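/- **Setting.** Let $d_1,d_2\ge 2$ and $m\ge 1$ be integers. For an integer $d\ge 2$ let $B_d$ be the cardinal B-spline of degree $d$ with knots $0,1,\dots,d+1$, and let $\hat\alpha^{(d)},\hat\beta^{(d)}\in\mathbb R^d$ be the solution of the nonsingular $2d\times 2d$ linear system $$\sum_{r=1}^{d}\bigl(\hat\alpha_r B_d(r-l)-\hat\beta_r B_d'(r-l)\bigr)=\delta_{l,0}\quad(-d<l<d),\qquad \sum_{r=1}^d\hat\beta_r=0 .$$ Let $\Omega=[a_1,b_1]\times[a_2,b_2]$ with $b_1=a_1+N_1h_x$, $b_2=a_2+N_2h_y$, $h_x,h_y>0$, $N_1,N_2\ge 1$, and let $\Omega_e=[a_1-d_1h_x,\,b_1+d_1h_x]\times[a_2-d_2h_y,\,b_2+d_2h_y]$. For $\ell\ge 0$ put $h_{x,\ell}=h_x/2^\ell$, $h_{y,\ell}=h_y/2^\ell$, $x_i^\ell=a_1+ih_{x,\ell}$, $y_j^\ell=a_2+jh_{y,\ell}$; let $G^\ell$ be the set of closed cells $[x_i^\ell,x_{i+1}^\ell]\times[y_j^\ell,y_{j+1}^\ell]$ covering $\Omega$,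 and for $J=(j,i)$ with $-d_1\le i\le 2^\ell N_1-1$, $-d_2\le j\le 2^\ell N_2-1$ let $$B_J^\ell(x,y)=B_{d_1}\bigl((x-a_1)/h_{x,\ell}-i\bigr)\,B_{d_2}\bigl((y-a_2)/h_{y,\ell}-j\bigr),\qquad \Lambda_J^\ell=[x^\ell_{i+1},x^\ell_{i+d_1}]\times[y^\ell_{j+1},y^\ell_{j+d_2}],$$ $$\lambda_J^\ell(f)=\sum_{r=1}^{d_1}\sum_{s=1}^{d_2}\Bigl(\hat\alpha^{(d_2)}_s\hat\alpha^{(d_1)}_r f-h_{x,\ell}\hat\alpha^{(d_2)}_s\hat\beta^{(d_1)}_r f_x-h_{y,\ell}\hat\beta^{(d_2)}_s\hat\alpha^{(d_1)}_r f_y+h_{x,\ell}h_{y,\ell}\hat\beta^{(d_2)}_s\hat\beta^{(d_1)}_r f_{xy}\Bigr)(x^\ell_{i+r},y^\ell_{j+s}).$$ Let $\Omega=\Omega^0\supseteq\Omega^1\supseteq\dots\supseteq\Omega^{M-1}$, $\Omega^M=\emptyset$, where each $\Omega^{\ell}$, $1\le\ell<M$, is a union of cells of $G^{\ell-1}$.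 The set $\mathcal G^k$ of active cells of level $k$ consists of the $c\in G^k$ with $c\subseteq\Omega^k$ that contain no cell $c^*\in G^{\ell^*}$, $\ell^*>k$, with $c^*\subseteq\Omega^{\ell^*}$; the hierarchical mesh is the union of $\mathcal G^0,\dots,\mathcal G^{M-1}$. With $\operatorname{supp}B_J^\ell$ denoting the support intersected with $\Omega$, let $A^\ell$ be the set of indices $J$ of level $\ell$ with $\operatorname{supp}B_J^\ell\subseteq\Omega^\ell$ and $\operatorname{supp}B_J^\ell\not\subseteq\Omega^{\ell+1}$. If $s=\sum_J\sigma_JB_J^{\ell}$ on $\Omega$, then $\operatorname{trunc}^{\ell}s$ is the same sum restricted to the $J$ with $\operatorname{supp}B_J^{\ell}\not\subseteq\Omega^{\ell}$; the THB-splines are $T_J^\ell=\operatorname{trunc}^{M-1}(\cdots(\operatorname{trunc}^{\ell+1}B_J^\ell)\cdots)$, $J\in A^\ell$, $0\le\ell<M$. The hierarchical Hermite BS quasi-interpolant is $$Q_{\mathcal H}(f)=\sum_{\ell=0}^{M-1}\sum_{J\in A^\ell}\lambda_J^\ell(f)\,T_J^\ell .$$ The mesh is called admissible of class $m$, $1\le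 m<M$, if for every $k$ and every $c\in\mathcal G^k$ the THB-splines that take non-zero values on $c$ belong to the at most $m$ successive levels $k_m,\dots,k$, where $k_m=\max\{0,k-m+1\}$. For $c\in\mathcal G^k$ let $A^\ell(c)=\{J\in A^\ell: c\subseteq\operatorname{supp}T_J^\ell\}$ and $$C=\bigcup_{\ell=k_m}^{k}\ \bigcup_{J\in A^\ell(c)}(\Lambda_J^\ell\cup c).$$ Write $\|g\|_S=\sup_{S}|g|$, and let $C^{(p,q)}(\Omega_e)$ be the set of functions whose partial derivatives $f^{(r,s)}$ ($r\le p$ in $x$, $s\le q$ in $y$) all exist and are continuous on $\Omega_e$. **Theorem.** There are positive constants $v_1,v_2,v_3$, depending only on $d_1,d_2$ and $m$, such that for every hierarchical mesh as above that is admissible of class $m$, every $f\in C^{(d_1+1,d_2+1)}(\Omega_e)$, every $k=0,\dots,M-1$ and every active cell $c\in\mathcal G^k$, $$\|f-Q_{\mathcal H}(f)\|_c\le v_1\|f^{(d_1+1,0)}\|_C\,h_{x,k}^{d_1+1}+v_2\|f^{(0,d_2+1)}\|_C\,h_{y,k}^{d_2+1}+v_3\|f^{(d_1+1,d_2+1)}\|_C\,h_{x,k}^{d_1+1}h_{y,k}^{d_2+1}.$$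 -/

import Mathlib

noncomputable section

namespace HermiteBS

/-! ### Univariate B-splines and the coefficients of the BS functionals -/

/-- The cardinal B-spline of degree `d` with knots `0, 1, …, d + 1` (Cox - de Boor recursion). -/
def bspline : ℕ → ℝ → ℝ
  | 0, x => (Set.Ico (0 : ℝ) 1).indicator 1 x
  | d + 1, x => (x * bspline d x + (d + 2 - x) * bspline d (x - 1)) / (d + 1)

/-- The square `2d × 2d` linear system (unknowns `α`, `β`; `2d - 1` equations indexed by `l`, plus
one) that determines the coefficients of the BS Hermite functional
`f ↦ ∑ r, α r * f (r + 1) - ∑ r, β r * f' (r + 1)`, with the integers `1, …, d` as nodes: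
the functional is dual to the `2d - 1` B-splines of degree `d` that do not vanish on `[1, d]`,
and the entries of `β` sum to zero. -/
def IsBSSolution (d : ℕ) (α β : Fin d → ℝ) : Prop :=
  (∀ l : ℤ, -(d : ℤ) < l → l < d →
    ∑ r : Fin d, (α r * bspline d (((r : ℕ) : ℝ) + 1 - l)
        - β r * deriv (bspline d) (((r : ℕ) : ℝ) + 1 - l))
      = if l = 0 then 1 else 0) ∧
  ∑ r : Fin d, β r = 0

/-- The coefficient vectors `(α̂, β̂)`: the solution of the system above. -/
def bsCoeff (d : ℕ) : (Fin d → ℝ) × (Fin d → ℝ) :=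
  Classical.epsilon fun c => IsBSSolution d c.1 c.2

/-- The coefficients `α̂` of the function values. -/
def bsAlpha (d : ℕ) : Fin d → ℝ := (bsCoeff d).1

/-- The coefficients `β̂` of the derivative values. -/
def bsBeta (d : ℕ) : Fin d → ℝ := (bsCoeff d).2

/-! ### Mixed partial derivatives, mixed smoothness, uniform norms -/

/-- The mixed partial derivative `f^{(r,s)}` on the rectangle `X ×ˢ Y`
(one-sided on the boundary of the rectangle). -/
def mixedDeriv (X Y : Set ℝ) (r s : ℕ) (f : ℝ × ℝ → ℝ) (p : ℝ × ℝ) : ℝ :=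
  iteratedDerivWithin s (fun y => iteratedDerivWithin r (fun x => f (x, y)) X p.1) Y p.2

/-- `f ∈ C^{(p,q)}(X ×ˢ Y)`: all the partial derivatives `f^{(r,s)}` with `r ≤ p` and `s ≤ q`
exist and are continuous on `X ×ˢ Y`. -/
structure MixedContDiffOn (p q : ℕ) (f : ℝ × ℝ → ℝ) (X Y : Set ℝ) : Prop where
  contDiffOn_fst : ∀ y ∈ Y, ContDiffOn ℝ p (fun x => f (x, y)) X
  contDiffOn_snd : ∀ r ≤ p, ∀ x ∈ X,
    ContDiffOn ℝ q (fun y => iteratedDerivWithin r (fun t => f (t, y)) X x) Y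
  continuousOn : ∀ r ≤ p, ∀ s ≤ q, ContinuousOn (mixedDeriv X Y r s f) (X ×ˢ Y)

/-- The uniform norm `‖g‖_S` of `g` on the set `S`. -/
def supNorm (S : Set (ℝ × ℝ)) (g : ℝ × ℝ → ℝ) : ℝ := sSup ((fun p => |g p|) '' S)

/-! ### Dyadic uniform tensor-product grids -/

/-- An initial uniform grid of `N₁ × N₂` cells of size `hx × hy` on the rectangle
`[a₁, a₁ + N₁ hx] × [a₂, a₂ + N₂ hy]`. -/
structure TensorGrid where
  a₁ : ℝ
  a₂ : ℝ
  hx : ℝ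
  hy : ℝ
  N₁ : ℕ
  N₂ : ℕ
  hx_pos : 0 < hx
  hy_pos : 0 < hy
  N₁_pos : 0 < N₁
  N₂_pos : 0 < N₂

namespace TensorGrid

variable (G : TensorGrid)

/-- The domain `Ω`. -/
def domain : Set (ℝ × ℝ) :=
  Set.Icc G.a₁ (G.a₁ + G.N₁ * G.hx) ×ˢ Set.Icc G.a₂ (G.a₂ + G.N₂ * G.hy)

/-- The first factor of the enlarged domain `Ω_e`. -/
def extX (d₁ : ℕ) : Set ℝ := Set.Icc (G.a₁ - d₁ * G.hx) (G.a₁ + G.N₁ * G.hx + d₁ * G.hx)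

/-- The second factor of the enlarged domain `Ω_e`. -/
def extY (d₂ : ℕ) : Set ℝ := Set.Icc (G.a₂ - d₂ * G.hy) (G.a₂ + G.N₂ * G.hy + d₂ * G.hy)

/-- The step `h_{x,ℓ}` of level `ℓ`. -/
def stepX (ℓ : ℕ) : ℝ := G.hx / 2 ^ ℓ

/-- The step `h_{y,ℓ}` of level `ℓ`. -/
def stepY (ℓ : ℕ) : ℝ := G.hy / 2 ^ ℓ

/-- The abscissa `x_i` of level `ℓ`. -/
def nodeX (ℓ : ℕ) (i : ℤ) : ℝ := G.a₁ + i * G.stepX ℓ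

/-- The ordinate `y_j` of level `ℓ`. -/
def nodeY (ℓ : ℕ) (j : ℤ) : ℝ := G.a₂ + j * G.stepY ℓ

/-- The grid `G^ℓ`: the collection of the closed cells of level `ℓ` that cover `Ω`. -/
def cells (ℓ : ℕ) : Set (Set (ℝ × ℝ)) :=
  {c | ∃ i j : ℤ, 0 ≤ i ∧ i < 2 ^ ℓ * G.N₁ ∧ 0 ≤ j ∧ j < 2 ^ ℓ * G.N₂ ∧
    c = Set.Icc (G.nodeX ℓ i) (G.nodeX ℓ (i + 1)) ×ˢ Set.Icc (G.nodeY ℓ j) (G.nodeY ℓ (j + 1))}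

/-- The index set `Γ` of the B-splines of level `ℓ` that do not vanish identically on `Ω`.
A multi-index is written `J = (i, j)`, with `i` for the variable `x` and `j` for `y`. -/
def indices (d₁ d₂ ℓ : ℕ) : Finset (ℤ × ℤ) :=
  Finset.Ico (-(d₁ : ℤ)) (2 ^ ℓ * G.N₁) ×ˢ Finset.Ico (-(d₂ : ℤ)) (2 ^ ℓ * G.N₂)

/-- The tensor-product B-spline `B_J^ℓ`. -/
def basisFun (d₁ d₂ ℓ : ℕ) (J : ℤ × ℤ) (p : ℝ × ℝ) : ℝ :=
  bspline d₁ ((p.1 - G.a₁) / G.stepX ℓ - J.1) * bspline d₂ ((p.2 - G.a₂) / G.stepY ℓ - J.2)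

/-- `supp B_J^ℓ`: the intersection of the support of `B_J^ℓ` with `Ω`. -/
def suppBasis (d₁ d₂ ℓ : ℕ) (J : ℤ × ℤ) : Set (ℝ × ℝ) :=
  tsupport (G.basisFun d₁ d₂ ℓ J) ∩ G.domain

/-- The functional `λ_J^ℓ` of the tensor-product Hermite BS scheme of level `ℓ`. -/
def functional (d₁ d₂ ℓ : ℕ) (J : ℤ × ℤ) (f : ℝ × ℝ → ℝ) : ℝ :=
  ∑ r : Fin d₁, ∑ s : Fin d₂,
    let z : ℝ × ℝ := (G.nodeX ℓ (J.1 + ((r : ℕ) : ℤ) + 1), G.nodeY ℓ (J.2 + ((s : ℕ) : ℤ) + 1))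
    let D : ℕ → ℕ → ℝ := fun u v => mixedDeriv (G.extX d₁) (G.extY d₂) u v f z
    bsAlpha d₂ s * f z * bsAlpha d₁ r
      - G.stepX ℓ * (bsAlpha d₂ s * D 1 0 * bsBeta d₁ r)
      - G.stepY ℓ * (bsBeta d₂ s * D 0 1 * bsAlpha d₁ r)
      + G.stepX ℓ * G.stepY ℓ * (bsBeta d₂ s * D 1 1 * bsBeta d₁ r)

/-- The support `Λ_J^ℓ = [x_{i+1}, x_{i+d₁}] × [y_{j+1}, y_{j+d₂}]` of `λ_J^ℓ`. -/
def functionalSupp (d₁ d₂ ℓ : ℕ) (J : ℤ × ℤ) : Set (ℝ × ℝ) :=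
  Set.Icc (G.nodeX ℓ (J.1 + 1)) (G.nodeX ℓ (J.1 + d₁)) ×ˢ
    Set.Icc (G.nodeY ℓ (J.2 + 1)) (G.nodeY ℓ (J.2 + d₂))

end TensorGrid

/-! ### Hierarchical meshes and truncated hierarchical B-splines -/

/-- A hierarchy of closed subdomains `Ω = Ω^0 ⊇ Ω^1 ⊇ … ⊇ Ω^{M-1}`, `Ω^M = ∅`, of depth `M`, over
the dyadic refinements of a uniform grid; each `Ω^{ℓ+1}` is a union of cells of level `ℓ`. -/
structure Hierarchy extends TensorGrid where
  M : ℕ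
  M_pos : 0 < M
  sub : ℕ → Set (ℝ × ℝ)
  sub_zero : sub 0 = toTensorGrid.domain
  sub_succ_subset : ∀ ℓ, sub (ℓ + 1) ⊆ sub ℓ
  sub_eq_union : ∀ ℓ, ∃ S ⊆ toTensorGrid.cells ℓ, sub (ℓ + 1) = ⋃₀ S
  sub_eq_empty : ∀ ℓ, M ≤ ℓ → sub ℓ = ∅

namespace Hierarchy

variable (H : Hierarchy)

/-- The set `𝒢^ℓ` of the active cells of level `ℓ`; the hierarchical mesh is the union of
the sets `𝒢^ℓ`, `ℓ < M`. -/
def activeCells (ℓ : ℕ) : Set (Set (ℝ × ℝ)) :=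
  {c | c ∈ H.cells ℓ ∧ c ⊆ H.sub ℓ ∧ ¬ ∃ ℓ' > ℓ, ∃ c' ∈ H.cells ℓ', c' ⊆ H.sub ℓ' ∧ c' ⊂ c}

open scoped Classical in
/-- The set `A^ℓ` of the active multi-indices of level `ℓ`. -/
def activeIndices (d₁ d₂ ℓ : ℕ) : Finset (ℤ × ℤ) :=
  (H.indices d₁ d₂ ℓ).filter fun J =>
    H.suppBasis d₁ d₂ ℓ J ⊆ H.sub ℓ ∧ ¬ H.suppBasis d₁ d₂ ℓ J ⊆ H.sub (ℓ + 1)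

/-- The coefficients on `Ω` of a function `s` in the B-spline basis of level `ℓ`
(unique on the index set of level `ℓ` whenever `s` is in the span of this basis). -/
def coeffs (d₁ d₂ ℓ : ℕ) (s : ℝ × ℝ → ℝ) : ℤ × ℤ → ℝ :=
  Classical.epsilon fun σ : ℤ × ℤ → ℝ =>
    ∀ p ∈ H.domain, s p = ∑ J ∈ H.indices d₁ d₂ ℓ, σ J * H.basisFun d₁ d₂ ℓ J p

open scoped Classical in
/-- The truncation `trunc^ℓ s` with respect to the B-spline basis of level `ℓ` and `Ω^ℓ`. -/
def trunc (d₁ d₂ ℓ : ℕ) (s : ℝ × ℝ → ℝ) : ℝ × ℝ → ℝ := fun p =>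
  ∑ J ∈ (H.indices d₁ d₂ ℓ).filter (fun J => ¬ H.suppBasis d₁ d₂ ℓ J ⊆ H.sub ℓ),
    H.coeffs d₁ d₂ ℓ s J * H.basisFun d₁ d₂ ℓ J p

/-- The composition `trunc^{ℓ+n} ∘ ⋯ ∘ trunc^{ℓ+1}`. -/
def truncIter (d₁ d₂ ℓ : ℕ) : ℕ → (ℝ × ℝ → ℝ) → ℝ × ℝ → ℝ
  | 0, s => s
  | n + 1, s => H.trunc d₁ d₂ (ℓ + n + 1) (truncIter d₁ d₂ ℓ n s)

/-- The truncated hierarchical B-spline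
`T_J^ℓ = trunc^{M-1} (⋯ (trunc^{ℓ+1} B_J^ℓ) ⋯)`, for `ℓ < M`. -/
def thb (d₁ d₂ ℓ : ℕ) (J : ℤ × ℤ) : ℝ × ℝ → ℝ :=
  H.truncIter d₁ d₂ ℓ (H.M - 1 - ℓ) (H.basisFun d₁ d₂ ℓ J)

/-- `A^ℓ(c)`: the active multi-indices of level `ℓ` whose THB-spline acts on `c`. -/
def actingIndices (d₁ d₂ ℓ : ℕ) (c : Set (ℝ × ℝ)) : Set (ℤ × ℤ) :=
  {J | J ∈ H.activeIndices d₁ d₂ ℓ ∧ c ⊆ tsupport (H.thb d₁ d₂ ℓ J)}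

/-- The hierarchical mesh is admissible of class `m`, `1 ≤ m < M`: the THB-splines that take
non-zero values on an active cell of level `k` belong to the (at most) `m` successive levels
`max 0 (k - m + 1), …, k`. -/
def IsAdmissible (d₁ d₂ m : ℕ) : Prop :=
  1 ≤ m ∧ m < H.M ∧
    ∀ k < H.M, ∀ c ∈ H.activeCells k, ∀ ℓ < H.M, ∀ J ∈ H.activeIndices d₁ d₂ ℓ,
      (∃ p ∈ c, H.thb d₁ d₂ ℓ J p ≠ 0) → k + 1 - m ≤ ℓ ∧ ℓ ≤ k

/-- The hierarchical Hermite BS quasi-interpolant `Q_ℋ(f)`. -/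
def quasiInterp (d₁ d₂ : ℕ) (f : ℝ × ℝ → ℝ) (p : ℝ × ℝ) : ℝ :=
  ∑ ℓ ∈ Finset.range H.M, ∑ J ∈ H.activeIndices d₁ d₂ ℓ,
    H.functional d₁ d₂ ℓ J f * H.thb d₁ d₂ ℓ J p

/-- The local set `C` of a cell `c` of level `k` (the subtraction is truncated at zero, so
`k + 1 - m` is `max 0 (k - m + 1)`). -/
def localSet (d₁ d₂ m k : ℕ) (c : Set (ℝ × ℝ)) : Set (ℝ × ℝ) :=
  ⋃ ℓ ∈ Set.Icc (k + 1 - m) k, ⋃ J ∈ H.actingIndices d₁ d₂ ℓ c, (H.functionalSupp d₁ d₂ ℓ J ∪ c)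

end Hierarchy

end HermiteBS

end

/-! The error bound follows the classical pattern for quasi-interpolants: reproduction of
polynomials, locality, and stability, all of them carried over from the tensor-product scheme of one
level to the hierarchical scheme.

*Reproduction.* The linear system for the coefficients `(α̂, β̂)` says that the univariate
functionals are dual to the B-splines. Read off coefficient by coefficient, it is a Bézout identity
between the Euler polynomials `E_d` and `(1 - X) E_{d-1}`, where the coefficients of `E_d` are the
values of `B_d` at the integers. It is solvable because `E_{d-1}` has simple real roots, which by
the recursion of the Euler polynomials are not shared by `E_d` (`exists_isBSSolution`). By Marsden's
identity the B-splines span the polynomials, so duality gives reproduction of the polynomials of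
bidegree `(d₁, d₂)` on every single level (`TensorGrid.taylorFamily_eq_sum`). Truncation preserves
coefficients: a function whose B-spline coefficients of level `ℓ` are `σ ℓ`, for every `ℓ`, is
`∑ σ ℓ J * T_J^ℓ` over the active indices (`Hierarchy.sum_thb_eq`). Hence `Q_ℋ` reproduces
polynomials as well, and, since the B-splines sum to one, the THB-splines are a convex partition of
unity.

*Stability.* Let `p` be a point of the active cell `c` and let `g` be `f` minus its Taylor
polynomial of bidegree `(d₁, d₂)` at `p`. Then `f p - Q_ℋ f p` is minus a convex combination of the
numbers `λ_J^ℓ g` for the THB-splines that do not vanish at `p`, so it is enough to bound `g` and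
its derivatives of orders at most `(1, 1)` on the supports `Λ_J^ℓ`, in units of the steps of level `k`.
All derivatives of `g` of orders up to `(d₁, d₂)` vanish at `p`, while those of orders
`(d₁ + 1, 0)`, `(0, d₂ + 1)` and `(d₁ + 1, d₂ + 1)` coincide with those of `f` and are bounded on
the local set `C` by the right-hand side of the estimate. On a rectangle of size comparable to the
steps such bounds, together with bounds for the derivatives of lower orders at one point, control
these derivatives on the whole rectangle: the Landau inequality handles the derivatives of orders
`(d₁ + 1, s)` and `(r, d₂ + 1)`, and integration from the point the others
(`exists_propagation_bound`).

*Locality.* The convex hull of `C` may be larger than `C`, so the bounds have to travel from `c` to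
each `Λ_J^ℓ` inside `C`, from rectangle to rectangle. The THB-splines acting on `c` are those of
which a descendant of level `k`, surviving all truncations, covers `c`. For a B-spline of level `k`
that covers `c`, the support of the functional meets `c`. If this B-spline is contained in `Ω^k`, it
is active and the support of its functional is one of the rectangles of `C`. Otherwise all its
parents also have a surviving descendant covering `c`; the supports of their functionals cover the
support of the given one and share a point (here the degrees must be at least two), so that an
induction on the level reaches all the active ancestors (`Hierarchy.propagate_to_ancestors`).
Admissibility bounds the number of levels in this induction by `m`, and with it the number of
rectangles to be crossed and the ratio of their sizes to the steps of level `k`. -/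

noncomputable section

namespace HermiteBS

section

open Polynomial

/-! ### Positivity and support of the B-splines -/

lemma bspline_succ (d : ℕ) (x : ℝ) :
    bspline (d + 1) x = (x * bspline d x + (d + 2 - x) * bspline d (x - 1)) / (d + 1) := rfl

lemma bspline_nonneg_and_eq_zero (d : ℕ) (x : ℝ) :
    0 ≤ bspline d x ∧ (x < 0 ∨ (d : ℝ) + 1 ≤ x → bspline d x = 0) := by
  induction d generalizing x with
  | zero =>
    refine ⟨Set.indicator_nonneg (fun _ _ => zero_le_one) x, fun h => ?_⟩
    apply Set.indicator_of_notMem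
    rintro ⟨h0, h1⟩
    norm_num at h
    rcases h with h | h <;> linarith
  | succ d ih =>
    have h1 := ih x
    have h2 := ih (x - 1)
    refine ⟨?_, fun h => ?_⟩
    · rw [bspline_succ]
      refine div_nonneg (add_nonneg ?_ ?_) (by positivity)
      · rcases lt_or_ge x 0 with h | h
        · rw [h1.2 (Or.inl h), mul_zero]
        · exact mul_nonneg h h1.1
      · rcases le_or_gt x (d + 2) with h | h
        · exact mul_nonneg (by linarith) h2.1
        · rw [h2.2 (Or.inr (by linarith)), mul_zero]
    · push_cast at h
      rw [bspline_succ, h1.2 (by rcases h with h | h; exacts [Or.inl h, Or.inr (by linarith)]),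
        h2.2 (by rcases h with h | h; exacts [Or.inl (by linarith), Or.inr (by linarith)])]
      simp

lemma bspline_nonneg (d : ℕ) (x : ℝ) : 0 ≤ bspline d x := (bspline_nonneg_and_eq_zero d x).1

lemma bspline_eq_zero_of_neg {d : ℕ} {x : ℝ} (h : x < 0) : bspline d x = 0 :=
  (bspline_nonneg_and_eq_zero d x).2 (Or.inl h)

lemma bspline_eq_zero_of_ge {d : ℕ} {x : ℝ} (h : (d : ℝ) + 1 ≤ x) : bspline d x = 0 :=
  (bspline_nonneg_and_eq_zero d x).2 (Or.inr h)

lemma bspline_eq_zero_of_nonpos {d : ℕ} (hd : 1 ≤ d) {x : ℝ} (h : x ≤ 0) : bspline d x = 0 := by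
  rcases h.lt_or_eq with h | rfl
  · exact bspline_eq_zero_of_neg h
  · obtain ⟨d, rfl⟩ := Nat.exists_eq_add_of_le' hd
    rw [bspline_succ, bspline_eq_zero_of_neg (by norm_num : (0 : ℝ) - 1 < 0)]
    simp

lemma bspline_pos {d : ℕ} {x : ℝ} (h0 : 0 < x) (h1 : x < d + 1) : 0 < bspline d x := by
  induction d generalizing x with
  | zero =>
    have : x ∈ Set.Ico (0 : ℝ) 1 := ⟨h0.le, by simpa using h1⟩
    simp [bspline, this]
  | succ d ih =>
    push_cast at h1
    rw [bspline_succ]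
    apply div_pos _ (by positivity)
    rcases lt_or_ge x (d + 1) with h | h
    · exact add_pos_of_pos_of_nonneg (mul_pos h0 (ih h0 h))
        (mul_nonneg (by linarith) (bspline_nonneg _ _))
    · refine add_pos_of_nonneg_of_pos (mul_nonneg h0.le (bspline_nonneg _ _))
        (mul_pos (by linarith) ?_)
      rcases Nat.eq_zero_or_pos d with rfl | hd
      · have : x - 1 ∈ Set.Ico (0 : ℝ) 1 := by
          norm_num at h h1 ⊢; exact ⟨h, by linarith⟩
        simp [bspline, this]
      · have : (1 : ℝ) ≤ d := by exact_mod_cast hd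
        exact ih (by linarith) (by linarith)

lemma bspline_ne_zero_iff {d : ℕ} (hd : 1 ≤ d) {x : ℝ} :
    bspline d x ≠ 0 ↔ 0 < x ∧ x < d + 1 := by
  refine ⟨fun h => ?_, fun h => (bspline_pos h.1 h.2).ne'⟩
  by_contra h'
  rw [not_and_or, not_lt, not_lt] at h'
  rcases h' with h' | h'
  · exact h (bspline_eq_zero_of_nonpos hd h')
  · exact h (bspline_eq_zero_of_ge h')

/-! ### Differentiability -/

lemma hasDerivAt_max_zero_sq (x : ℝ) : HasDerivAt (fun t : ℝ => max t 0 ^ 2) (2 * max x 0) x := by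
  rcases lt_trichotomy x 0 with h | rfl | h
  · rw [max_eq_right h.le, mul_zero]
    refine (hasDerivAt_const x (0 : ℝ)).congr_of_eventuallyEq ?_
    filter_upwards [eventually_lt_nhds h] with t ht
    simp [max_eq_right ht.le]
  · rw [max_self, mul_zero, hasDerivAt_iff_isLittleO_nhds_zero]
    refine Asymptotics.IsBigO.trans_isLittleO (g := fun t : ℝ => t ^ 2) ?_ ?_
    · refine Asymptotics.IsBigO.of_bound 1 (Filter.Eventually.of_forall fun t => ?_)
      simp only [zero_add, max_self, smul_zero, sub_zero, Real.norm_eq_abs, one_mul, abs_pow, sq_abs]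
      simp only [ne_eq, OfNat.ofNat_ne_zero, not_false_eq_true, zero_pow, sub_zero, abs_pow, sq_abs]
      rcases le_total t 0 with ht | ht
      · rw [max_eq_right ht]; simpa using sq_nonneg t
      · rw [max_eq_left ht]
    · exact Asymptotics.isLittleO_pow_id one_lt_two
  · rw [max_eq_left h.le]
    have := hasDerivAt_pow 2 x
    refine HasDerivAt.congr_of_eventuallyEq (f := fun t : ℝ => t ^ 2) (by simpa using this) ?_
    filter_upwards [eventually_gt_nhds h] with t ht
    simp [max_eq_left ht.le]

lemma bspline_one_eq (x : ℝ) :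
    bspline 1 x = max x 0 - 2 * max (x - 1) 0 + max (x - 2) 0 := by
  rw [bspline_succ]
  simp only [bspline, Set.indicator, Set.mem_Ico, Pi.one_apply]
  push_cast
  rcases lt_or_ge x 0 with h | h
  · rw [max_eq_right h.le, max_eq_right (by linarith), max_eq_right (by linarith),
      if_neg (by intro h'; linarith [h'.1]), if_neg (by intro h'; linarith [h'.1])]
    ring
  rcases lt_or_ge x 1 with h1 | h1
  · rw [max_eq_left h, max_eq_right (by linarith), max_eq_right (by linarith),
      if_pos ⟨h, h1⟩, if_neg (by intro h'; linarith [h'.1])]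
    ring
  rcases lt_or_ge x 2 with h2 | h2
  · rw [max_eq_left h, max_eq_left (by linarith), max_eq_right (by linarith),
      if_neg (by intro h'; linarith [h'.2]), if_pos ⟨by linarith, by linarith⟩]
    ring
  · rw [max_eq_left h, max_eq_left (by linarith), max_eq_left (by linarith),
      if_neg (by intro h'; linarith [h'.2]), if_neg (by intro h'; linarith [h'.2])]
    ring

lemma mul_max_zero (t : ℝ) : t * max t 0 = max t 0 ^ 2 := by
  rcases le_total t 0 with h | h
  · simp [max_eq_right h]
  · simp [max_eq_left h, sq]

lemma bspline_two_eq (x : ℝ) : bspline 2 x =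
    (max x 0 ^ 2 - 3 * max (x - 1) 0 ^ 2 + 3 * max (x - 2) 0 ^ 2 - max (x - 3) 0 ^ 2) / 2 := by
  rw [bspline_succ, bspline_one_eq, bspline_one_eq]
  have h0 := mul_max_zero x
  have h1 := mul_max_zero (x - 1)
  have h2 := mul_max_zero (x - 2)
  have h3 := mul_max_zero (x - 3)
  rw [show x - 1 - 1 = x - 2 by ring, show x - 1 - 2 = x - 3 by ring]
  push_cast
  linear_combination (1 / 2) * h0 - (3 / 2) * h1 + (3 / 2) * h2 - (1 / 2) * h3

/-- The derivative of a B-spline of degree at least two is a difference of B-splines of the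
previous degree. The base case goes through truncated powers, since the recursion passes through
the hat function, which is not differentiable. -/
lemma hasDerivAt_bspline {d : ℕ} (hd : 1 ≤ d) (x : ℝ) :
    HasDerivAt (bspline (d + 1)) (bspline d x - bspline d (x - 1)) x := by
  induction d, hd using Nat.le_induction generalizing x with
  | base =>
    have key : ∀ a : ℝ, HasDerivAt (fun t : ℝ => max (t - a) 0 ^ 2) (2 * max (x - a) 0) x :=
      fun a => by
        have := (hasDerivAt_max_zero_sq (x - a)).comp x ((hasDerivAt_id x).sub_const a)
        simpa [Function.comp_def] using this
    have h := ((((key 0).sub ((key 1).const_mul 3)).add ((key 2).const_mul 3)).sub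
      (key 3)).div_const 2
    have e : bspline (1 + 1) = fun x => (max (x - 0) 0 ^ 2 - 3 * max (x - 1) 0 ^ 2
        + 3 * max (x - 2) 0 ^ 2 - max (x - 3) 0 ^ 2) / 2 := by
      funext t; rw [sub_zero]; exact bspline_two_eq t
    rw [e]
    refine h.congr_deriv ?_
    rw [bspline_one_eq, bspline_one_eq, show x - 1 - 1 = x - 2 by ring,
      show x - 1 - 2 = x - 3 by ring, sub_zero]
    ring
  | succ d hd ih =>
    have h1 := ih x
    have h2 : HasDerivAt (fun t => bspline (d + 1) (t - 1))
        (bspline d (x - 1) - bspline d (x - 1 - 1)) x := by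
      simpa [Function.comp_def] using (ih (x - 1)).comp x ((hasDerivAt_id x).sub_const 1)
    have h := (((hasDerivAt_id x).mul h1).add
      (((hasDerivAt_id x).const_sub ((d : ℝ) + 1 + 2)).mul h2)).div_const ((d : ℝ) + 1 + 1)
    have e : bspline (d + 1 + 1) = fun x => (x * bspline (d + 1) x +
        ((d : ℝ) + 1 + 2 - x) * bspline (d + 1) (x - 1)) / ((d : ℝ) + 1 + 1) := by
      funext t; rw [bspline_succ (d + 1)]; push_cast; rfl
    rw [e]
    refine h.congr_deriv ?_
    rw [bspline_succ d x, bspline_succ d (x - 1)]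
    have h0 : (d : ℝ) + 1 ≠ 0 := by positivity
    have h0' : (d : ℝ) + 1 + 1 ≠ 0 := by positivity
    simp only [id]
    field_simp
    ring

/-! ### Marsden's identity: B-splines reproduce polynomials -/

/-- The dual polynomial `∏ j, (i + j + 1 - X)` over the interior knots `i + 1, …, i + d` of the
`i`-th B-spline. -/
def dualPoly (d : ℕ) (i : ℤ) : ℝ[X] := ∏ j ∈ Finset.range d, (C ((i : ℝ) + j + 1) - X)

lemma dualPoly_succ (d : ℕ) (i : ℤ) :
    dualPoly (d + 1) i = dualPoly d i * (C ((i : ℝ) + d + 1) - X) := Finset.prod_range_succ _ _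

lemma dualPoly_succ' (d : ℕ) (i : ℤ) :
    dualPoly (d + 1) (i - 1) = dualPoly d i * (C (i : ℝ) - X) := by
  rw [dualPoly, Finset.prod_range_succ', dualPoly]
  congr 1
  · refine Finset.prod_congr rfl fun j _ => ?_
    congr 2; push_cast; ring
  · congr 2; push_cast; ring

/-- Marsden's identity on the knot interval `[n, n + 1)`, where only `d + 1` of the B-splines are
present. -/
lemma marsden_floor (d : ℕ) (n : ℤ) (x : ℝ) (h0 : (n : ℝ) ≤ x) (h1 : x < n + 1) :
    ∑ t ∈ Finset.range (d + 1), C (bspline d (x - ((n - t : ℤ) : ℝ))) * dualPoly d (n - t)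
      = (C x - X) ^ d := by
  induction d with
  | zero =>
    have : x - n ∈ Set.Ico (0 : ℝ) 1 := ⟨by linarith, by linarith⟩
    simp [dualPoly, bspline, this]
  | succ d ih =>
    have hd : (d : ℝ) + 1 ≠ 0 := by positivity
    have e : ∀ t ∈ Finset.range (d + 1 + 1),
        C (bspline (d + 1) (x - ((n - t : ℤ) : ℝ))) * dualPoly (d + 1) (n - t) =
        C ((x - ((n - t : ℤ) : ℝ)) / (d + 1) * bspline d (x - ((n - t : ℤ) : ℝ))) *
          dualPoly (d + 1) (n - t)
        + C ((d + 2 - (x - ((n - t : ℤ) : ℝ))) / (d + 1) *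
          bspline d (x - ((n - t : ℤ) : ℝ) - 1)) * dualPoly (d + 1) (n - t) := by
      intro t _
      rw [← add_mul, ← C_add, bspline_succ]
      congr 2
      field_simp
    rw [Finset.sum_congr rfl e, Finset.sum_add_distrib, Finset.sum_range_succ,
      Finset.sum_range_succ' _ (d + 1), pow_succ, ← ih, Finset.sum_mul]
    have z1 : bspline d (x - ((n - (d + 1 : ℕ) : ℤ) : ℝ)) = 0 :=
      bspline_eq_zero_of_ge (by push_cast; linarith)
    have z2 : bspline d (x - ((n - (0 : ℕ) : ℤ) : ℝ) - 1) = 0 :=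
      bspline_eq_zero_of_neg (by push_cast; linarith)
    rw [z1, z2]
    simp only [mul_zero, C_0, zero_mul, add_zero]
    rw [← Finset.sum_add_distrib]
    refine Finset.sum_congr rfl fun t _ => ?_
    have a1 : (n - (t + 1 : ℕ) : ℤ) = (n - t) - 1 := by push_cast; ring
    rw [a1, dualPoly_succ' d (n - t), dualPoly_succ d (n - t)]
    have a2 : x - ((n - t - 1 : ℤ) : ℝ) - 1 = x - ((n - t : ℤ) : ℝ) := by push_cast; ring
    rw [a2]
    set b := bspline d (x - ((n - t : ℤ) : ℝ))
    set i := ((n - t : ℤ) : ℝ) with hi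
    have a3 : ((n - t - 1 : ℤ) : ℝ) = i - 1 := by rw [hi]; push_cast; ring
    rw [a3]
    have a4 : C ((x - i) / (d + 1) * b) * (C (i + d + 1) - X)
        + C ((d + 2 - (x - (i - 1))) / (d + 1) * b) * (C i - X) = C b * (C x - X) := by
      have : ∀ p q r s : ℝ, C p * (C q - X) + C r * (C s - X) =
          C (p * q + r * s) - C (p + r) * X := by
        intro p q r s; simp only [C_add, C_mul]; ring
      rw [this, mul_sub, ← C_mul]
      congr 2
      · field_simp; ring
      · congr 1; field_simp; ring
    linear_combination (dualPoly d (n - t)) * a4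

/-- A sum of translates at `x` over any finite set containing the non-vanishing ones reduces to the
`d + 1` translates indexed by `⌊x⌋ - d, …, ⌊x⌋`. -/
lemma sum_bspline_shift {d : ℕ} (w : ℤ → ℝ) (x : ℝ) (S : Finset ℤ)
    (hS : ∀ i : ℤ, bspline d (x - i) ≠ 0 → i ∈ S) :
    ∑ i ∈ S, w i * bspline d (x - i) = ∑ t ∈ Finset.range (d + 1),
      w (⌊x⌋ - t) * bspline d (x - ((⌊x⌋ - t : ℤ) : ℝ)) := by
  classical
  have inj : Set.InjOn (fun t : ℕ => ⌊x⌋ - (t : ℤ)) (Finset.range (d + 1)) := by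
    intro a _ b _ h; simpa using h
  rw [← Finset.sum_image (f := fun i : ℤ => w i * bspline d (x - i)) inj]
  have hT : ∀ i : ℤ, bspline d (x - i) ≠ 0 →
      i ∈ (Finset.range (d + 1)).image (fun t : ℕ => ⌊x⌋ - (t : ℤ)) := by
    intro i hi
    have h0 : (i : ℝ) ≤ x := by
      by_contra h; exact hi (bspline_eq_zero_of_neg (by linarith))
    have h1 : x < i + d + 1 := by
      by_contra h; exact hi (bspline_eq_zero_of_ge (by linarith))
    have h2 : i ≤ ⌊x⌋ := Int.le_floor.2 h0
    have h3 : ⌊x⌋ < i + d + 1 := Int.floor_lt.2 (by push_cast; exact h1)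
    rw [Finset.mem_image]
    exact ⟨(⌊x⌋ - i).toNat, by rw [Finset.mem_range]; omega, by omega⟩
  have key : ∀ U V : Finset ℤ, (∀ i : ℤ, bspline d (x - i) ≠ 0 → i ∈ U) →
      (∀ i : ℤ, bspline d (x - i) ≠ 0 → i ∈ V) → ∑ i ∈ U, w i * bspline d (x - i) =
      ∑ i ∈ U ∩ V, w i * bspline d (x - i) := fun U V _ hV => by
    refine (Finset.sum_subset Finset.inter_subset_left fun i hi hi' => ?_).symm
    by_contra h
    exact hi' (Finset.mem_inter.2 ⟨hi, hV i (right_ne_zero_of_mul h)⟩)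
  rw [key _ _ hS hT, key _ _ hT hS, Finset.inter_comm]

/-- Every polynomial of degree at most `d` is a combination of the integer translates of the
B-spline of degree `d`; at each point the sum may be taken over any finite set of translates
containing the non-vanishing ones. -/
theorem exists_bspline_coeff (d : ℕ) (u : ℝ[X]) (hu : u.natDegree ≤ d) :
    ∃ w : ℤ → ℝ, ∀ (x : ℝ) (S : Finset ℤ), (∀ i : ℤ, bspline d (x - i) ≠ 0 → i ∈ S) →
      ∑ i ∈ S, w i * bspline d (x - i) = u.eval x := by
  have key : ∀ (a : ℕ), a ≤ d → ∀ (x : ℝ) (S : Finset ℤ),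
      (∀ i : ℤ, bspline d (x - i) ≠ 0 → i ∈ S) →
      ∑ i ∈ S, ((dualPoly d i).coeff (d - a) * (-1) ^ (d - a) / (d.choose a)) *
        bspline d (x - i) = x ^ a := by
    intro a ha x S hS
    rw [sum_bspline_shift (fun i => (dualPoly d i).coeff (d - a) * (-1) ^ (d - a) / (d.choose a))
      x S hS]
    have h := congrArg (fun q : ℝ[X] => q.coeff (d - a))
      (marsden_floor d ⌊x⌋ x (Int.floor_le x) (Int.lt_floor_add_one x))
    simp only [finsetSum_coeff, coeff_C_mul] at h
    have hc : ((C x - X) ^ d : ℝ[X]).coeff (d - a) = (-1) ^ (d - a) * x ^ a * (d.choose a) := by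
      have : (C x - X : ℝ[X]) = C (-1) * (X + C (-x)) := by
        simp only [C_neg, C_1]; ring
      rw [this, mul_pow, ← C_pow, coeff_C_mul, coeff_X_add_C_pow, Nat.sub_sub_self ha,
        Nat.choose_symm ha, neg_pow x]
      have : ((-1 : ℝ)) ^ d = (-1) ^ (d - a) * (-1) ^ a := by rw [← pow_add, Nat.sub_add_cancel ha]
      rw [this]
      have h2 : ((-1 : ℝ)) ^ a * (-1) ^ a = 1 := by rw [← mul_pow]; simp
      linear_combination ((-1) ^ (d - a) * x ^ a * (d.choose a : ℝ)) * h2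
    have hch : (d.choose a : ℝ) ≠ 0 := by exact_mod_cast (Nat.choose_pos ha).ne'
    have h1 : ((-1 : ℝ)) ^ (d - a) * (-1) ^ (d - a) = 1 := by rw [← mul_pow]; simp
    calc _ = (∑ t ∈ Finset.range (d + 1), bspline d (x - ((⌊x⌋ - t : ℤ) : ℝ)) *
          (dualPoly d (⌊x⌋ - t)).coeff (d - a)) * ((-1) ^ (d - a) / (d.choose a)) := by
          rw [Finset.sum_mul]; exact Finset.sum_congr rfl fun t _ => by ring
      _ = x ^ a := by
          rw [h, hc]
          field_simp
          linear_combination x ^ a * h1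
  refine ⟨fun i => ∑ a ∈ Finset.range (d + 1), u.coeff a *
    ((dualPoly d i).coeff (d - a) * (-1) ^ (d - a) / (d.choose a)), fun x S hS => ?_⟩
  rw [eval_eq_sum_range' (Nat.lt_succ_of_le hu)]
  simp_rw [Finset.sum_mul]
  rw [Finset.sum_comm]
  refine Finset.sum_congr rfl fun a ha => ?_
  rw [← key a (Nat.lt_succ_iff.1 (Finset.mem_range.1 ha)) x S hS, Finset.mul_sum]
  exact Finset.sum_congr rfl fun i _ => by ring

lemma sum_bspline_eq_one {d : ℕ} (x : ℝ) (S : Finset ℤ)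
    (hS : ∀ i : ℤ, bspline d (x - i) ≠ 0 → i ∈ S) : ∑ i ∈ S, bspline d (x - i) = 1 := by
  have h := congrArg (fun q : ℝ[X] => q.coeff d)
    (marsden_floor d ⌊x⌋ x (Int.floor_le x) (Int.lt_floor_add_one x))
  have lc : ∀ i, (dualPoly d i).coeff d = (-1) ^ d := by
    intro i
    have := Polynomial.coeff_prod_of_natDegree_le (Finset.range d)
      (fun j => (C ((i : ℝ) + j + 1) - X)) 1 (fun j _ => by
        refine (natDegree_sub_le _ _).trans ?_
        rw [natDegree_C, natDegree_X]; simp)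
    rw [Finset.card_range, mul_one] at this
    rw [dualPoly, this]
    simp only [coeff_sub, coeff_C_succ, coeff_X_one, zero_sub, Finset.prod_const,
      Finset.card_range]
  have rc : ((C x - X) ^ d : ℝ[X]).coeff d = (-1) ^ d := by
    have : (C x - X : ℝ[X]) = C (-1) * (X + C (-x)) := by
        simp only [C_neg, C_1]; ring
    rw [this, mul_pow, ← C_pow, coeff_C_mul, coeff_X_add_C_pow]; simp
  simp only [finsetSum_coeff, coeff_C_mul, lc, rc, ← Finset.sum_mul] at h
  have h2 := sum_bspline_shift (fun _ => 1) x S hS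
  simp only [one_mul] at h2
  rw [h2]
  exact mul_right_cancel₀ (pow_ne_zero d (by norm_num : (-1 : ℝ) ≠ 0)) (by rw [h, one_mul])

end

section

open Polynomial

/-! ### Dyadic refinement -/

lemma choose_mul_succ_real (n k : ℕ) :
    (n.choose (k + 1) : ℝ) * (k + 1) = n.choose k * (n - k) := by
  rcases le_or_gt k n with h | h
  · have := Nat.choose_succ_right_eq n k
    rw [← Nat.cast_sub h]
    exact_mod_cast this
  · rw [Nat.choose_eq_zero_of_lt h, Nat.choose_eq_zero_of_lt (by omega)]; simp

lemma sum_range_choose_extend (n m k : ℕ) (h : n < k) (b : ℕ → ℝ) (hm : k ≤ m) :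
    ∑ j ∈ Finset.range k, (n.choose j : ℝ) * b j = ∑ j ∈ Finset.range m, (n.choose j : ℝ) * b j := by
  refine Finset.sum_subset (Finset.range_mono hm) fun j _ hj => ?_
  rw [Nat.choose_eq_zero_of_lt (by rw [Finset.mem_range] at hj; omega)]; simp

lemma bspline_refine_range (d : ℕ) (x : ℝ) :
    bspline d x = ∑ j ∈ Finset.range (d + 2), ((d + 1).choose j : ℝ) / 2 ^ d *
      bspline d (2 * x - j) := by
  induction d generalizing x with
  | zero =>
    simp only [Finset.sum_range_succ, Finset.sum_range_zero, bspline, Set.indicator, Set.mem_Ico,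
      Pi.one_apply]
    norm_num
    split_ifs <;> first | rfl | (exfalso; grind) | norm_num
  | succ d ih =>
    set b : ℕ → ℝ := fun j => bspline d (2 * x - j) with hb
    have L0 : bspline d x = ∑ j ∈ Finset.range (d + 4), ((d + 1).choose j : ℝ) * (b j / 2 ^ d) := by
      rw [ih x, ← sum_range_choose_extend (d + 1) (d + 4) (d + 2) (by omega) _ (by omega)]
      exact Finset.sum_congr rfl fun j _ => by simp only [hb]; ring
    have L1 : bspline d (x - 1) =
        ∑ j ∈ Finset.range (d + 2), ((d + 1).choose j : ℝ) * (b (j + 2) / 2 ^ d) := by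
      rw [ih (x - 1)]
      refine Finset.sum_congr rfl fun j _ => ?_
      simp only [hb]
      push_cast
      rw [show 2 * (x - 1) - (j : ℝ) = 2 * x - (j + 2) by ring]; ring
    have hd : (d : ℝ) + 1 ≠ 0 := by positivity
    have R : ∀ j ∈ Finset.range (d + 1 + 2), ((d + 1 + 1).choose j : ℝ) / 2 ^ (d + 1) *
        bspline (d + 1) (2 * x - j) = (((d + 2).choose j : ℝ) *
          ((2 * x - j) * b j / 2 ^ (d + 1)) + ((d + 2).choose j : ℝ) *
          ((d + 2 - 2 * x + j) * b (j + 1) / 2 ^ (d + 1))) / (d + 1) := by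
      intro j _
      rw [bspline_succ]
      simp only [hb]
      push_cast
      rw [show 2 * x - (j : ℝ) - 1 = 2 * x - (j + 1) by ring]
      field_simp
      ring
    rw [Finset.sum_congr rfl R, ← Finset.sum_div, Finset.sum_add_distrib, sum_range_choose_extend (d + 2) (d + 4) _
      (by omega) _ (by omega), bspline_succ, L0, L1]
    congr 1
    simp only [Finset.sum_range_succ' _ (d + 3), Finset.sum_range_succ' _ (d + 2)]
    simp only [Nat.choose_zero_right, Nat.choose_one_right, zero_add]
    have key : ∀ j ∈ Finset.range (d + 2),
        x * (((d + 1).choose (j + 1 + 1) : ℝ) * (b (j + 1 + 1) / 2 ^ d)) +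
        (d + 2 - x) * (((d + 1).choose j : ℝ) * (b (j + 2) / 2 ^ d)) =
        ((d + 2).choose (j + 1 + 1) : ℝ) *
          ((2 * x - (j + 1 + 1 : ℕ)) * b (j + 1 + 1) / 2 ^ (d + 1)) +
        ((d + 2).choose (j + 1) : ℝ) *
          ((d + 2 - 2 * x + (j + 1 : ℕ)) * b (j + 1 + 1) / 2 ^ (d + 1)) := by
      intro j _
      have p1 : ((d + 2).choose (j + 1 + 1) : ℝ) = (d + 1).choose (j + 1) +
          (d + 1).choose (j + 1 + 1) := by exact_mod_cast Nat.choose_succ_succ (d + 1) (j + 1)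
      have p2 : ((d + 2).choose (j + 1) : ℝ) = (d + 1).choose j + (d + 1).choose (j + 1) := by
        exact_mod_cast Nat.choose_succ_succ (d + 1) j
      have q1 := choose_mul_succ_real (d + 1) j
      have q2 := choose_mul_succ_real (d + 1) (j + 1)
      push_cast at q1 q2 ⊢
      rw [p1, p2]
      set B := b (j + 1 + 1)
      set c0 := ((d + 1).choose j : ℝ)
      set c1 := ((d + 1).choose (j + 1) : ℝ)
      set c2 := ((d + 1).choose (j + 1 + 1) : ℝ)
      field_simp
      rw [pow_succ]
      linear_combination (2 ^ d * B) * (q2 - q1)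
    have ks := Finset.sum_congr rfl key
    rw [Finset.sum_add_distrib, Finset.sum_add_distrib] at ks
    simp only [← Finset.mul_sum] at ks
    push_cast at ks ⊢
    linear_combination ks

/-- The refinement mask of the B-spline of degree `d`, extended by zero to all integers. -/
def mask (d : ℕ) (j : ℤ) : ℝ := if 0 ≤ j then ((d + 1).choose j.toNat : ℝ) / 2 ^ d else 0

lemma mask_nonneg (d : ℕ) (j : ℤ) : 0 ≤ mask d j := by
  unfold mask; split_ifs <;> positivity

lemma mask_pos_iff {d : ℕ} {j : ℤ} : 0 < mask d j ↔ 0 ≤ j ∧ j ≤ d + 1 := by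
  unfold mask
  split_ifs with h
  · refine ⟨fun h' => ⟨h, ?_⟩, fun h' => ?_⟩
    · by_contra hlt
      rw [Nat.choose_eq_zero_of_lt (by omega)] at h'
      simp at h'
    · have : 0 < (d + 1).choose j.toNat := Nat.choose_pos (by omega)
      positivity
  · simp [h]

lemma bspline_refine (d : ℕ) (x : ℝ) (i : ℤ) (S : Finset ℤ)
    (hS : ∀ q : ℤ, bspline d (2 * x - q) ≠ 0 → q ∈ S) :
    bspline d (x - i) = ∑ q ∈ S, mask d (q - 2 * i) * bspline d (2 * x - q) := by
  classical
  have inj : Set.InjOn (fun j : ℕ => 2 * i + (j : ℤ)) (Finset.range (d + 2)) := by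
    intro a _ b _ h; simpa using h
  have e : bspline d (x - i) = ∑ q ∈ (Finset.range (d + 2)).image (fun j : ℕ => 2 * i + (j : ℤ)),
      mask d (q - 2 * i) * bspline d (2 * x - q) := by
    rw [Finset.sum_image inj, bspline_refine_range]
    refine Finset.sum_congr rfl fun j _ => ?_
    have : (2 * i + (j : ℤ) - 2 * i) = j := by ring
    rw [this, mask, if_pos (by omega), Int.toNat_natCast]
    congr 2; push_cast; ring
  rw [e]
  set U := (Finset.range (d + 2)).image (fun j : ℕ => 2 * i + (j : ℤ))
  have h1 : ∑ q ∈ U ∩ S, mask d (q - 2 * i) * bspline d (2 * x - q) =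
      ∑ q ∈ U, mask d (q - 2 * i) * bspline d (2 * x - q) := by
    refine Finset.sum_subset Finset.inter_subset_left fun q hq hq' => ?_
    by_contra h
    exact hq' (Finset.mem_inter.2 ⟨hq, hS q (right_ne_zero_of_mul h)⟩)
  have h2 : ∑ q ∈ U ∩ S, mask d (q - 2 * i) * bspline d (2 * x - q) =
      ∑ q ∈ S, mask d (q - 2 * i) * bspline d (2 * x - q) := by
    refine Finset.sum_subset Finset.inter_subset_right fun q hq hq' => ?_
    by_contra h
    have hm : 0 < mask d (q - 2 * i) :=
      lt_of_le_of_ne (mask_nonneg _ _) (left_ne_zero_of_mul h).symm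
    rw [mask_pos_iff] at hm
    refine hq' (Finset.mem_inter.2 ⟨Finset.mem_image.2 ⟨(q - 2 * i).toNat, ?_, ?_⟩, hq⟩)
    · rw [Finset.mem_range]; omega
    · omega
  rw [← h1, h2]

/-! ### Local linear independence -/

/-- The `d + 1` translates that do not vanish on a knot interval are linearly independent there:
they span the `(d + 1)`-dimensional space of polynomials of degree at most `d`. -/
lemma bspline_locally_independent {d : ℕ} (n : ℤ) (w : ℤ → ℝ)
    (h : ∀ x : ℝ, (n : ℝ) ≤ x → x < n + 1 →
      ∑ t ∈ Finset.range (d + 1), w (n - t) * bspline d (x - ((n - t : ℤ) : ℝ)) = 0)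
    {t : ℕ} (ht : t ≤ d) : w (n - t) = 0 := by
  let I : Set ℝ := Set.Ico (n : ℝ) (n + 1)
  let v : Fin (d + 1) → (I → ℝ) := fun t x => bspline d (x - ((n - (t : ℕ) : ℤ) : ℝ))
  let ev : ℝ[X] →ₗ[ℝ] (I → ℝ) :=
    { toFun := fun p x => p.eval (x : ℝ)
      map_add' := fun p q => by ext; simp
      map_smul' := fun a p => by ext; simp }
  have hinj : Function.Injective ev := by
    intro p q hpq
    refine eq_of_infinite_eval_eq p q ((Set.Ico_infinite (by linarith :
      (n : ℝ) < n + 1)).mono fun x hx => congrFun hpq ⟨x, hx⟩)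
  have hle : (degreeLT ℝ (d + 1)).map ev ≤ Submodule.span ℝ (Set.range v) := by
    rintro _ ⟨p, hp, rfl⟩
    have hp' : p.natDegree ≤ d := by
      have := mem_degreeLT.1 hp
      exact natDegree_le_iff_coeff_eq_zero.2 fun N hN =>
        coeff_eq_zero_of_degree_lt (this.trans_le (by exact_mod_cast hN))
    obtain ⟨c, hc⟩ := exists_bspline_coeff d p hp'
    have : ev p = ∑ t : Fin (d + 1), c (n - (t : ℕ)) • v t := by
      ext ⟨x, hx⟩
      have hfl : ⌊x⌋ = n := Int.floor_eq_iff.2 hx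
      have hs : ∀ i : ℤ, bspline d (x - i) ≠ 0 → i ∈ Finset.Icc (n - d) n := by
        intro i hi
        have h0 : (i : ℝ) ≤ x := by
          by_contra h; exact hi (bspline_eq_zero_of_neg (by linarith))
        have h1 : x < i + d + 1 := by
          by_contra h; exact hi (bspline_eq_zero_of_ge (by linarith))
        have h2 : i ≤ ⌊x⌋ := Int.le_floor.2 h0
        have h3 : ⌊x⌋ < i + d + 1 := Int.floor_lt.2 (by push_cast; exact h1)
        rw [Finset.mem_Icc]; omega
      have e2 := sum_bspline_shift c x _ hs
      rw [hc x _ hs, hfl] at e2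
      simp only [ev, v, LinearMap.coe_mk, AddHom.coe_mk, Finset.sum_apply, Pi.smul_apply,
        smul_eq_mul]
      rw [e2, Finset.sum_range]
    rw [this]
    exact Submodule.sum_mem _ fun t _ => Submodule.smul_mem _ _ (Submodule.subset_span ⟨t, rfl⟩)
  have hcard : Fintype.card (Fin (d + 1)) ≤ (Set.range v).finrank ℝ := by
    have h1 : Module.finrank ℝ ((degreeLT ℝ (d + 1)).map ev) = d + 1 := by
      rw [← (Submodule.equivMapOfInjective ev hinj (degreeLT ℝ (d + 1))).finrank_eq,
        (degreeLTEquiv ℝ (d + 1)).finrank_eq, Module.finrank_fin_fun]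
    have : FiniteDimensional ℝ (Submodule.span ℝ (Set.range v)) :=
      FiniteDimensional.span_of_finite ℝ (Set.finite_range v)
    exact (Fintype.card_fin _).trans h1.symm |>.trans_le (Submodule.finrank_mono hle)
  have hli := linearIndependent_iff_card_le_finrank_span.2 hcard
  have := Fintype.linearIndependent_iff.1 hli (fun t => w (n - (t : ℕ))) (by
    ext ⟨x, hx⟩
    have := h x hx.1 hx.2
    rw [Finset.sum_range] at this
    simpa [v] using this) ⟨t, Nat.lt_succ_of_le ht⟩
  exact this

lemma bspline_index_mem {d : ℕ} (hd : 1 ≤ d) {N : ℤ} {x : ℝ} (h0 : 0 ≤ x) (h1 : x ≤ N) {i : ℤ}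
    (hi : bspline d (x - i) ≠ 0) : i ∈ Finset.Ico (-(d : ℤ)) N := by
  rw [bspline_ne_zero_iff hd] at hi
  have a : (i : ℝ) < N := by linarith [hi.1]
  have b : (-(d : ℤ) - 1 : ℤ) < (i : ℝ) := by push_cast; linarith [hi.2]
  rw [Int.cast_lt] at a b
  rw [Finset.mem_Ico]; omega

lemma bspline_independent {d : ℕ} (hd : 1 ≤ d) {N : ℤ} (hN : 0 < N) (w : ℤ → ℝ)
    (h : ∀ x : ℝ, 0 ≤ x → x ≤ N → ∑ i ∈ Finset.Ico (-(d : ℤ)) N, w i * bspline d (x - i) = 0)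
    {i : ℤ} (hi : i ∈ Finset.Ico (-(d : ℤ)) N) : w i = 0 := by
  rw [Finset.mem_Ico] at hi
  set n : ℤ := max i 0 with hn
  have := bspline_locally_independent (d := d) n w (fun x hx0 hx1 => ?_) (t := (n - i).toNat)
    (by omega)
  · rwa [show n - ((n - i).toNat : ℤ) = i by omega] at this
  · have hfl : ⌊x⌋ = n := Int.floor_eq_iff.2 ⟨hx0, hx1⟩
    have h0 : (0 : ℝ) ≤ n := by exact_mod_cast (by omega : 0 ≤ n)
    have h1 : ((n + 1 : ℤ) : ℝ) ≤ N := by exact_mod_cast (by omega : n + 1 ≤ N)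
    push_cast at h1
    rw [← h x (by linarith) (by linarith), sum_bspline_shift w x _ fun i hi =>
      bspline_index_mem hd (by linarith) (by linarith) hi, hfl]

end

section

open Polynomial

/-! ### Existence of the coefficients of the BS functionals -/

/-- The Euler polynomial `E_d` (up to normalization the classical Eulerian polynomial): its
coefficients are the values of the B-spline of degree `d` at the integers `1, …, d`. -/
def eulerPoly (d : ℕ) : ℝ[X] := ∑ n ∈ Finset.range d, C (bspline d ((n : ℝ) + 1)) * X ^ n

lemma eulerPoly_coeff {d : ℕ} (n : ℕ) : (eulerPoly d).coeff n =
    if n < d then bspline d ((n : ℝ) + 1) else 0 := by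
  simp [eulerPoly, finsetSum_coeff, coeff_C_mul, coeff_X_pow]

lemma eulerPoly_coeff' {d : ℕ} (n : ℕ) : (eulerPoly d).coeff n = bspline d ((n : ℝ) + 1) := by
  rw [eulerPoly_coeff]
  split_ifs with h
  · rfl
  · have : (d : ℝ) ≤ n := by exact_mod_cast not_lt.1 h
    rw [bspline_eq_zero_of_ge (by linarith)]

lemma eulerPoly_eval_pos {d : ℕ} (hd : 1 ≤ d) {x : ℝ} (hx : 0 ≤ x) : 0 < (eulerPoly d).eval x := by
  have h1 : (1 : ℝ) ≤ d := by exact_mod_cast hd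
  simp only [eulerPoly, eval_finsetSum, eval_mul, eval_C, eval_pow, eval_X]
  refine Finset.sum_pos' (fun n _ => mul_nonneg (bspline_nonneg _ _) (by positivity))
    ⟨0, Finset.mem_range.2 hd, ?_⟩
  simp only [CharP.cast_eq_zero, zero_add, pow_zero, mul_one]
  exact bspline_pos one_pos (by linarith)

lemma eulerPoly_natDegree {d : ℕ} (hd : 1 ≤ d) : (eulerPoly d).natDegree = d - 1 := by
  refine natDegree_eq_of_le_of_coeff_ne_zero ?_ ?_
  · refine natDegree_le_iff_coeff_eq_zero.2 fun n hn => ?_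
    rw [eulerPoly_coeff, if_neg (by omega)]
  · rw [eulerPoly_coeff, if_pos (by omega), Nat.cast_sub hd]
    have h1 : (1 : ℝ) ≤ d := by exact_mod_cast hd
    exact (bspline_pos (by push_cast; linarith) (by push_cast; linarith)).ne'

lemma eulerPoly_ne_zero {d : ℕ} (hd : 1 ≤ d) : eulerPoly d ≠ 0 := fun h => by
  have := eulerPoly_eval_pos hd zero_le_one
  rw [h] at this; simp at this

lemma eulerPoly_one : eulerPoly 1 = 1 := by
  have : bspline 1 1 = 1 := by rw [bspline_one_eq]; norm_num
  simp [eulerPoly, this]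

/-- The recursion of the Euler polynomials, a reformulation of the recursion of the B-splines
at the integers. -/
lemma eulerPoly_succ {d : ℕ} (hd : 1 ≤ d) :
    C ((d : ℝ) + 1) * eulerPoly (d + 1) = (1 - X) * (eulerPoly d + X * derivative (eulerPoly d)) +
      C ((d : ℝ) + 1) * (X * eulerPoly d) := by
  have e : (1 - X) * (eulerPoly d + X * derivative (eulerPoly d)) +
      C ((d : ℝ) + 1) * (X * eulerPoly d) = eulerPoly d + X * derivative (eulerPoly d)
        + X * (C (d : ℝ) * eulerPoly d - X * derivative (eulerPoly d)) := by
    simp only [C_add, C_1]; ring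
  rw [e]
  ext n
  have h0 : (d : ℝ) + 1 ≠ 0 := by positivity
  have hd0 : bspline d 0 = 0 := bspline_eq_zero_of_nonpos hd le_rfl
  rcases n with _ | n
  · simp only [coeff_C_mul, coeff_add, eulerPoly_coeff', coeff_X_mul_zero, bspline_succ]
    norm_num [hd0]
    field_simp
  · simp only [coeff_C_mul, coeff_add, coeff_sub, eulerPoly_coeff', coeff_X_mul, bspline_succ]
    rcases n with _ | n
    · simp only [coeff_derivative, eulerPoly_coeff', coeff_X_mul_zero]
      push_cast
      field_simp
      ring_nf
    · simp only [coeff_derivative, eulerPoly_coeff', coeff_X_mul]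
      push_cast
      field_simp
      ring_nf

/-- The polynomials with `R_0 = X² - X` and `(d + 2) R_{d+1} = (X² - X) R_d'`. They are, up to a
factor, the Euler polynomials in the variable `w = 1 - 1 / u` (`logisticPoly_eval`). Rolle's theorem
for the Euler polynomials has to use zeros of `w E(w)` at `w = 0` and at infinity; in the variable
`u` these are the ordinary zeros `1` and `0`. -/
def logisticPoly : ℕ → ℝ[X]
  | 0 => X ^ 2 - X
  | d + 1 => C (((d : ℝ) + 2)⁻¹) * ((X ^ 2 - X) * derivative (logisticPoly d))

lemma logisticPoly_eval (d : ℕ) {u : ℝ} (hu : u ≠ 0) : (logisticPoly d).eval u =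
    (1 - u⁻¹) * (eulerPoly (d + 1)).eval (1 - u⁻¹) * u ^ (d + 2) := by
  induction d generalizing u with
  | zero =>
    simp [logisticPoly, eulerPoly_one]
    field_simp
  | succ d ih =>
    have hw : HasDerivAt (fun t : ℝ => 1 - t⁻¹) ((u ^ 2)⁻¹) u := by
      simpa using (hasDerivAt_inv hu).const_sub 1
    have h1 := ((hw.mul ((eulerPoly (d + 1)).hasDerivAt (1 - u⁻¹) |>.comp u hw)).mul
      (hasDerivAt_pow (d + 2) u))
    have h2 : HasDerivAt (fun t => (logisticPoly d).eval t) _ u := h1.congr_of_eventuallyEq (by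
      filter_upwards [isOpen_ne.mem_nhds hu] with t ht
      exact ih ht)
    have h3 := ((logisticPoly d).hasDerivAt u).unique h2
    have h4 := congrArg (eval (1 - u⁻¹)) (eulerPoly_succ (Nat.le_add_left 1 d))
    have hd : (d : ℝ) + 2 ≠ 0 := by positivity
    simp only [logisticPoly, eval_mul, eval_C, eval_sub, eval_pow, eval_X, h3]
    simp only [eval_mul, eval_C, eval_sub, eval_add, eval_X, eval_one] at h4
    push_cast at h4
    simp only [Pi.mul_apply, Function.comp_apply]
    rw [inv_mul_eq_iff_eq_mul₀ hd]
    push_cast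
    set w := 1 - u⁻¹ with hw'
    have huw : u ^ 2 - u = u ^ 2 * w := by rw [hw']; field_simp
    have hu1 : 1 - w = u⁻¹ := by rw [hw']; ring
    rw [hu1] at h4
    set E := eval w (eulerPoly (d + 1))
    set E' := eval w (derivative (eulerPoly (d + 1)))
    set E2 := eval w (eulerPoly (d + 1 + 1))
    have h5 : ((d : ℝ) + 2) * E2 = u⁻¹ * (E + w * E') + (d + 2) * (w * E) := by
      linear_combination h4
    rw [huw, show ((d : ℝ) + 2) * (w * E2 * u ^ (d + 1 + 2)) =
      w * u ^ (d + 1 + 2) * ((d + 2) * E2) by ring, h5]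
    field_simp
    ring_nf

lemma logisticPoly_card_roots (d : ℕ) : d + 2 ≤ (logisticPoly d).roots.toFinset.card := by
  have hne : ∀ d, logisticPoly d ≠ 0 := fun d h => by
    have h1 := logisticPoly_eval d (u := -1) (by norm_num)
    rw [h] at h1
    have h2 := eulerPoly_eval_pos (Nat.le_add_left 1 d) (x := 2) (by norm_num)
    norm_num at h1
    exact h2.ne' h1
  have mem : ∀ d, (0 : ℝ) ∈ (logisticPoly d).roots.toFinset ∧
      (1 : ℝ) ∈ (logisticPoly d).roots.toFinset := fun d => by
    simp only [Multiset.mem_toFinset, mem_roots (hne d), IsRoot.def]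
    cases d <;> simp [logisticPoly]
  induction d with
  | zero =>
    have : ({0, 1} : Finset ℝ) ⊆ (logisticPoly 0).roots.toFinset := by
      intro x hx
      simp only [Finset.mem_insert, Finset.mem_singleton] at hx
      rcases hx with rfl | rfl
      exacts [(mem 0).1, (mem 0).2]
    simpa using Finset.card_le_card this
  | succ d ih =>
    -- the zeros of the derivative provided by Rolle's theorem differ from the zeros `0` and `1`
    have h := card_roots_toFinset_le_card_roots_derivative_sdiff_roots_succ (logisticPoly d)
    set D := (derivative (logisticPoly d)).roots.toFinset \ (logisticPoly d).roots.toFinset with hD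
    have n0 : (0 : ℝ) ∉ D := fun h0 => (Finset.mem_sdiff.1 h0).2 (mem d).1
    have n1 : (1 : ℝ) ∉ D := fun h0 => (Finset.mem_sdiff.1 h0).2 (mem d).2
    have hsub : insert 0 (insert 1 D) ⊆ (logisticPoly (d + 1)).roots.toFinset := by
      intro x hx
      simp only [Finset.mem_insert] at hx
      rcases hx with rfl | rfl | hx
      · exact (mem (d + 1)).1
      · exact (mem (d + 1)).2
      · have := (Finset.mem_sdiff.1 hx).1
        rw [Multiset.mem_toFinset] at this
        rw [Multiset.mem_toFinset, mem_roots (hne (d + 1)), IsRoot.def]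
        simp [logisticPoly, (isRoot_of_mem_roots this).eq_zero]
    have hc := Finset.card_le_card hsub
    rw [Finset.card_insert_of_notMem (by simp [n0]), Finset.card_insert_of_notMem n1] at hc
    omega

lemma eulerPoly_card_roots {d : ℕ} (hd : 1 ≤ d) :
    d - 1 ≤ (eulerPoly d).roots.toFinset.card := by
  obtain ⟨d, rfl⟩ := Nat.exists_eq_add_of_le' hd
  have h := logisticPoly_card_roots d
  set S := ((logisticPoly d).roots.toFinset.erase 0).erase 1 with hS
  have hc : d ≤ S.card := by
    have h1 := Finset.pred_card_le_card_erase (s := (logisticPoly d).roots.toFinset) (a := 0)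
    have h2 := Finset.pred_card_le_card_erase
      (s := (logisticPoly d).roots.toFinset.erase 0) (a := 1)
    rw [hS]
    omega
  refine hc.trans (Finset.card_le_card_of_injOn (fun u => 1 - u⁻¹) ?_ ?_)
  · intro u hu
    simp only [hS, Finset.coe_erase, Set.mem_sdiff, Finset.mem_coe, Multiset.mem_toFinset,
      Set.mem_singleton_iff] at hu
    obtain ⟨⟨hr, h0⟩, h1⟩ := hu
    have h3 := (isRoot_of_mem_roots hr).eq_zero
    rw [logisticPoly_eval d h0] at h3
    have h4 : (1 : ℝ) - u⁻¹ ≠ 0 := by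
      rw [sub_ne_zero]; intro h; exact h1 (by rw [← inv_inv u, ← h, inv_one])
    simp only [Finset.mem_coe, Multiset.mem_toFinset, mem_roots (eulerPoly_ne_zero hd), IsRoot.def]
    have := pow_ne_zero (d + 2) h0
    simpa [h4, this] using h3
  · intro a _ b _ hab
    simpa using hab

/-- At a root of `E_d`, which is real, negative and simple, the recursion leaves a nonzero multiple
of the derivative of `E_d`, so `E_{d+1}` does not vanish there. -/
lemma isCoprime_eulerPoly_succ {d : ℕ} (hd : 1 ≤ d) :
    IsCoprime (eulerPoly d) (eulerPoly (d + 1)) := by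
  have hcard : (eulerPoly d).roots.card = (eulerPoly d).natDegree := by
    refine le_antisymm (card_roots' _) ?_
    rw [eulerPoly_natDegree hd]
    exact (eulerPoly_card_roots hd).trans (Multiset.toFinset_card_le _)
  have hnodup : (eulerPoly d).roots.Nodup := by
    rw [← Multiset.toFinset_card_eq_card_iff_nodup]
    refine le_antisymm (Multiset.toFinset_card_le _) ?_
    rw [hcard, eulerPoly_natDegree hd]
    exact eulerPoly_card_roots hd
  have hsplit := C_leadingCoeff_mul_prod_multiset_X_sub_C hcard
  rw [← hsplit]
  have hlc : (eulerPoly d).leadingCoeff ≠ 0 := leadingCoeff_ne_zero.2 (eulerPoly_ne_zero hd)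
  refine (isCoprime_mul_unit_left_left (isUnit_C.2 hlc.isUnit) _ _).2 ?_
  refine IsCoprime.symm (Multiset.prod_induction (fun q => IsCoprime (eulerPoly (d + 1)) q) _
    (fun a b ha hb => ha.mul_right hb) isCoprime_one_right fun q hq => ?_)
  obtain ⟨r, hr, rfl⟩ := Multiset.mem_map.1 hq
  refine IsCoprime.symm ((irreducible_X_sub_C r).coprime_iff_not_dvd.2 fun hdvd => ?_)
  have hr0 : (eulerPoly d).eval r = 0 := (isRoot_of_mem_roots hr).eq_zero
  have hr1 : (eulerPoly (d + 1)).eval r = 0 := (dvd_iff_isRoot.1 hdvd).eq_zero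
  have hrneg : r < 0 := by
    by_contra h; exact (eulerPoly_eval_pos hd (not_lt.1 h)).ne' hr0
  have hder : (derivative (eulerPoly d)).eval r ≠ 0 := by
    intro h
    have := (one_lt_rootMultiplicity_iff_isRoot (eulerPoly_ne_zero hd)).2 ⟨hr0, h⟩
    rw [← count_roots] at this
    exact absurd (Multiset.nodup_iff_count_le_one.1 hnodup r) (not_le.2 this)
  have h := congrArg (eval r) (eulerPoly_succ hd)
  simp only [eval_mul, eval_C, eval_sub, eval_add, eval_X, eval_one, hr0, hr1] at h
  have : (1 - r) * (r * (derivative (eulerPoly d)).eval r) = 0 := by linear_combination -h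
  rcases mul_eq_zero.1 this with h | h
  · linarith
  · exact (mul_ne_zero hrneg.ne hder) h

lemma deriv_bspline {d : ℕ} (hd : 2 ≤ d) (x : ℝ) :
    deriv (bspline d) x = bspline (d - 1) x - bspline (d - 1) (x - 1) := by
  obtain ⟨e, rfl⟩ := Nat.exists_eq_add_of_le' (show 1 ≤ d by omega)
  exact (hasDerivAt_bspline (by omega) x).deriv

/-- Reduction of `b` modulo `E_d` gives the bounds for the degrees. The pair `(a, b)` is then unique
up to constant multiples of `((1 - X) E_{d-1}, E_d)`, and the normalization `b(1) = 0` can be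
achieved because `E_d(1) ≠ 0`. -/
lemma bezout_eulerPoly {d : ℕ} (hd : 2 ≤ d) : ∃ a b : ℝ[X], a.natDegree < d ∧ b.natDegree < d ∧
    b.eval 1 = 0 ∧ a * eulerPoly d - b * ((1 - X) * eulerPoly (d - 1)) = X ^ (d - 1) := by
  set E := eulerPoly d with hE
  set F := (1 - X) * eulerPoly (d - 1) with hF
  have hEd : E.natDegree = d - 1 := eulerPoly_natDegree (by omega)
  have hE0 : E ≠ 0 := eulerPoly_ne_zero (by omega)
  have hE1 : 0 < E.eval 1 := eulerPoly_eval_pos (by omega) zero_le_one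
  have hFd : F.natDegree ≤ d - 1 := by
    refine natDegree_mul_le.trans ?_
    rw [eulerPoly_natDegree (by omega : 1 ≤ d - 1)]
    have : (1 - X : ℝ[X]).natDegree ≤ 1 := (natDegree_sub_le _ _).trans (by simp)
    omega
  have hco : IsCoprime E F := by
    refine IsCoprime.mul_right ?_ ?_
    · have h : IsCoprime (X - C 1) E := (irreducible_X_sub_C (1 : ℝ)).coprime_iff_not_dvd.2
        fun h => hE1.ne' (dvd_iff_isRoot.1 h)
      have e : (1 - X : ℝ[X]) = -(X - C 1) := by simp
      rw [e]; exact h.symm.neg_right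
    · have := isCoprime_eulerPoly_succ (d := d - 1) (by omega)
      rw [show d - 1 + 1 = d by omega] at this
      exact this.symm
  obtain ⟨u, v, huv⟩ := hco
  set u₀ := u * X ^ (d - 1) with hu₀
  set v₀ := v * X ^ (d - 1) with hv₀
  set r := v₀ % E with hr
  set q := v₀ / E with hq
  have hv : E * q + r = v₀ := EuclideanDomain.div_add_mod v₀ E
  set s := u₀ + q * F with hs
  have hsr : s * E + r * F = X ^ (d - 1) := by
    have : u₀ * E + v₀ * F = X ^ (d - 1) := by
      rw [hu₀, hv₀]; linear_combination X ^ (d - 1) * huv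
    rw [hs, ← this, ← hv]; ring
  have hrd : r.natDegree < d := by
    have := degree_mod_lt v₀ hE0
    have h2 : r.natDegree ≤ E.natDegree := natDegree_le_natDegree this.le
    omega
  have hsd : s.natDegree < d := by
    by_cases h0 : s = 0
    · rw [h0, natDegree_zero]; omega
    have h1 : (s * E).natDegree = s.natDegree + E.natDegree := natDegree_mul h0 hE0
    have h2 : s * E = X ^ (d - 1) - r * F := by linear_combination hsr
    have h3 : (s * E).natDegree ≤ max (d - 1) (d - 1 + (d - 1)) := by
      rw [h2]
      refine (natDegree_sub_le _ _).trans (max_le_max (by simp) (natDegree_mul_le.trans ?_))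
      omega
    have : max (d - 1) (d - 1 + (d - 1)) = d - 1 + (d - 1) := by omega
    omega
  set t : ℝ := -(r.eval 1) / E.eval 1 with ht
  refine ⟨s - C t * F, -r - C t * E, ?_, ?_, ?_, ?_⟩
  · refine (natDegree_sub_le _ _).trans_lt (max_lt hsd ((natDegree_C_mul_le _ _).trans_lt ?_))
    omega
  · refine (natDegree_sub_le _ _).trans_lt (max_lt (by rwa [natDegree_neg])
      ((natDegree_C_mul_le _ _).trans_lt ?_))
    omega
  · simp only [eval_sub, eval_neg, eval_mul, eval_C, ht]
    field_simp; ring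
  · linear_combination hsr

/-- The linear system of the BS coefficients is solvable. Its first `2d - 1` equations form the
Bézout identity `a E_d - b (1 - X) E_{d-1} = X ^ (d - 1)` for the polynomials `a` and `b` whose
coefficients are the unknowns in reverse order, and the last one is `b(1) = 0`. -/
theorem exists_isBSSolution {d : ℕ} (hd : 2 ≤ d) : ∃ c : (Fin d → ℝ) × (Fin d → ℝ),
    IsBSSolution d c.1 c.2 := by
  obtain ⟨a, b, ha, hb, hb1, hab⟩ := bezout_eulerPoly hd
  refine ⟨(fun r => a.coeff (d - 1 - r), fun r => b.coeff (d - 1 - r)), fun l hl0 hl1 => ?_, ?_⟩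
  · have hF : ∀ n : ℕ, ((1 - X) * eulerPoly (d - 1)).coeff n = deriv (bspline d) ((n : ℝ) + 1) := by
      intro n
      rw [deriv_bspline hd, sub_mul, one_mul, coeff_sub, eulerPoly_coeff']
      rcases n with _ | n
      · simp [bspline_eq_zero_of_nonpos (show 1 ≤ d - 1 by omega) le_rfl]
      · rw [coeff_X_mul, eulerPoly_coeff']; push_cast; ring_nf
    have hco := congrArg (fun q : ℝ[X] => q.coeff (d - 1 - l).toNat) hab
    have expand : ∀ (p g : ℝ[X]) (φ : ℝ → ℝ), p.natDegree < d → (∀ n : ℕ, g.coeff n = φ (n + 1)) →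
        (∀ x ≤ 0, φ x = 0) →
        (p * g).coeff (d - 1 - l).toNat =
          ∑ r : Fin d, p.coeff (d - 1 - r) * φ ((r : ℕ) + 1 - l) := by
      intro p g φ hp hg hφ
      have e1 : ∑ r : Fin d, p.coeff (d - 1 - r) * φ ((r : ℕ) + 1 - l) =
          ∑ k ∈ Finset.range d, p.coeff k * φ (d - l - k) := by
        rw [← Finset.sum_range_reflect, Finset.sum_range]
        refine Finset.sum_congr rfl fun r _ => ?_
        congr 2
        rw [Nat.cast_sub (by omega), Nat.cast_sub (by omega)]; push_cast; ring
      have e2 : (p * g).coeff (d - 1 - l).toNat =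
          ∑ k ∈ Finset.range ((d - 1 - l).toNat + 1), p.coeff k * φ (d - l - k) := by
        rw [coeff_mul, Finset.Nat.sum_antidiagonal_eq_sum_range_succ_mk]
        refine Finset.sum_congr rfl fun k hk => ?_
        rw [Finset.mem_range] at hk
        simp only [hg]
        congr 2
        have : (((d - 1 - l).toNat - k : ℕ) : ℤ) + 1 = d - l - k := by omega
        exact_mod_cast congrArg (Int.cast : ℤ → ℝ) this
      -- extra terms vanish: `k ≥ d` exceeds the degree, a larger `k` leaves the support of `φ`
      rw [e1, e2]
      refine (Finset.sum_subset (Finset.range_mono (Nat.le_add_right _ d)) fun k _ hk => ?_).trans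
        (Finset.sum_subset (Finset.range_mono (Nat.le_add_left _ ((d - 1 - l).toNat + 1)))
          fun k _ hk => ?_).symm
      · rw [Finset.mem_range] at hk
        have : (d : ℤ) - l - k ≤ 0 := by omega
        rw [hφ _ (by exact_mod_cast this), mul_zero]
      · rw [Finset.mem_range] at hk
        rw [coeff_eq_zero_of_natDegree_lt (by omega), zero_mul]
    rw [coeff_sub, expand _ _ (bspline d) ha eulerPoly_coeff' (fun x hx =>
      bspline_eq_zero_of_nonpos (by omega) hx), expand _ _ (deriv (bspline d)) hb hF (fun x hx => by
        rw [deriv_bspline hd, bspline_eq_zero_of_nonpos (by omega) hx,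
          bspline_eq_zero_of_nonpos (by omega) (by linarith), sub_zero]), coeff_X_pow,
      ← Finset.sum_sub_distrib] at hco
    rw [hco]
    congr 1
    simp only [eq_iff_iff]
    omega
  · rw [eval_eq_sum_range' hb] at hb1
    simp only [one_pow, mul_one] at hb1
    rw [← hb1, ← Finset.sum_range_reflect, Finset.sum_range]

lemma isBSSolution_bsCoeff {d : ℕ} (hd : 2 ≤ d) : IsBSSolution d (bsAlpha d) (bsBeta d) :=
  Classical.epsilon_spec (exists_isBSSolution hd)

end

section

open Polynomial

/-! ### Reproduction of polynomials by the univariate BS functionals -/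

/-- The univariate BS functional of index `i` over the grid `a + ℤ h`, applied to a polynomial. -/
def polyFunctional (d : ℕ) (a h : ℝ) (i : ℤ) (u : ℝ[X]) : ℝ :=
  ∑ r : Fin d, (bsAlpha d r * u.eval (a + ((i + ((r : ℕ) : ℤ) + 1 : ℤ) : ℝ) * h)
    - h * (bsBeta d r * (derivative u).eval (a + ((i + ((r : ℕ) : ℤ) + 1 : ℤ) : ℝ) * h)))

/-- On polynomials the functional of index `i` returns the `i`-th B-spline coefficient. -/
lemma polyFunctional_eq_coeff {d : ℕ} (hd : 2 ≤ d) {u : ℝ[X]} {w : ℤ → ℝ}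
    (hw : ∀ (x : ℝ) (S : Finset ℤ), (∀ i : ℤ, bspline d (x - i) ≠ 0 → i ∈ S) →
      ∑ i ∈ S, w i * bspline d (x - i) = u.eval x) (i : ℤ) :
    polyFunctional d 0 1 i u = w i := by
  obtain ⟨hsol, -⟩ := isBSSolution_bsCoeff hd
  set S := Finset.Icc (i - d) (i + d) with hS
  have hmem : ∀ x : ℝ, (i : ℝ) < x → x < i + d + 1 → ∀ l : ℤ, bspline d (x - l) ≠ 0 → l ∈ S := by
    intro x h0 h1 l hl
    rw [bspline_ne_zero_iff (by omega)] at hl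
    have a1 : (l : ℝ) < (i + d + 1 : ℤ) := by push_cast; linarith
    have a2 : ((i - d - 1 : ℤ) : ℝ) < l := by push_cast; linarith
    rw [Int.cast_lt] at a1 a2
    rw [hS, Finset.mem_Icc]; omega
  have hdiff : ∀ x, DifferentiableAt ℝ (bspline d) x := fun x => by
    obtain ⟨e, rfl⟩ := Nat.exists_eq_add_of_le' (show 1 ≤ d by omega)
    exact (hasDerivAt_bspline (by omega) x).differentiableAt
  have hder : ∀ x : ℝ, (i : ℝ) < x → x < i + d + 1 →
      (derivative u).eval x = ∑ l ∈ S, w l * deriv (bspline d) (x - l) := by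
    intro x h0 h1
    have hs : HasDerivAt (fun t : ℝ => ∑ l ∈ S, w l * bspline d (t - l))
        (∑ l ∈ S, w l * deriv (bspline d) (x - l)) x := by
      refine HasDerivAt.fun_sum fun l _ => HasDerivAt.const_mul (w l) ?_
      simpa [Function.comp_def] using
        (hdiff (x - l)).hasDerivAt.comp x ((hasDerivAt_id x).sub_const (l : ℝ))
    refine (u.hasDerivAt x).unique (hs.congr_of_eventuallyEq ?_)
    filter_upwards [Ioo_mem_nhds h0 h1] with t ht
    exact (hw t S (hmem t ht.1 ht.2)).symm
  have hnode : ∀ r : Fin d, (i : ℝ) < ((i + ((r : ℕ) : ℤ) + 1 : ℤ) : ℝ) ∧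
      ((i + ((r : ℕ) : ℤ) + 1 : ℤ) : ℝ) < i + d + 1 := fun r => by
    have : ((r : ℕ) : ℝ) < d := by exact_mod_cast r.2
    push_cast
    exact ⟨by linarith [Nat.cast_nonneg (α := ℝ) (r : ℕ)], by linarith⟩
  have key : ∀ l ∈ S, ∑ r : Fin d, (bsAlpha d r * bspline d (((r : ℕ) : ℝ) + 1 - (l - i : ℤ))
      - bsBeta d r * deriv (bspline d) (((r : ℕ) : ℝ) + 1 - (l - i : ℤ)))
      = if l - i = 0 then 1 else 0 := by
    intro l hl
    rw [hS, Finset.mem_Icc] at hl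
    by_cases hlt : -(d : ℤ) < l - i ∧ l - i < d
    · exact hsol (l - i) hlt.1 hlt.2
    rw [if_neg (by omega)]
    refine Finset.sum_eq_zero fun r _ => ?_
    have hr : ((r : ℕ) : ℝ) + 1 ≤ d := by exact_mod_cast r.2
    rw [deriv_bspline hd]
    have hd1 : ((d - 1 : ℕ) : ℝ) = d - 1 := by rw [Nat.cast_sub (by omega)]; simp
    rcases (by omega : l - i = d ∨ l - i = -d) with h | h
    · rw [h, bspline_eq_zero_of_nonpos (by omega) (by push_cast; linarith),
        bspline_eq_zero_of_nonpos (by omega) (by push_cast; linarith),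
        bspline_eq_zero_of_nonpos (by omega) (by push_cast; linarith)]
      simp
    · have : (0 : ℝ) ≤ (r : ℕ) := Nat.cast_nonneg _
      rw [h, bspline_eq_zero_of_ge (by push_cast; linarith),
        bspline_eq_zero_of_ge (by rw [hd1]; push_cast; linarith),
        bspline_eq_zero_of_ge (by rw [hd1]; push_cast; linarith)]
      simp
  calc polyFunctional d 0 1 i u
      = ∑ r : Fin d, (bsAlpha d r * (∑ l ∈ S, w l * bspline d (((r : ℕ) : ℝ) + 1 - (l - i : ℤ)))
        - bsBeta d r * ∑ l ∈ S, w l * deriv (bspline d) (((r : ℕ) : ℝ) + 1 - (l - i : ℤ))) := by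
        refine Finset.sum_congr rfl fun r _ => ?_
        rw [zero_add, mul_one, one_mul, hder _ (hnode r).1 (hnode r).2,
          ← hw _ S (hmem _ (hnode r).1 (hnode r).2)]
        have e : ∀ l : ℤ, ((i + ((r : ℕ) : ℤ) + 1 : ℤ) : ℝ) - l =
            ((r : ℕ) : ℝ) + 1 - (l - i : ℤ) := fun l => by push_cast; ring
        simp only [e]
    _ = ∑ l ∈ S, w l * ∑ r : Fin d, (bsAlpha d r * bspline d (((r : ℕ) : ℝ) + 1 - (l - i : ℤ))
        - bsBeta d r * deriv (bspline d) (((r : ℕ) : ℝ) + 1 - (l - i : ℤ))) := by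
        simp only [Finset.mul_sum, ← Finset.sum_sub_distrib]
        rw [Finset.sum_comm]
        exact Finset.sum_congr rfl fun l _ => Finset.sum_congr rfl fun r _ => by ring
    _ = w i := by
        rw [Finset.sum_congr rfl fun l hl => by rw [key l hl], Finset.sum_eq_single i]
        · simp
        · intro l _ hl
          rw [if_neg (by omega), mul_zero]
        · intro h; exact absurd (Finset.mem_Icc.2 ⟨by omega, by omega⟩) h

lemma polyFunctional_scale (d : ℕ) (a h : ℝ) (i : ℤ) (u : ℝ[X]) :
    polyFunctional d a h i u = polyFunctional d 0 1 i (u.comp (C h * X + C a)) := by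
  refine Finset.sum_congr rfl fun r _ => ?_
  simp only [eval_comp, derivative_comp, eval_mul, eval_add, eval_C, eval_X, derivative_add,
    derivative_mul, derivative_C, derivative_X, zero_add, mul_one, one_mul, add_zero, zero_mul]
  rw [add_comm a, mul_comm h]
  ring_nf

/-- Since the BS functionals are dual to the B-splines, they reproduce the polynomials of degree at
most `d`. -/
theorem sum_polyFunctional {d : ℕ} (hd : 2 ≤ d) {a h : ℝ} (hh : 0 < h) (N : ℤ) {u : ℝ[X]}
    (hu : u.natDegree ≤ d) {x : ℝ} (h0 : a ≤ x) (h1 : x ≤ a + N * h) :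
    ∑ i ∈ Finset.Ico (-(d : ℤ)) N, polyFunctional d a h i u * bspline d ((x - a) / h - i) =
      u.eval x := by
  have hdeg : (u.comp (C h * X + C a)).natDegree ≤ d := by
    refine natDegree_comp_le.trans ?_
    have : (C h * X + C a).natDegree ≤ 1 := natDegree_linear_le
    calc _ ≤ u.natDegree * 1 := Nat.mul_le_mul_left _ this
      _ ≤ d := by omega
  obtain ⟨w, hw⟩ := exists_bspline_coeff d _ hdeg
  have hx0 : 0 ≤ (x - a) / h := div_nonneg (by linarith) hh.le
  have hx1 : (x - a) / h ≤ N := by rw [div_le_iff₀ hh]; linarith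
  have := hw ((x - a) / h) _ fun i hi => bspline_index_mem (by omega) hx0 hx1 hi
  rw [Finset.sum_congr rfl fun i _ => by
    rw [polyFunctional_scale d a h i u, polyFunctional_eq_coeff hd hw i], this]
  simp only [eval_comp, eval_add, eval_mul, eval_C, eval_X]
  congr 1
  field_simp
  ring

end

section

open Set Filter Topology

/-! ### Mixed partial derivatives -/

lemma norm_le_of_hasDerivWithinAt {φ : ℝ → ℝ} {φ' C y₀ : ℝ} {Y : Set ℝ}
    (hY : UniqueDiffWithinAt ℝ Y y₀) (h : HasDerivWithinAt φ φ' Y y₀)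
    (hb : ∀ᶠ y in 𝓝[Y] y₀, |φ y - φ y₀| ≤ C * |y - y₀|) : |φ'| ≤ C := by
  have ht := (hasDerivWithinAt_iff_tendsto_slope.1 h).abs
  have : (𝓝[Y \ {y₀}] y₀).NeBot := by
    have := uniqueDiffWithinAt_iff_accPt.1 hY
    rw [accPt_principal_iff_nhdsWithin] at this
    exact this
  refine le_of_tendsto ht ?_
  have hb' := nhdsWithin_mono y₀ (sdiff_subset : Y \ {y₀} ⊆ Y) hb
  filter_upwards [hb', self_mem_nhdsWithin] with y hy hy'
  have hne : y - y₀ ≠ 0 := sub_ne_zero.2 hy'.2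
  rw [slope_def_field, abs_div, div_le_iff₀ (abs_pos.2 hne)]
  exact hy

/-- The symmetry of mixed derivatives: if `∂ₓF`, `∂ᵧF` and `∂ᵧ∂ₓF` exist and the last one is
continuous, then `∂ₓ∂ᵧF` exists and equals `∂ᵧ∂ₓF`; the derivatives are one-sided at the boundary
of the rectangle. -/
lemma hasDerivWithinAt_swap {X Y : Set ℝ} (hX : Convex ℝ X) (hY : Convex ℝ Y)
    (hYd : UniqueDiffOn ℝ Y) {F Fx Fy Fxy : ℝ × ℝ → ℝ}
    (hFx : ∀ x ∈ X, ∀ y ∈ Y, HasDerivWithinAt (fun t => F (t, y)) (Fx (x, y)) X x)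
    (hFy : ∀ x ∈ X, ∀ y ∈ Y, HasDerivWithinAt (fun t => F (x, t)) (Fy (x, y)) Y y)
    (hFxy : ∀ x ∈ X, ∀ y ∈ Y, HasDerivWithinAt (fun t => Fx (x, t)) (Fxy (x, y)) Y y)
    (hc : ContinuousOn Fxy (X ×ˢ Y)) {x₀ y₀ : ℝ} (hx₀ : x₀ ∈ X) (hy₀ : y₀ ∈ Y) :
    HasDerivWithinAt (fun t => Fy (t, y₀)) (Fxy (x₀, y₀)) X x₀ := by
  rw [hasDerivWithinAt_iff_isLittleO, Asymptotics.isLittleO_iff]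
  intro ε hε
  obtain ⟨δ, hδ, hδ'⟩ := Metric.continuousWithinAt_iff.1 (hc (x₀, y₀) ⟨hx₀, hy₀⟩) ε hε
  set A := Fxy (x₀, y₀) with hA
  have hbound : ∀ x ∈ X, |x - x₀| < δ → ∀ y ∈ Y, |y - y₀| < δ → |Fxy (x, y) - A| ≤ ε := by
    intro x hx hxd y hy hyd
    have := hδ' (x := (x, y)) ⟨hx, hy⟩ (by
      rw [Prod.dist_eq]; exact max_lt (by rwa [Real.dist_eq]) (by rwa [Real.dist_eq]))
    rw [Real.dist_eq] at this
    exact this.le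
  filter_upwards [self_mem_nhdsWithin, nhdsWithin_le_nhds (Metric.ball_mem_nhds x₀ hδ)] with x hx hxδ
  rw [Metric.mem_ball, Real.dist_eq] at hxδ
  rw [Real.norm_eq_abs, Real.norm_eq_abs, smul_eq_mul]
  have hφ : HasDerivWithinAt (fun y => F (x, y) - F (x₀, y) - (x - x₀) * A * y)
      (Fy (x, y₀) - Fy (x₀, y₀) - (x - x₀) * A) Y y₀ := by
    simpa using ((hFy x hx y₀ hy₀).fun_sub (hFy x₀ hx₀ y₀ hy₀)).fun_sub
      ((hasDerivWithinAt_id y₀ Y).const_mul ((x - x₀) * A))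
  refine norm_le_of_hasDerivWithinAt (hYd y₀ hy₀) hφ ?_
  filter_upwards [self_mem_nhdsWithin, nhdsWithin_le_nhds (Metric.ball_mem_nhds y₀ hδ)] with y hy hyδ
  rw [Metric.mem_ball, Real.dist_eq] at hyδ
  -- two applications of the mean value inequality to the second difference of `F`
  have h1 : ∀ t ∈ X ∩ Metric.ball x₀ δ, |Fx (t, y) - Fx (t, y₀) - (y - y₀) * A| ≤ ε * |y - y₀| := by
    rintro t ⟨ht, htδ⟩
    rw [Metric.mem_ball, Real.dist_eq] at htδ
    have := Convex.norm_image_sub_le_of_norm_hasDerivWithin_le (s := Y ∩ Metric.ball y₀ δ)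
      (f := fun y => Fx (t, y) - A * y) (f' := fun y => Fxy (t, y) - A) (C := ε) (x := y₀) (y := y)
      (fun y hy => by
        simpa using ((hFxy t ht y hy.1).mono inter_subset_left).fun_sub
          ((hasDerivWithinAt_id y (Y ∩ Metric.ball y₀ δ)).const_mul A))
      (fun y hy => hbound t ht htδ y hy.1 (by simpa [Real.dist_eq] using hy.2))
      (hY.inter (convex_ball _ _)) ⟨hy₀, Metric.mem_ball_self hδ⟩
      ⟨hy, by rwa [Metric.mem_ball, Real.dist_eq]⟩
    rw [Real.norm_eq_abs, Real.norm_eq_abs] at this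
    convert this using 2
    ring
  have h2 := Convex.norm_image_sub_le_of_norm_hasDerivWithin_le (s := X ∩ Metric.ball x₀ δ)
    (f := fun t => F (t, y) - F (t, y₀) - (y - y₀) * A * t)
    (f' := fun t => Fx (t, y) - Fx (t, y₀) - (y - y₀) * A) (C := ε * |y - y₀|) (x := x₀) (y := x)
    (fun t ht => by
      simpa using (((hFx t ht.1 y hy).mono inter_subset_left).fun_sub
        ((hFx t ht.1 y₀ hy₀).mono inter_subset_left)).fun_sub
        ((hasDerivWithinAt_id t (X ∩ Metric.ball x₀ δ)).const_mul ((y - y₀) * A)))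
    h1 (hX.inter (convex_ball _ _)) ⟨hx₀, Metric.mem_ball_self hδ⟩
    ⟨hx, by rwa [Metric.mem_ball, Real.dist_eq]⟩
  rw [Real.norm_eq_abs, Real.norm_eq_abs] at h2
  calc _ = |F (x, y) - F (x, y₀) - (y - y₀) * A * x
        - (F (x₀, y) - F (x₀, y₀) - (y - y₀) * A * x₀)| := by congr 1; ring
    _ ≤ ε * |y - y₀| * |x - x₀| := h2
    _ = _ := by ring

/-- A family `D r s` of functions on `X ×ˢ Y` which behaves, for `r ≤ p` and `s ≤ q`, like the
family of the mixed partial derivatives of `D 0 0`, in units `hx` and `hy`: differentiation in `x`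
turns `D r s` into `D (r + 1) s / hx`, and differentiation in `y` turns it into
`D r (s + 1) / hy`. -/
structure PartialFamily (X Y : Set ℝ) (hx hy : ℝ) (p q : ℕ) (D : ℕ → ℕ → ℝ × ℝ → ℝ) : Prop where
  dx : ∀ r < p, ∀ s ≤ q, ∀ x ∈ X, ∀ y ∈ Y,
    HasDerivWithinAt (fun t => D r s (t, y)) (D (r + 1) s (x, y) / hx) X x
  dy : ∀ r ≤ p, ∀ s < q, ∀ x ∈ X, ∀ y ∈ Y,
    HasDerivWithinAt (fun t => D r s (x, t)) (D r (s + 1) (x, y) / hy) Y y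

lemma hasDerivWithinAt_iteratedDerivWithin {g : ℝ → ℝ} {I : Set ℝ} (hI : UniqueDiffOn ℝ I) {n k : ℕ}
    (hg : ContDiffOn ℝ n g I) (hk : k < n) {x : ℝ} (hx : x ∈ I) :
    HasDerivWithinAt (fun t => iteratedDerivWithin k g I t) (iteratedDerivWithin (k + 1) g I x)
      I x := by
  rw [iteratedDerivWithin_succ]
  exact (hg.differentiableOn_iteratedDerivWithin (by exact_mod_cast hk) hI x hx).hasDerivWithinAt

theorem partialFamily_mixedDeriv {X Y : Set ℝ} (hX : Convex ℝ X) (hY : Convex ℝ Y)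
    (hXd : UniqueDiffOn ℝ X) (hYd : UniqueDiffOn ℝ Y) {p q : ℕ} {f : ℝ × ℝ → ℝ}
    (hf : MixedContDiffOn p q f X Y) :
    PartialFamily X Y 1 1 p q (fun r s => mixedDeriv X Y r s f) := by
  have dy : ∀ r ≤ p, ∀ s < q, ∀ x ∈ X, ∀ y ∈ Y, HasDerivWithinAt
      (fun t => mixedDeriv X Y r s f (x, t)) (mixedDeriv X Y r (s + 1) f (x, y)) Y y :=
    fun r hr s hs x hx y hy => hasDerivWithinAt_iteratedDerivWithin hYd
      (hf.contDiffOn_snd r hr x hx) hs hy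
  have dx : ∀ r < p, ∀ s ≤ q, ∀ x ∈ X, ∀ y ∈ Y, HasDerivWithinAt
      (fun t => mixedDeriv X Y r s f (t, y)) (mixedDeriv X Y (r + 1) s f (x, y)) X x := by
    intro r hr s hs
    induction s with
    | zero =>
      intro x hx y hy
      simp only [mixedDeriv, iteratedDerivWithin_zero]
      exact hasDerivWithinAt_iteratedDerivWithin hXd (hf.contDiffOn_fst y hy) hr hx
    | succ s ih =>
      intro x hx y hy
      exact hasDerivWithinAt_swap hX hY hYd (ih (by omega)) (dy r hr.le s (by omega))
        (dy (r + 1) hr s (by omega)) (hf.continuousOn (r + 1) hr (s + 1) hs) hx hy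
  exact ⟨by simpa using dx, by simpa using dy⟩

/-! ### Bounds for intermediate derivatives -/

section Univariate

variable {a b h : ℝ} {φ : ℕ → ℝ → ℝ}

/-- Bounds for a top derivative on an interval, and for each lower derivative at some point (which
may depend on the order), give bounds for all of them on the interval. -/
lemma abs_le_of_abs_le_at_point {L K : ℝ} {n : ℕ} (hh : 0 < h) (hL : b - a ≤ L * h)
    (hφ : ∀ j ≤ n, ∀ x ∈ Icc a b, HasDerivWithinAt (φ j) (φ (j + 1) x / h) (Icc a b) x)
    (hpt : ∀ j ≤ n, ∃ z ∈ Icc a b, |φ j z| ≤ K) (htop : ∀ x ∈ Icc a b, |φ (n + 1) x| ≤ K) :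
    ∀ j ≤ n + 1, ∀ x ∈ Icc a b, |φ j x| ≤ (1 + L) ^ (n + 1) * K := by
  intro j hj x hx
  have hab : a ≤ b := hx.1.trans hx.2
  have hL0 : 0 ≤ L := by
    by_contra hneg
    nlinarith
  have hK : 0 ≤ K := (abs_nonneg _).trans (htop x hx)
  have key : ∀ i ≤ n + 1, ∀ x ∈ Icc a b, |φ (n + 1 - i) x| ≤ (1 + L) ^ i * K := by
    intro i
    induction i with
    | zero => intro _ x hx; simpa using htop x hx
    | succ i ih =>
      intro hi x hx
      obtain ⟨z, hz, hzK⟩ := hpt (n + 1 - (i + 1)) (by omega)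
      have hih := ih (by omega)
      have e : n + 1 - i = n + 1 - (i + 1) + 1 := by omega
      rw [e] at hih
      have hmv := Convex.norm_image_sub_le_of_norm_hasDerivWithin_le
        (C := (1 + L) ^ i * K / h) (hφ (n + 1 - (i + 1)) (by omega))
        (fun t ht => by
          rw [norm_div, Real.norm_of_nonneg hh.le]
          exact div_le_div_of_nonneg_right (hih t ht) hh.le) (convex_Icc a b) hz hx
      rw [Real.norm_eq_abs, Real.norm_eq_abs] at hmv
      have hxz : |x - z| ≤ L * h := by
        rw [abs_le]; constructor <;> linarith [hx.1, hx.2, hz.1, hz.2]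
      have h1 : (1 + L) ^ i * K / h * |x - z| ≤ (1 + L) ^ i * K * L := by
        calc _ ≤ (1 + L) ^ i * K / h * (L * h) := by gcongr
          _ = _ := by field_simp
      have h2 : |φ (n + 1 - (i + 1)) x| ≤ |φ (n + 1 - (i + 1)) z| +
          |φ (n + 1 - (i + 1)) x - φ (n + 1 - (i + 1)) z| := by
        have := abs_add_le (φ (n + 1 - (i + 1)) z)
          (φ (n + 1 - (i + 1)) x - φ (n + 1 - (i + 1)) z)
        simpa using this
      have h3 : 1 ≤ (1 + L) ^ i := one_le_pow₀ (by linarith)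
      calc _ ≤ K + (1 + L) ^ i * K * L := by linarith
        _ ≤ (1 + L) ^ i * K + (1 + L) ^ i * K * L := by nlinarith
        _ = (1 + L) ^ (i + 1) * K := by ring
  refine (show |φ j x| ≤ (1 + L) ^ (n + 1 - j) * K by
    simpa [Nat.sub_sub_self hj] using key (n + 1 - j) (by omega) x hx).trans ?_
  gcongr
  · linarith
  · omega

/-- A function bounded by `K` on an interval of length at least `δ h` has at some point an `n`-th
derivative bounded by a multiple of `K`: the mean value theorem applied to two such points for the
previous derivative, one in the left third and one in the right third of the interval. -/
lemma exists_abs_le_deriv (n : ℕ) {δ : ℝ} (hδ : 0 < δ) : ∃ c : ℝ, 1 ≤ c ∧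
    ∀ (a b h K : ℝ) (φ : ℕ → ℝ → ℝ), 0 < h → δ * h ≤ b - a →
      (∀ j < n, ∀ x ∈ Icc a b, HasDerivWithinAt (φ j) (φ (j + 1) x / h) (Icc a b) x) →
      (∀ x ∈ Icc a b, |φ 0 x| ≤ K) → ∃ z ∈ Icc a b, |φ n z| ≤ c * K := by
  induction n generalizing δ with
  | zero =>
    refine ⟨1, le_rfl, fun a b h K φ hh hab _ h0 => ⟨a, ⟨le_rfl, ?_⟩, ?_⟩⟩
    · nlinarith [mul_pos hδ hh]
    · rw [one_mul]; exact h0 a ⟨le_rfl, by nlinarith [mul_pos hδ hh]⟩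
  | succ n ih =>
    obtain ⟨c, hc, hcP⟩ := ih (δ := δ / 3) (by positivity)
    refine ⟨max 1 (6 * c / δ), le_max_left _ _, fun a b h K φ hh hab hφ h0 => ?_⟩
    have hδh := mul_pos hδ hh
    have hsub1 : Icc a (a + (b - a) / 3) ⊆ Icc a b := Icc_subset_Icc_right (by linarith)
    have hsub2 : Icc (b - (b - a) / 3) b ⊆ Icc a b := Icc_subset_Icc_left (by linarith)
    obtain ⟨z₁, hz₁, hb₁⟩ := hcP a (a + (b - a) / 3) h K φ hh (by linarith)
      (fun j hj x hx => (hφ j (by omega) x (hsub1 hx)).mono hsub1) fun x hx => h0 x (hsub1 hx)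
    obtain ⟨z₂, hz₂, hb₂⟩ := hcP (b - (b - a) / 3) b h K φ hh (by linarith)
      (fun j hj x hx => (hφ j (by omega) x (hsub2 hx)).mono hsub2) fun x hx => h0 x (hsub2 hx)
    have hK : 0 ≤ K := (abs_nonneg _).trans (h0 z₁ (hsub1 hz₁))
    have hgap : δ * h / 3 ≤ z₂ - z₁ := by linarith [hz₁.2, hz₂.1]
    have hlt : z₁ < z₂ := by linarith
    have hsub : Icc z₁ z₂ ⊆ Icc a b := Icc_subset_Icc hz₁.1 hz₂.2
    obtain ⟨ξ, hξ, hξe⟩ := exists_hasDerivAt_eq_slope (φ n) (fun x => φ (n + 1) x / h) hlt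
      (fun x hx => ((hφ n (by omega) x (hsub hx)).mono hsub).continuousWithinAt)
      (fun x hx => ((hφ n (by omega) x (hsub (Ioo_subset_Icc_self hx))).mono hsub).hasDerivAt
        (Icc_mem_nhds hx.1 hx.2))
    refine ⟨ξ, hsub (Ioo_subset_Icc_self hξ), ?_⟩
    have hval : φ (n + 1) ξ = (φ n z₂ - φ n z₁) / (z₂ - z₁) * h := by
      rw [← hξe]; field_simp
    have hz0 : 0 < z₂ - z₁ := by linarith
    rw [hval, abs_mul, abs_div, abs_of_pos hz0, abs_of_pos hh]
    have hnum : |φ n z₂ - φ n z₁| ≤ 2 * (c * K) := (abs_sub _ _).trans (by linarith)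
    calc |φ n z₂ - φ n z₁| / (z₂ - z₁) * h ≤ 2 * (c * K) / (δ * h / 3) * h := by
          gcongr
      _ = 6 * c / δ * K := by field_simp; ring
      _ ≤ _ := by gcongr; exact le_max_right _ _

/-- The Landau inequality on an interval of length comparable to `h`: bounds for a function and
its derivative of order `n + 1` entail bounds for the derivatives in between. -/
lemma exists_landau_bound (n : ℕ) (L : ℝ) : ∃ C : ℝ, 1 ≤ C ∧
    ∀ (a b h K : ℝ) (φ : ℕ → ℝ → ℝ), 0 < h → h ≤ b - a → b - a ≤ L * h →
      (∀ j ≤ n, ∀ x ∈ Icc a b, HasDerivWithinAt (φ j) (φ (j + 1) x / h) (Icc a b) x) →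
      (∀ x ∈ Icc a b, |φ 0 x| ≤ K) → (∀ x ∈ Icc a b, |φ (n + 1) x| ≤ K) →
      ∀ j ≤ n + 1, ∀ x ∈ Icc a b, |φ j x| ≤ C * K := by
  choose c hc1 hc using fun j => exists_abs_le_deriv j (δ := 1) one_pos
  set c' := ∑ j ∈ Finset.range (n + 1), c j with hc'
  have hle : ∀ j ≤ n, c j ≤ c' := fun j hj =>
    Finset.single_le_sum (f := c) (fun i _ => by linarith [hc1 i])
      (Finset.mem_range.2 (Nat.lt_succ_of_le hj))
  have hc'1 : 1 ≤ c' := (hc1 0).trans (hle 0 (Nat.zero_le _))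
  refine ⟨max 1 ((1 + L) ^ (n + 1) * c'), le_max_left _ _,
    fun a b h K φ hh hab hL hφ h0 h1 j hj x hx => ?_⟩
  have hK : 0 ≤ K := (abs_nonneg _).trans (h0 x hx)
  have := abs_le_of_abs_le_at_point (K := c' * K) hh hL hφ (fun j hj => ?_) (fun x hx => ?_) j hj x hx
  · refine this.trans ?_
    rw [← mul_assoc]
    exact mul_le_mul_of_nonneg_right (le_max_right _ _) hK
  · obtain ⟨z, hz, hzb⟩ := hc j a b h K φ hh (by rwa [one_mul])
      (fun i hi => hφ i (by omega)) h0
    exact ⟨z, hz, hzb.trans (mul_le_mul_of_nonneg_right (hle j hj) hK)⟩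
  · exact (h1 x hx).trans (le_mul_of_one_le_left hK hc'1)

end Univariate

lemma PartialFamily.mono {X Y X' Y' : Set ℝ} {hx hy : ℝ} {p q : ℕ} {D : ℕ → ℕ → ℝ × ℝ → ℝ}
    (h : PartialFamily X Y hx hy p q D) (hX : X' ⊆ X) (hY : Y' ⊆ Y) :
    PartialFamily X' Y' hx hy p q D :=
  ⟨fun r hr s hs x hx y hy => (h.dx r hr s hs x (hX hx) y (hY hy)).mono hX,
    fun r hr s hs x hx y hy => (h.dy r hr s hs x (hX hx) y (hY hy)).mono hY⟩

/-- Propagation on a rectangle of size comparable to `hx × hy`: if all the scaled derivatives of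
order at most `(p, q)` are bounded at one point, then bounds on the rectangle for the three
derivatives of orders `(p + 1, 0)`, `(0, q + 1)` and `(p + 1, q + 1)` suffice to bound the former
on the whole rectangle. -/
theorem exists_propagation_bound (p q : ℕ) (L : ℝ) : ∃ A : ℝ, 1 ≤ A ∧
    ∀ (a b a' b' hx hy K : ℝ) (D : ℕ → ℕ → ℝ × ℝ → ℝ) (z : ℝ × ℝ), 0 < hx → 0 < hy →
      hx ≤ b - a → b - a ≤ L * hx → hy ≤ b' - a' → b' - a' ≤ L * hy →
      PartialFamily (Icc a b) (Icc a' b') hx hy (p + 1) (q + 1) D →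
      z ∈ Icc a b ×ˢ Icc a' b' → (∀ r ≤ p, ∀ s ≤ q, |D r s z| ≤ K) →
      (∀ w ∈ Icc a b ×ˢ Icc a' b', |D (p + 1) 0 w| ≤ K) →
      (∀ w ∈ Icc a b ×ˢ Icc a' b', |D 0 (q + 1) w| ≤ K) →
      (∀ w ∈ Icc a b ×ˢ Icc a' b', |D (p + 1) (q + 1) w| ≤ K) →
      ∀ r ≤ p, ∀ s ≤ q, ∀ w ∈ Icc a b ×ˢ Icc a' b', |D r s w| ≤ A * K := by
  obtain ⟨C₁, hC₁, hl₁⟩ := exists_landau_bound q L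
  obtain ⟨C₂, hC₂, hl₂⟩ := exists_landau_bound p L
  refine ⟨max 1 ((1 + L) ^ (p + 1) * ((1 + L) ^ (q + 1) * C₂ + C₁)), le_max_left _ _, ?_⟩
  intro a b a' b' hx hy K D z hx0 hy0 hab hL hab' hL' hD hz h0 hp0 h0q hpq r hr s hs w hw
  have hK : 0 ≤ K := (abs_nonneg _).trans (h0 0 (Nat.zero_le _) 0 (Nat.zero_le _))
  have hL0 : 0 ≤ L := by
    by_contra hneg
    nlinarith
  have e1 : ∀ s ≤ q + 1, ∀ x ∈ Icc a b, ∀ y ∈ Icc a' b', |D (p + 1) s (x, y)| ≤ C₁ * K := by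
    intro s hs x hx y hy
    exact hl₁ a' b' _ K (fun s y => D (p + 1) s (x, y)) hy0 hab' hL'
      (fun j hj y hy => hD.dy (p + 1) le_rfl j (by omega) x hx y hy)
      (fun y hy => hp0 (x, y) ⟨hx, hy⟩) (fun y hy => hpq (x, y) ⟨hx, hy⟩) s hs y hy
  have e2 : ∀ r ≤ p + 1, ∀ x ∈ Icc a b, ∀ y ∈ Icc a' b', |D r (q + 1) (x, y)| ≤ C₂ * K := by
    intro r hr x hx y hy
    exact hl₂ a b _ K (fun r x => D r (q + 1) (x, y)) hx0 hab hL
      (fun j hj x hx => hD.dx j (by omega) (q + 1) le_rfl x hx y hy)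
      (fun x hx => h0q (x, y) ⟨hx, hy⟩) (fun x hx => hpq (x, y) ⟨hx, hy⟩) r hr x hx
  have e3 : ∀ r ≤ p, ∀ s ≤ q + 1, ∀ y ∈ Icc a' b',
      |D r s (z.1, y)| ≤ (1 + L) ^ (q + 1) * (C₂ * K) := by
    intro r hr
    exact abs_le_of_abs_le_at_point (φ := fun s y => D r s (z.1, y)) hy0 hL'
      (fun j hj y hy => hD.dy r (by omega) j (by omega) z.1 hz.1 y hy)
      (fun j hj => ⟨z.2, hz.2, (h0 r hr j hj).trans (le_mul_of_one_le_left hK hC₂)⟩)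
      (fun y hy => e2 r (by omega) z.1 hz.1 y hy)
  have e4 := abs_le_of_abs_le_at_point (φ := fun r x => D r s (x, w.2)) (n := p)
    (K := (1 + L) ^ (q + 1) * (C₂ * K) + C₁ * K) hx0 hL
    (fun j hj x hx => hD.dx j (by omega) s (by omega) x hx w.2 hw.2)
    (fun j hj => ⟨z.1, hz.1, (e3 j hj s (by omega) w.2 hw.2).trans (by
      have : 0 ≤ C₁ * K := by positivity
      linarith)⟩)
    (fun x hx => (e1 s (by omega) x hx w.2 hw.2).trans (by
      have : 0 ≤ (1 + L) ^ (q + 1) * (C₂ * K) := by positivity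
      linarith)) r (by omega) w.1 hw.1
  calc |D r s w| ≤ (1 + L) ^ (p + 1) * ((1 + L) ^ (q + 1) * (C₂ * K) + C₁ * K) := e4
    _ = (1 + L) ^ (p + 1) * ((1 + L) ^ (q + 1) * C₂ + C₁) * K := by ring
    _ ≤ _ := mul_le_mul_of_nonneg_right (le_max_right _ _) hK

end

section

open Set

/-! ### The tensor-product B-splines of one level -/

namespace TensorGrid

variable (G : TensorGrid) {d₁ d₂ : ℕ}

lemma stepX_pos (ℓ : ℕ) : 0 < G.stepX ℓ := div_pos G.hx_pos (by positivity)

lemma stepY_pos (ℓ : ℕ) : 0 < G.stepY ℓ := div_pos G.hy_pos (by positivity)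

lemma stepX_succ (ℓ : ℕ) : G.stepX ℓ = 2 * G.stepX (ℓ + 1) := by
  unfold stepX; field_simp; ring

lemma stepY_succ (ℓ : ℕ) : G.stepY ℓ = 2 * G.stepY (ℓ + 1) := by
  unfold stepY; field_simp; ring

lemma stepX_eq_mul {ℓ k : ℕ} (h : ℓ ≤ k) : G.stepX ℓ = 2 ^ (k - ℓ) * G.stepX k := by
  unfold stepX
  rw [← Nat.sub_add_cancel h, pow_add, Nat.add_sub_cancel]; field_simp

lemma stepY_eq_mul {ℓ k : ℕ} (h : ℓ ≤ k) : G.stepY ℓ = 2 ^ (k - ℓ) * G.stepY k := by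
  unfold stepY
  rw [← Nat.sub_add_cancel h, pow_add, Nat.add_sub_cancel]; field_simp

/-- The abscissa measured in cells of level `ℓ`. -/
def coordX (ℓ : ℕ) (p : ℝ × ℝ) : ℝ := (p.1 - G.a₁) / G.stepX ℓ

/-- The ordinate measured in cells of level `ℓ`. -/
def coordY (ℓ : ℕ) (p : ℝ × ℝ) : ℝ := (p.2 - G.a₂) / G.stepY ℓ

lemma coordX_succ (ℓ : ℕ) (p : ℝ × ℝ) : G.coordX (ℓ + 1) p = 2 * G.coordX ℓ p := by
  have := (G.stepX_pos (ℓ + 1)).ne'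
  unfold coordX; rw [stepX_succ G ℓ]; field_simp

lemma coordY_succ (ℓ : ℕ) (p : ℝ × ℝ) : G.coordY (ℓ + 1) p = 2 * G.coordY ℓ p := by
  have := (G.stepY_pos (ℓ + 1)).ne'
  unfold coordY; rw [stepY_succ G ℓ]; field_simp

lemma basisFun_eq (ℓ : ℕ) (J : ℤ × ℤ) (p : ℝ × ℝ) : G.basisFun d₁ d₂ ℓ J p =
    bspline d₁ (G.coordX ℓ p - J.1) * bspline d₂ (G.coordY ℓ p - J.2) := rfl

lemma basisFun_nonneg (ℓ : ℕ) (J : ℤ × ℤ) (p : ℝ × ℝ) : 0 ≤ G.basisFun d₁ d₂ ℓ J p :=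
  mul_nonneg (bspline_nonneg _ _) (bspline_nonneg _ _)

lemma basisFun_ne_zero_iff (hd₁ : 1 ≤ d₁) (hd₂ : 1 ≤ d₂) {ℓ : ℕ} {J : ℤ × ℤ} {p : ℝ × ℝ} :
    G.basisFun d₁ d₂ ℓ J p ≠ 0 ↔ (0 < G.coordX ℓ p - J.1 ∧ G.coordX ℓ p - J.1 < d₁ + 1) ∧
      (0 < G.coordY ℓ p - J.2 ∧ G.coordY ℓ p - J.2 < d₂ + 1) := by
  rw [basisFun_eq, mul_ne_zero_iff, bspline_ne_zero_iff hd₁, bspline_ne_zero_iff hd₂]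

lemma mem_domain_iff (ℓ : ℕ) (p : ℝ × ℝ) : p ∈ G.domain ↔
    (0 ≤ G.coordX ℓ p ∧ G.coordX ℓ p ≤ (2 ^ ℓ * G.N₁ : ℤ)) ∧
      (0 ≤ G.coordY ℓ p ∧ G.coordY ℓ p ≤ (2 ^ ℓ * G.N₂ : ℤ)) := by
  have h1 := G.stepX_pos ℓ
  have h2 := G.stepY_pos ℓ
  have e1 : G.hx = 2 ^ ℓ * G.stepX ℓ := by unfold stepX; field_simp
  have e2 : G.hy = 2 ^ ℓ * G.stepY ℓ := by unfold stepY; field_simp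
  rw [domain, mem_prod, mem_Icc, mem_Icc, coordX, coordY, le_div_iff₀ h1, le_div_iff₀ h2,
    div_le_iff₀ h1, div_le_iff₀ h2, e1, e2]
  push_cast
  constructor
  · rintro ⟨⟨a, b⟩, c, d⟩
    exact ⟨⟨by linarith, by linarith⟩, by linarith, by linarith⟩
  · rintro ⟨⟨a, b⟩, c, d⟩
    exact ⟨⟨by linarith, by linarith⟩, by linarith, by linarith⟩

lemma bound_pos (ℓ : ℕ) : (0 : ℤ) < 2 ^ ℓ * G.N₁ ∧ (0 : ℤ) < 2 ^ ℓ * G.N₂ := by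
  have h1 := G.N₁_pos
  have h2 := G.N₂_pos
  exact ⟨by positivity, by positivity⟩

lemma sum_basisFun (ℓ : ℕ) (σ : ℤ × ℤ → ℝ) (p : ℝ × ℝ) :
    ∑ J ∈ G.indices d₁ d₂ ℓ, σ J * G.basisFun d₁ d₂ ℓ J p =
    ∑ i ∈ Finset.Ico (-(d₁ : ℤ)) (2 ^ ℓ * G.N₁), (∑ j ∈ Finset.Ico (-(d₂ : ℤ)) (2 ^ ℓ * G.N₂),
      σ (i, j) * bspline d₂ (G.coordY ℓ p - j)) * bspline d₁ (G.coordX ℓ p - i) := by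
  rw [indices, Finset.sum_product]
  refine Finset.sum_congr rfl fun i _ => ?_
  rw [Finset.sum_mul]
  refine Finset.sum_congr rfl fun j _ => ?_
  rw [basisFun_eq]; ring

lemma exists_coord (ℓ : ℕ) (x y : ℝ) : ∃ p : ℝ × ℝ, G.coordX ℓ p = x ∧ G.coordY ℓ p = y := by
  have h1 := (G.stepX_pos ℓ).ne'
  have h2 := (G.stepY_pos ℓ).ne'
  exact ⟨(G.a₁ + x * G.stepX ℓ, G.a₂ + y * G.stepY ℓ), by simp [coordX, h1], by simp [coordY, h2]⟩

/-- The tensor-product B-splines of one level are linearly independent on `Ω`. -/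
lemma basisFun_independent (hd₁ : 1 ≤ d₁) (hd₂ : 1 ≤ d₂) (ℓ : ℕ) (σ : ℤ × ℤ → ℝ)
    (h : ∀ p ∈ G.domain, ∑ J ∈ G.indices d₁ d₂ ℓ, σ J * G.basisFun d₁ d₂ ℓ J p = 0) :
    ∀ J ∈ G.indices d₁ d₂ ℓ, σ J = 0 := by
  rintro ⟨i, j⟩ hJ
  obtain ⟨hi, hj⟩ := Finset.mem_product.1 hJ
  refine bspline_independent hd₂ (G.bound_pos ℓ).2 (fun j => σ (i, j)) (fun y hy0 hy1 => ?_) hj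
  refine bspline_independent hd₁ (G.bound_pos ℓ).1
    (fun i => ∑ j ∈ Finset.Ico (-(d₂ : ℤ)) (2 ^ ℓ * G.N₂), σ (i, j) * bspline d₂ (y - j))
    (fun x hx0 hx1 => ?_) hi
  obtain ⟨p, rfl, rfl⟩ := G.exists_coord ℓ x y
  rw [← sum_basisFun]
  exact h p ((G.mem_domain_iff ℓ p).2 ⟨⟨hx0, hx1⟩, hy0, hy1⟩)

/-- The coefficient of `B_K` (of the next level) in the refinement of `B_J`. -/
def refineCoeff (d₁ d₂ : ℕ) (J K : ℤ × ℤ) : ℝ :=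
  mask d₁ (K.1 - 2 * J.1) * mask d₂ (K.2 - 2 * J.2)

lemma refineCoeff_nonneg (J K : ℤ × ℤ) : 0 ≤ refineCoeff d₁ d₂ J K :=
  mul_nonneg (mask_nonneg _ _) (mask_nonneg _ _)

lemma refineCoeff_pos_iff {J K : ℤ × ℤ} : 0 < refineCoeff d₁ d₂ J K ↔
    (0 ≤ K.1 - 2 * J.1 ∧ K.1 - 2 * J.1 ≤ d₁ + 1) ∧ (0 ≤ K.2 - 2 * J.2 ∧ K.2 - 2 * J.2 ≤ d₂ + 1) := by
  rw [← mask_pos_iff, ← mask_pos_iff, refineCoeff]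
  constructor
  · intro h
    exact ⟨lt_of_le_of_ne (mask_nonneg _ _) (left_ne_zero_of_mul h.ne').symm,
      lt_of_le_of_ne (mask_nonneg _ _) (right_ne_zero_of_mul h.ne').symm⟩
  · exact fun h => mul_pos h.1 h.2

lemma basisFun_refine (hd₁ : 1 ≤ d₁) (hd₂ : 1 ≤ d₂) (ℓ : ℕ) (J : ℤ × ℤ) {p : ℝ × ℝ}
    (hp : p ∈ G.domain) : G.basisFun d₁ d₂ ℓ J p =
      ∑ K ∈ G.indices d₁ d₂ (ℓ + 1), refineCoeff d₁ d₂ J K * G.basisFun d₁ d₂ (ℓ + 1) K p := by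
  obtain ⟨⟨hx0, hx1⟩, hy0, hy1⟩ := (G.mem_domain_iff (ℓ + 1) p).1 hp
  rw [sum_basisFun, basisFun_eq]
  simp only [coordX_succ, coordY_succ] at hx0 hx1 hy0 hy1 ⊢
  rw [bspline_refine d₁ (G.coordX ℓ p) J.1 _ fun q hq => bspline_index_mem hd₁ hx0 hx1 hq,
    bspline_refine d₂ (G.coordY ℓ p) J.2 _ fun q hq => bspline_index_mem hd₂ hy0 hy1 hq,
    Finset.sum_mul]
  refine Finset.sum_congr rfl fun i _ => ?_
  rw [Finset.mul_sum, Finset.sum_mul]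
  refine Finset.sum_congr rfl fun j _ => ?_
  simp only [refineCoeff]; ring

lemma suppBasis_mono (hd₁ : 1 ≤ d₁) (hd₂ : 1 ≤ d₂) {ℓ : ℕ} {J K : ℤ × ℤ}
    (h : 0 < refineCoeff d₁ d₂ J K) :
    G.suppBasis d₁ d₂ (ℓ + 1) K ⊆ G.suppBasis d₁ d₂ ℓ J := by
  refine inter_subset_inter_left _ (closure_mono fun p hp => ?_)
  rw [Function.mem_support, basisFun_ne_zero_iff _ hd₁ hd₂] at hp ⊢
  rw [refineCoeff_pos_iff] at h
  obtain ⟨⟨a, b⟩, c, e⟩ := h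
  rw [coordX_succ, coordY_succ] at hp
  have a' : (0 : ℝ) ≤ K.1 - 2 * J.1 := by exact_mod_cast a
  have b' : (K.1 - 2 * J.1 : ℝ) ≤ d₁ + 1 := by exact_mod_cast b
  have c' : (0 : ℝ) ≤ K.2 - 2 * J.2 := by exact_mod_cast c
  have e' : (K.2 - 2 * J.2 : ℝ) ≤ d₂ + 1 := by exact_mod_cast e
  exact ⟨⟨by linarith [hp.1.1], by linarith [hp.1.2]⟩, by linarith [hp.2.1], by linarith [hp.2.2]⟩

lemma mem_suppBasis {ℓ : ℕ} {J : ℤ × ℤ} {p : ℝ × ℝ} (hp : p ∈ G.domain)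
    (h : G.basisFun d₁ d₂ ℓ J p ≠ 0) : p ∈ G.suppBasis d₁ d₂ ℓ J :=
  ⟨subset_tsupport _ h, hp⟩

lemma suppBasis_nonempty (hd₁ : 1 ≤ d₁) (hd₂ : 1 ≤ d₂) {ℓ : ℕ} {J : ℤ × ℤ}
    (hJ : J ∈ G.indices d₁ d₂ ℓ) : (G.suppBasis d₁ d₂ ℓ J).Nonempty := by
  obtain ⟨h1, h2⟩ := Finset.mem_product.1 hJ
  rw [Finset.mem_Ico] at h1 h2
  obtain ⟨p, hx, hy⟩ := G.exists_coord ℓ (((max J.1 0 : ℤ) : ℝ) + 1 / 2)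
    (((max J.2 0 : ℤ) : ℝ) + 1 / 2)
  have hb := G.bound_pos ℓ
  have key : ∀ (d : ℕ) (N i : ℤ), 1 ≤ d → 0 < N → -(d : ℤ) ≤ i → i < N →
      ((0 : ℝ) ≤ ((max i 0 : ℤ) : ℝ) + 1 / 2 ∧ ((max i 0 : ℤ) : ℝ) + 1 / 2 ≤ N) ∧
      0 < ((max i 0 : ℤ) : ℝ) + 1 / 2 - i ∧ ((max i 0 : ℤ) : ℝ) + 1 / 2 - i < d + 1 := by
    intro d N i hd hN h0 h1
    have a1 : (0 : ℝ) ≤ ((max i 0 : ℤ) : ℝ) := by exact_mod_cast le_max_right i 0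
    have a2 : (((max i 0 : ℤ)) : ℝ) + 1 ≤ N := by exact_mod_cast (by omega : max i 0 + 1 ≤ N)
    have a3 : (i : ℝ) ≤ ((max i 0 : ℤ) : ℝ) := by exact_mod_cast le_max_left i 0
    have a4 : ((max i 0 : ℤ) : ℝ) ≤ i + d := by exact_mod_cast (by omega : max i 0 ≤ i + d)
    exact ⟨⟨by linarith, by linarith⟩, by linarith, by linarith⟩
  have k1 := key d₁ _ J.1 hd₁ hb.1 h1.1 h1.2
  have k2 := key d₂ _ J.2 hd₂ hb.2 h2.1 h2.2
  refine ⟨p, G.mem_suppBasis ((G.mem_domain_iff ℓ p).2 ?_)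
    ((G.basisFun_ne_zero_iff hd₁ hd₂).2 ?_)⟩
  · rw [hx, hy]; exact ⟨k1.1, k2.1⟩
  · rw [hx, hy]; exact ⟨k1.2, k2.2⟩

end TensorGrid

/-! ### Truncation -/

namespace Hierarchy

variable (H : Hierarchy) {d₁ d₂ : ℕ}

lemma sub_antitone : Antitone H.sub := antitone_nat_of_succ_le H.sub_succ_subset

/-- The coefficients in the definition of the truncation are those of any given representation. -/
lemma coeffs_eq (hd₁ : 1 ≤ d₁) (hd₂ : 1 ≤ d₂) {ℓ : ℕ} {s : ℝ × ℝ → ℝ} {σ : ℤ × ℤ → ℝ}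
    (h : ∀ p ∈ H.domain, s p = ∑ J ∈ H.indices d₁ d₂ ℓ, σ J * H.basisFun d₁ d₂ ℓ J p)
    {J : ℤ × ℤ} (hJ : J ∈ H.indices d₁ d₂ ℓ) : H.coeffs d₁ d₂ ℓ s J = σ J := by
  have hs : ∀ p ∈ H.domain, s p =
      ∑ J ∈ H.indices d₁ d₂ ℓ, H.coeffs d₁ d₂ ℓ s J * H.basisFun d₁ d₂ ℓ J p :=
    Classical.epsilon_spec (p := fun σ : ℤ × ℤ → ℝ => ∀ p ∈ H.domain,
      s p = ∑ J ∈ H.indices d₁ d₂ ℓ, σ J * H.basisFun d₁ d₂ ℓ J p) ⟨σ, h⟩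
  refine sub_eq_zero.1 (H.basisFun_independent hd₁ hd₂ ℓ
    (fun J => H.coeffs d₁ d₂ ℓ s J - σ J) (fun p hp => ?_) J hJ)
  simp only [sub_mul, Finset.sum_sub_distrib]
  rw [← hs p hp, ← h p hp, sub_self]

open scoped Classical in
lemma trunc_eq (hd₁ : 1 ≤ d₁) (hd₂ : 1 ≤ d₂) {ℓ : ℕ} {s : ℝ × ℝ → ℝ} {σ : ℤ × ℤ → ℝ}
    (h : ∀ p ∈ H.domain, s p = ∑ J ∈ H.indices d₁ d₂ ℓ, σ J * H.basisFun d₁ d₂ ℓ J p)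
    (p : ℝ × ℝ) : H.trunc d₁ d₂ ℓ s p = ∑ J ∈ H.indices d₁ d₂ ℓ,
      (if H.suppBasis d₁ d₂ ℓ J ⊆ H.sub ℓ then 0 else σ J) * H.basisFun d₁ d₂ ℓ J p := by
  rw [trunc, Finset.sum_filter]
  refine Finset.sum_congr rfl fun J hJ => ?_
  rw [H.coeffs_eq hd₁ hd₂ h hJ]
  split_ifs <;> simp_all

open scoped Classical in
/-- The coefficients of `trunc^{ℓ+n} (⋯ (trunc^{ℓ+1} B_J^ℓ))` in the B-spline basis of level
`ℓ + n`. -/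
def truncCoeff (d₁ d₂ ℓ : ℕ) (J : ℤ × ℤ) : ℕ → ℤ × ℤ → ℝ
  | 0, K => if K = J then 1 else 0
  | n + 1, K => if H.suppBasis d₁ d₂ (ℓ + n + 1) K ⊆ H.sub (ℓ + n + 1) then 0 else
      ∑ K' ∈ H.indices d₁ d₂ (ℓ + n), truncCoeff d₁ d₂ ℓ J n K' *
        TensorGrid.refineCoeff d₁ d₂ K' K

lemma truncCoeff_nonneg (ℓ : ℕ) (J : ℤ × ℤ) (n : ℕ) (K : ℤ × ℤ) :
    0 ≤ H.truncCoeff d₁ d₂ ℓ J n K := by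
  induction n generalizing K with
  | zero => rw [truncCoeff]; split_ifs <;> norm_num
  | succ n ih =>
    rw [truncCoeff]
    split_ifs
    · exact le_rfl
    · exact Finset.sum_nonneg fun K' _ => mul_nonneg (ih K') (TensorGrid.refineCoeff_nonneg _ _)

lemma sum_refine (hd₁ : 1 ≤ d₁) (hd₂ : 1 ≤ d₂) (ℓ : ℕ) (σ : ℤ × ℤ → ℝ) {p : ℝ × ℝ}
    (hp : p ∈ H.domain) : ∑ J ∈ H.indices d₁ d₂ ℓ, σ J * H.basisFun d₁ d₂ ℓ J p =
      ∑ K ∈ H.indices d₁ d₂ (ℓ + 1), (∑ J ∈ H.indices d₁ d₂ ℓ,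
        σ J * TensorGrid.refineCoeff d₁ d₂ J K) * H.basisFun d₁ d₂ (ℓ + 1) K p := by
  simp only [Finset.sum_mul]
  rw [Finset.sum_comm]
  refine Finset.sum_congr rfl fun J _ => ?_
  rw [H.basisFun_refine hd₁ hd₂ ℓ J hp, Finset.mul_sum]
  exact Finset.sum_congr rfl fun K _ => by ring

lemma truncIter_eq (hd₁ : 1 ≤ d₁) (hd₂ : 1 ≤ d₂) {ℓ : ℕ} {J : ℤ × ℤ}
    (hJ : J ∈ H.indices d₁ d₂ ℓ) (n : ℕ) : ∀ p ∈ H.domain,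
      H.truncIter d₁ d₂ ℓ n (H.basisFun d₁ d₂ ℓ J) p = ∑ K ∈ H.indices d₁ d₂ (ℓ + n),
        H.truncCoeff d₁ d₂ ℓ J n K * H.basisFun d₁ d₂ (ℓ + n) K p := by
  induction n with
  | zero => intro p _; simp [truncIter, truncCoeff, hJ]
  | succ n ih =>
    intro p _
    rw [truncIter, H.trunc_eq hd₁ hd₂ (σ := fun K => ∑ K' ∈ H.indices d₁ d₂ (ℓ + n),
      H.truncCoeff d₁ d₂ ℓ J n K' * TensorGrid.refineCoeff d₁ d₂ K' K) (fun q hq => by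
        rw [ih q hq, H.sum_refine hd₁ hd₂ _ _ hq])]
    rfl

lemma thb_nonneg (hd₁ : 1 ≤ d₁) (hd₂ : 1 ≤ d₂) {ℓ : ℕ} {J : ℤ × ℤ}
    (hJ : J ∈ H.indices d₁ d₂ ℓ) {p : ℝ × ℝ} (hp : p ∈ H.domain) : 0 ≤ H.thb d₁ d₂ ℓ J p := by
  rw [thb, H.truncIter_eq hd₁ hd₂ hJ _ p hp]
  exact Finset.sum_nonneg fun K _ => mul_nonneg (H.truncCoeff_nonneg _ _ _ _)
    (H.basisFun_nonneg _ _ _)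

lemma truncCoeff_succ_pos_iff {ℓ : ℕ} {J : ℤ × ℤ} {n : ℕ} {K : ℤ × ℤ} :
    0 < H.truncCoeff d₁ d₂ ℓ J (n + 1) K ↔
      ¬ H.suppBasis d₁ d₂ (ℓ + n + 1) K ⊆ H.sub (ℓ + n + 1) ∧
      ∃ K' ∈ H.indices d₁ d₂ (ℓ + n), 0 < H.truncCoeff d₁ d₂ ℓ J n K' ∧
        0 < TensorGrid.refineCoeff d₁ d₂ K' K := by
  rw [truncCoeff]
  split_ifs with h
  · simp [h]
  · rw [Finset.sum_pos_iff_of_nonneg fun K' _ =>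
      mul_nonneg (H.truncCoeff_nonneg _ _ _ _) (TensorGrid.refineCoeff_nonneg _ _)]
    simp only [h, not_false_eq_true, true_and]
    refine exists_congr fun K' => and_congr_right fun _ => ⟨fun h' => ?_, fun h' => mul_pos h'.1 h'.2⟩
    exact ⟨lt_of_le_of_ne (H.truncCoeff_nonneg _ _ _ _) (left_ne_zero_of_mul h'.ne').symm,
      lt_of_le_of_ne (TensorGrid.refineCoeff_nonneg _ _) (right_ne_zero_of_mul h'.ne').symm⟩

/-- If a B-spline of level `ℓ + 1` is not supported in `Ω^{ℓ+1}`, so that truncation at that level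
keeps it, then its surviving descendants are also surviving descendants of its parents. -/
lemma truncCoeff_pos_of_parent {ℓ : ℕ} {J J' : ℤ × ℤ} (hJ' : J' ∈ H.indices d₁ d₂ ℓ)
    (hpar : 0 < TensorGrid.refineCoeff d₁ d₂ J' J)
    (hns : ¬ H.suppBasis d₁ d₂ (ℓ + 1) J ⊆ H.sub (ℓ + 1)) {n : ℕ} {K : ℤ × ℤ}
    (h : 0 < H.truncCoeff d₁ d₂ (ℓ + 1) J n K) : 0 < H.truncCoeff d₁ d₂ ℓ J' (n + 1) K := by
  induction n generalizing K with
  | zero =>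
    have hKJ : K = J := by
      by_contra hne; simp [truncCoeff, hne] at h
    subst hKJ
    exact H.truncCoeff_succ_pos_iff.2 ⟨hns, J', hJ', by simp [truncCoeff], hpar⟩
  | succ n ih =>
    obtain ⟨h1, K', hK', h2, h3⟩ := H.truncCoeff_succ_pos_iff.1 h
    have e : ℓ + 1 + n = ℓ + (n + 1) := by ring
    rw [e] at h1 hK'
    exact H.truncCoeff_succ_pos_iff.2 ⟨h1, K', hK', ih h2, h3⟩

/-- Preservation of coefficients: a function which lies in the B-spline space of every level is the
combination of the THB-splines with, at each level, its coefficients in the B-spline basis of that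
level. -/
theorem sum_thb_eq (hd₁ : 1 ≤ d₁) (hd₂ : 1 ≤ d₂) {P : ℝ × ℝ → ℝ} {σ : ℕ → ℤ × ℤ → ℝ}
    (h : ∀ ℓ, ∀ p ∈ H.domain, P p = ∑ J ∈ H.indices d₁ d₂ ℓ, σ ℓ J * H.basisFun d₁ d₂ ℓ J p)
    {p : ℝ × ℝ} (hp : p ∈ H.domain) :
    ∑ ℓ ∈ Finset.range H.M, ∑ J ∈ H.activeIndices d₁ d₂ ℓ, σ ℓ J * H.thb d₁ d₂ ℓ J p = P p := by
  classical
  have hcons : ∀ ℓ, ∀ K ∈ H.indices d₁ d₂ (ℓ + 1),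
      ∑ J ∈ H.indices d₁ d₂ ℓ, σ ℓ J * TensorGrid.refineCoeff d₁ d₂ J K = σ (ℓ + 1) K := by
    intro ℓ K hK
    rw [← H.coeffs_eq hd₁ hd₂ (h (ℓ + 1)) hK, H.coeffs_eq hd₁ hd₂ (s := P) (σ := fun K =>
      ∑ J ∈ H.indices d₁ d₂ ℓ, σ ℓ J * TensorGrid.refineCoeff d₁ d₂ J K) (fun q hq => by
        rw [h ℓ q hq, H.sum_refine hd₁ hd₂ _ _ hq]) hK]
  -- the part of the sum of the levels up to `n`, truncated up to level `n`
  have key : ∀ n, ∀ K ∈ H.indices d₁ d₂ n,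
      ∑ ℓ ∈ Finset.range (n + 1), ∑ J ∈ H.activeIndices d₁ d₂ ℓ,
        σ ℓ J * H.truncCoeff d₁ d₂ ℓ J (n - ℓ) K =
      if H.suppBasis d₁ d₂ n K ⊆ H.sub (n + 1) then 0 else σ n K := by
    intro n
    have hlast : ∀ m, ∀ K ∈ H.indices d₁ d₂ m,
        ∑ J ∈ H.activeIndices d₁ d₂ m, σ m J * H.truncCoeff d₁ d₂ m J (m - m) K =
        if H.suppBasis d₁ d₂ m K ⊆ H.sub m ∧ ¬ H.suppBasis d₁ d₂ m K ⊆ H.sub (m + 1)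
          then σ m K else 0 := by
      intro m K hK
      simp [truncCoeff, activeIndices, hK]
    induction n with
    | zero =>
      intro K hK
      rw [zero_add, Finset.sum_range_one, hlast 0 K hK, H.sub_zero]
      have : H.suppBasis d₁ d₂ 0 K ⊆ H.domain := inter_subset_right
      by_cases hs : H.suppBasis d₁ d₂ 0 K ⊆ H.sub (0 + 1) <;> simp [this, hs]
    | succ n ih =>
      intro K hK
      rw [Finset.sum_range_succ, hlast (n + 1) K hK]
      by_cases hs : H.suppBasis d₁ d₂ (n + 1) K ⊆ H.sub (n + 1)
      · have hz : ∑ ℓ ∈ Finset.range (n + 1), ∑ J ∈ H.activeIndices d₁ d₂ ℓ,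
            σ ℓ J * H.truncCoeff d₁ d₂ ℓ J (n + 1 - ℓ) K = 0 := by
          refine Finset.sum_eq_zero fun ℓ hℓ => Finset.sum_eq_zero fun J _ => ?_
          rw [Finset.mem_range] at hℓ
          rw [show n + 1 - ℓ = n - ℓ + 1 by omega, truncCoeff, if_pos, mul_zero]
          rwa [show ℓ + (n - ℓ) + 1 = n + 1 by omega]
        rw [hz, zero_add]
        by_cases hs2 : H.suppBasis d₁ d₂ (n + 1) K ⊆ H.sub (n + 1 + 1)
        · rw [if_neg (fun h => h.2 hs2), if_pos hs2]
        · rw [if_pos ⟨hs, hs2⟩, if_neg hs2]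
      · have hs2 : ¬ H.suppBasis d₁ d₂ (n + 1) K ⊆ H.sub (n + 1 + 1) :=
          fun h => hs (h.trans (H.sub_succ_subset _))
        rw [if_neg (fun h => hs h.1), add_zero, if_neg hs2, ← hcons n K hK]
        have e : ∀ ℓ ∈ Finset.range (n + 1), ∑ J ∈ H.activeIndices d₁ d₂ ℓ,
            σ ℓ J * H.truncCoeff d₁ d₂ ℓ J (n + 1 - ℓ) K =
            ∑ K' ∈ H.indices d₁ d₂ n, (∑ J ∈ H.activeIndices d₁ d₂ ℓ,
              σ ℓ J * H.truncCoeff d₁ d₂ ℓ J (n - ℓ) K') * TensorGrid.refineCoeff d₁ d₂ K' K := by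
          intro ℓ hℓ
          rw [Finset.mem_range] at hℓ
          simp only [Finset.sum_mul]
          rw [Finset.sum_comm]
          refine Finset.sum_congr rfl fun J _ => ?_
          rw [show n + 1 - ℓ = n - ℓ + 1 by omega, truncCoeff,
            show ℓ + (n - ℓ) + 1 = n + 1 by omega, show ℓ + (n - ℓ) = n by omega, if_neg hs,
            Finset.mul_sum]
          exact Finset.sum_congr rfl fun K' _ => by ring
        rw [Finset.sum_congr rfl e, Finset.sum_comm]
        refine Finset.sum_congr rfl fun K' hK' => ?_
        rw [← Finset.sum_mul, ih K' hK']
        rcases (TensorGrid.refineCoeff_nonneg (d₁ := d₁) (d₂ := d₂) K' K).eq_or_lt with h0 | h0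
        · rw [← h0, mul_zero, mul_zero]
        · rw [if_neg fun h => hs ((H.suppBasis_mono hd₁ hd₂ h0).trans h)]
  have hM := H.M_pos
  have hfin := key (H.M - 1)
  rw [show H.M - 1 + 1 = H.M by omega] at hfin
  have e : ∑ K ∈ H.indices d₁ d₂ (H.M - 1),
        σ (H.M - 1) K * H.basisFun d₁ d₂ (H.M - 1) K p =
      ∑ K ∈ H.indices d₁ d₂ (H.M - 1), (∑ ℓ ∈ Finset.range H.M, ∑ J ∈ H.activeIndices d₁ d₂ ℓ,
        σ ℓ J * H.truncCoeff d₁ d₂ ℓ J (H.M - 1 - ℓ) K) * H.basisFun d₁ d₂ (H.M - 1) K p := by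
    refine Finset.sum_congr rfl fun K hK => ?_
    rw [hfin K hK, if_neg fun hsub => ?_]
    rw [H.sub_eq_empty _ le_rfl, subset_empty_iff] at hsub
    exact (H.suppBasis_nonempty hd₁ hd₂ hK).ne_empty hsub
  rw [h (H.M - 1) p hp, e]
  simp only [Finset.sum_mul]
  rw [Finset.sum_comm]
  refine Finset.sum_congr rfl fun ℓ hℓ => ?_
  rw [Finset.sum_comm]
  refine Finset.sum_congr rfl fun J hJ => ?_
  rw [Finset.mem_range] at hℓ
  rw [thb, H.truncIter_eq hd₁ hd₂ (Finset.mem_filter.1 hJ).1 _ p hp, Finset.mul_sum,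
    show ℓ + (H.M - 1 - ℓ) = H.M - 1 by omega]
  exact Finset.sum_congr rfl fun K _ => by ring

end Hierarchy

end

section

open Set

/-! ### Cells and the supports of the functionals -/

namespace TensorGrid

variable (G : TensorGrid) {d₁ d₂ : ℕ}

/-- The closed cell of level `k` with lower left corner of index `n`. -/
def cell (k : ℕ) (n : ℤ × ℤ) : Set (ℝ × ℝ) :=
  Icc (G.nodeX k n.1) (G.nodeX k (n.1 + 1)) ×ˢ Icc (G.nodeY k n.2) (G.nodeY k (n.2 + 1))

/-- The interior of the cell of level `k` with lower left corner of index `n`. -/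
def openCell (k : ℕ) (n : ℤ × ℤ) : Set (ℝ × ℝ) :=
  Ioo (G.nodeX k n.1) (G.nodeX k (n.1 + 1)) ×ˢ Ioo (G.nodeY k n.2) (G.nodeY k (n.2 + 1))

lemma nodeX_le_iff {k : ℕ} {i : ℤ} {p : ℝ × ℝ} : G.nodeX k i ≤ p.1 ↔ (i : ℝ) ≤ G.coordX k p := by
  rw [nodeX, coordX, le_div_iff₀ (G.stepX_pos k)]; constructor <;> intro h <;> linarith

lemma le_nodeX_iff {k : ℕ} {i : ℤ} {p : ℝ × ℝ} : p.1 ≤ G.nodeX k i ↔ G.coordX k p ≤ i := by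
  rw [nodeX, coordX, div_le_iff₀ (G.stepX_pos k)]; constructor <;> intro h <;> linarith

lemma nodeY_le_iff {k : ℕ} {j : ℤ} {p : ℝ × ℝ} : G.nodeY k j ≤ p.2 ↔ (j : ℝ) ≤ G.coordY k p := by
  rw [nodeY, coordY, le_div_iff₀ (G.stepY_pos k)]; constructor <;> intro h <;> linarith

lemma le_nodeY_iff {k : ℕ} {j : ℤ} {p : ℝ × ℝ} : p.2 ≤ G.nodeY k j ↔ G.coordY k p ≤ j := by
  rw [nodeY, coordY, div_le_iff₀ (G.stepY_pos k)]; constructor <;> intro h <;> linarith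

lemma mem_cell_iff {k : ℕ} {n : ℤ × ℤ} {p : ℝ × ℝ} : p ∈ G.cell k n ↔
    ((n.1 : ℝ) ≤ G.coordX k p ∧ G.coordX k p ≤ n.1 + 1) ∧
      ((n.2 : ℝ) ≤ G.coordY k p ∧ G.coordY k p ≤ n.2 + 1) := by
  rw [cell, mem_prod, mem_Icc, mem_Icc, nodeX_le_iff, le_nodeX_iff, nodeY_le_iff, le_nodeY_iff]
  push_cast; rfl

lemma mem_openCell_iff {k : ℕ} {n : ℤ × ℤ} {p : ℝ × ℝ} : p ∈ G.openCell k n ↔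
    ((n.1 : ℝ) < G.coordX k p ∧ G.coordX k p < n.1 + 1) ∧
      ((n.2 : ℝ) < G.coordY k p ∧ G.coordY k p < n.2 + 1) := by
  rw [openCell, mem_prod, mem_Ioo, mem_Ioo, ← not_le, ← not_le, ← not_le, ← not_le, nodeX_le_iff,
    le_nodeX_iff, nodeY_le_iff, le_nodeY_iff]
  push_cast; simp only [not_le]

lemma mem_functionalSupp_iff {k : ℕ} {J : ℤ × ℤ} {p : ℝ × ℝ} :
    p ∈ G.functionalSupp d₁ d₂ k J ↔
    ((J.1 : ℝ) + 1 ≤ G.coordX k p ∧ G.coordX k p ≤ J.1 + d₁) ∧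
      ((J.2 : ℝ) + 1 ≤ G.coordY k p ∧ G.coordY k p ≤ J.2 + d₂) := by
  rw [functionalSupp, mem_prod, mem_Icc, mem_Icc, nodeX_le_iff, le_nodeX_iff, nodeY_le_iff,
    le_nodeY_iff]
  push_cast; rfl

lemma openCell_subset_cell (k : ℕ) (n : ℤ × ℤ) : G.openCell k n ⊆ G.cell k n :=
  prod_mono Ioo_subset_Icc_self Ioo_subset_Icc_self

lemma nodeX_lt (k : ℕ) (i : ℤ) : G.nodeX k i < G.nodeX k (i + 1) := by
  have := G.stepX_pos k
  simp only [nodeX]; push_cast; nlinarith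

lemma nodeY_lt (k : ℕ) (j : ℤ) : G.nodeY k j < G.nodeY k (j + 1) := by
  have := G.stepY_pos k
  simp only [nodeY]; push_cast; nlinarith

lemma cell_eq_closure (k : ℕ) (n : ℤ × ℤ) : G.cell k n = closure (G.openCell k n) := by
  rw [openCell, closure_prod_eq, closure_Ioo (G.nodeX_lt k _).ne, closure_Ioo (G.nodeY_lt k _).ne]
  rfl

lemma openCell_nonempty (k : ℕ) (n : ℤ × ℤ) : (G.openCell k n).Nonempty :=
  (nonempty_Ioo.2 (G.nodeX_lt k _)).prod (nonempty_Ioo.2 (G.nodeY_lt k _))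

/-- The index `n` is that of a cell of level `k` in `Ω`. -/
def IsCellIndex (k : ℕ) (n : ℤ × ℤ) : Prop :=
  (0 ≤ n.1 ∧ n.1 < 2 ^ k * G.N₁) ∧ (0 ≤ n.2 ∧ n.2 < 2 ^ k * G.N₂)

lemma mem_cells_iff {k : ℕ} {c : Set (ℝ × ℝ)} :
    c ∈ G.cells k ↔ ∃ n, G.IsCellIndex k n ∧ c = G.cell k n := by
  constructor
  · rintro ⟨i, j, h1, h2, h3, h4, rfl⟩
    exact ⟨(i, j), ⟨⟨h1, h2⟩, h3, h4⟩, rfl⟩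
  · rintro ⟨n, ⟨⟨h1, h2⟩, h3, h4⟩, rfl⟩
    exact ⟨n.1, n.2, h1, h2, h3, h4, rfl⟩

lemma cell_subset_domain {k : ℕ} {n : ℤ × ℤ} (hn : G.IsCellIndex k n) :
    G.cell k n ⊆ G.domain := by
  intro p hp
  rw [mem_cell_iff] at hp
  rw [mem_domain_iff G k]
  obtain ⟨⟨a, b⟩, c, d⟩ := hn
  have a' : (0 : ℝ) ≤ n.1 := by exact_mod_cast a
  have b' : (n.1 : ℝ) + 1 ≤ (2 ^ k * G.N₁ : ℤ) := by exact_mod_cast b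
  have c' : (0 : ℝ) ≤ n.2 := by exact_mod_cast c
  have d' : (n.2 : ℝ) + 1 ≤ (2 ^ k * G.N₂ : ℤ) := by exact_mod_cast d
  exact ⟨⟨by linarith [hp.1.1], by linarith [hp.1.2]⟩, by linarith [hp.2.1], by linarith [hp.2.2]⟩

lemma cell_injective {k : ℕ} {n n' : ℤ × ℤ} {q : ℝ × ℝ} (h : q ∈ G.openCell k n)
    (h' : q ∈ G.cell k n') : n' = n := by
  rw [mem_openCell_iff] at h
  rw [mem_cell_iff] at h'
  have key : ∀ (a b : ℤ) (x : ℝ), (a : ℝ) < x → x < a + 1 → (b : ℝ) ≤ x → x ≤ b + 1 → b = a := by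
    intro a b x h1 h2 h3 h4
    have h5 : (b : ℝ) < (a + 1 : ℤ) := by push_cast; linarith
    have h6 : (a : ℝ) < (b + 1 : ℤ) := by push_cast; linarith
    rw [Int.cast_lt] at h5 h6
    omega
  exact Prod.ext (key _ _ _ h.1.1 h.1.2 h'.1.1 h'.1.2) (key _ _ _ h.2.1 h.2.2 h'.2.1 h'.2.2)

/-- The support of the B-spline of index `K` contains the cell of index `n` (of the same level). -/
def Covers (d₁ d₂ : ℕ) (n K : ℤ × ℤ) : Prop :=
  (n.1 - d₁ ≤ K.1 ∧ K.1 ≤ n.1) ∧ (n.2 - d₂ ≤ K.2 ∧ K.2 ≤ n.2)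

variable {G}

lemma Covers.mem_indices {k : ℕ} {n K : ℤ × ℤ} (h : Covers d₁ d₂ n K) (hn : G.IsCellIndex k n) :
    K ∈ G.indices d₁ d₂ k := by
  obtain ⟨⟨a, b⟩, c, d⟩ := h
  obtain ⟨⟨a', b'⟩, c', d'⟩ := hn
  exact Finset.mem_product.2 ⟨Finset.mem_Ico.2 ⟨by omega, by omega⟩,
    Finset.mem_Ico.2 ⟨by omega, by omega⟩⟩

lemma Covers.basisFun_pos (hd₁ : 1 ≤ d₁) (hd₂ : 1 ≤ d₂) {k : ℕ} {n K : ℤ × ℤ}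
    (h : Covers d₁ d₂ n K) {p : ℝ × ℝ} (hp : p ∈ G.openCell k n) :
    0 < G.basisFun d₁ d₂ k K p := by
  refine lt_of_le_of_ne (G.basisFun_nonneg _ _ _) (Ne.symm ((G.basisFun_ne_zero_iff hd₁ hd₂).2 ?_))
  rw [mem_openCell_iff] at hp
  obtain ⟨⟨a, b⟩, c, d⟩ := h
  have a' : (n.1 : ℝ) - d₁ ≤ K.1 := by exact_mod_cast a
  have b' : (K.1 : ℝ) ≤ n.1 := by exact_mod_cast b
  have c' : (n.2 : ℝ) - d₂ ≤ K.2 := by exact_mod_cast c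
  have d' : (K.2 : ℝ) ≤ n.2 := by exact_mod_cast d
  exact ⟨⟨by linarith [hp.1.1], by linarith [hp.1.2]⟩, by linarith [hp.2.1], by linarith [hp.2.2]⟩

lemma covers_of_basisFun_ne_zero (hd₁ : 1 ≤ d₁) (hd₂ : 1 ≤ d₂) {k : ℕ} {n K : ℤ × ℤ} {p : ℝ × ℝ}
    (hp : p ∈ G.cell k n) (h : G.basisFun d₁ d₂ k K p ≠ 0) : Covers d₁ d₂ n K := by
  rw [basisFun_ne_zero_iff G hd₁ hd₂] at h
  rw [mem_cell_iff] at hp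
  have key : ∀ (d : ℕ) (a b : ℤ) (x : ℝ), (a : ℝ) ≤ x → x ≤ a + 1 → 0 < x - b → x - b < d + 1 →
      a - d ≤ b ∧ b ≤ a := by
    intro d a b x h1 h2 h3 h4
    have h5 : (b : ℝ) < (a + 1 : ℤ) := by push_cast; linarith
    have h6 : (a : ℝ) < (b + d + 1 : ℤ) := by push_cast; linarith
    rw [Int.cast_lt] at h5 h6
    omega
  exact ⟨key _ _ _ _ hp.1.1 hp.1.2 h.1.1 h.1.2, key _ _ _ _ hp.2.1 hp.2.2 h.2.1 h.2.2⟩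

variable (G)

lemma coordX_eq_mul {k r : ℕ} (h : k ≤ r) (p : ℝ × ℝ) :
    G.coordX r p = 2 ^ (r - k) * G.coordX k p := by
  induction r, h using Nat.le_induction with
  | base => simp
  | succ r hr ih => rw [coordX_succ, ih, Nat.succ_sub hr, pow_succ]; ring

lemma coordY_eq_mul {k r : ℕ} (h : k ≤ r) (p : ℝ × ℝ) :
    G.coordY r p = 2 ^ (r - k) * G.coordY k p := by
  induction r, h using Nat.le_induction with
  | base => simp
  | succ r hr ih => rw [coordY_succ, ih, Nat.succ_sub hr, pow_succ]; ring

/-- A B-spline of a finer level that does not vanish at a point of a closed cell does not vanish at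
some interior point of the cell. -/
lemma exists_mem_openCell_basisFun_ne_zero (hd₁ : 1 ≤ d₁) (hd₂ : 1 ≤ d₂) {k r : ℕ} (hkr : k ≤ r)
    {n K : ℤ × ℤ} {p : ℝ × ℝ} (hp : p ∈ G.cell k n) (h : G.basisFun d₁ d₂ r K p ≠ 0) :
    ∃ q ∈ G.openCell k n, G.basisFun d₁ d₂ r K q ≠ 0 := by
  rw [basisFun_ne_zero_iff G hd₁ hd₂, coordX_eq_mul G hkr, coordY_eq_mul G hkr] at h
  rw [mem_cell_iff] at hp
  have key : ∀ (m x i u : ℝ), m ≤ x → x ≤ m + 1 → 0 < 2 ^ (r - k) * x - i →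
      2 ^ (r - k) * x - i < u → ∃ t, (m < t ∧ t < m + 1) ∧
        (0 < 2 ^ (r - k) * t - i ∧ 2 ^ (r - k) * t - i < u) := by
    intro m x i u h1 h2 h3 h4
    have h2k : (0 : ℝ) < 2 ^ (r - k) := by positivity
    have lo : i / 2 ^ (r - k) < x := by rw [div_lt_iff₀ h2k]; linarith
    have hi : x < (i + u) / 2 ^ (r - k) := by rw [lt_div_iff₀ h2k]; linarith
    obtain ⟨t, ht1, ht2⟩ := exists_between
      (show max m (i / 2 ^ (r - k)) < min (m + 1) ((i + u) / 2 ^ (r - k)) from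
        max_lt (lt_min (by linarith) (by linarith)) (lt_min (by linarith) (by linarith)))
    rw [max_lt_iff] at ht1
    rw [lt_min_iff] at ht2
    have ht3 := (div_lt_iff₀ h2k).1 ht1.2
    have ht4 := (lt_div_iff₀ h2k).1 ht2.2
    exact ⟨t, ⟨ht1.1, ht2.1⟩, by linarith, by linarith⟩
  obtain ⟨x, hx, hx'⟩ := key _ _ _ _ hp.1.1 hp.1.2 h.1.1 h.1.2
  obtain ⟨y, hy, hy'⟩ := key _ _ _ _ hp.2.1 hp.2.2 h.2.1 h.2.2
  obtain ⟨q, rfl, rfl⟩ := G.exists_coord k x y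
  refine ⟨q, G.mem_openCell_iff.2 ⟨hx, hy⟩, (G.basisFun_ne_zero_iff hd₁ hd₂).2 ?_⟩
  rw [coordX_eq_mul G hkr, coordY_eq_mul G hkr]
  exact ⟨hx', hy'⟩

lemma Covers.exists_mem_functionalSupp (hd₁ : 1 ≤ d₁) (hd₂ : 1 ≤ d₂) (k : ℕ) {n K : ℤ × ℤ}
    (h : Covers d₁ d₂ n K) : ∃ z ∈ G.cell k n, z ∈ G.functionalSupp d₁ d₂ k K := by
  have key : ∀ (d : ℕ) (a b : ℤ), 1 ≤ d → a - d ≤ b → b ≤ a →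
      ∃ x : ℝ, ((a : ℝ) ≤ x ∧ x ≤ a + 1) ∧ ((b : ℝ) + 1 ≤ x ∧ x ≤ b + d) := by
    intro d a b hd h1 h2
    refine ⟨((max a (b + 1) : ℤ) : ℝ), ⟨?_, ?_⟩, ?_, ?_⟩
    · exact_mod_cast (by omega : a ≤ max a (b + 1))
    · exact_mod_cast (by omega : max a (b + 1) ≤ a + 1)
    · exact_mod_cast (by omega : b + 1 ≤ max a (b + 1))
    · exact_mod_cast (by omega : max a (b + 1) ≤ b + d)
  obtain ⟨x, hx, hx'⟩ := key _ _ _ hd₁ h.1.1 h.1.2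
  obtain ⟨y, hy, hy'⟩ := key _ _ _ hd₂ h.2.1 h.2.2
  obtain ⟨z, rfl, rfl⟩ := G.exists_coord k x y
  exact ⟨z, G.mem_cell_iff.2 ⟨hx, hy⟩, G.mem_functionalSupp_iff.2 ⟨hx', hy'⟩⟩

lemma parent_mem_indices {ℓ : ℕ} {J K : ℤ × ℤ} (hK : K ∈ G.indices d₁ d₂ (ℓ + 1))
    (h : 0 < refineCoeff d₁ d₂ J K) : J ∈ G.indices d₁ d₂ ℓ := by
  rw [refineCoeff_pos_iff] at h
  obtain ⟨h1, h2⟩ := Finset.mem_product.1 hK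
  rw [Finset.mem_Ico, pow_succ, mul_right_comm] at h1 h2
  exact Finset.mem_product.2 ⟨Finset.mem_Ico.2 ⟨by omega, by omega⟩,
    Finset.mem_Ico.2 ⟨by omega, by omega⟩⟩

/-- The supports of the functionals of the parents of a B-spline cover the support of its own
functional. -/
lemma exists_parent_mem_functionalSupp (hd₁ : 2 ≤ d₁) (hd₂ : 2 ≤ d₂) {ℓ : ℕ} {K : ℤ × ℤ}
    {z : ℝ × ℝ} (hz : z ∈ G.functionalSupp d₁ d₂ (ℓ + 1) K) :
    ∃ J, 0 < refineCoeff d₁ d₂ J K ∧ z ∈ G.functionalSupp d₁ d₂ ℓ J := by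
  have key : ∀ (d : ℕ) (i : ℤ) (x : ℝ), 2 ≤ d → (i : ℝ) + 1 ≤ 2 * x → 2 * x ≤ i + d →
      ∃ i' : ℤ, (0 ≤ i - 2 * i' ∧ i - 2 * i' ≤ d + 1) ∧ ((i' : ℝ) + 1 ≤ x ∧ x ≤ i' + d) := by
    intro d i x hd h1 h2
    have hd' : (2 : ℝ) ≤ d := by exact_mod_cast hd
    obtain ⟨e, rfl | rfl⟩ := Int.even_or_odd' i
    · push_cast at h1 h2
      rcases le_or_gt ((e : ℝ) + 1) x with hx | hx
      · exact ⟨e, ⟨by omega, by omega⟩, hx, by linarith⟩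
      · refine ⟨e - 1, ⟨by omega, by omega⟩, ?_, ?_⟩ <;> push_cast <;> linarith
    · push_cast at h1 h2
      exact ⟨e, ⟨by omega, by omega⟩, by linarith, by linarith⟩
  rw [mem_functionalSupp_iff, coordX_succ, coordY_succ] at hz
  obtain ⟨i, hi, hi'⟩ := key _ _ _ hd₁ hz.1.1 hz.1.2
  obtain ⟨j, hj, hj'⟩ := key _ _ _ hd₂ hz.2.1 hz.2.2
  exact ⟨(i, j), refineCoeff_pos_iff.2 ⟨hi, hj⟩, G.mem_functionalSupp_iff.2 ⟨hi', hj'⟩⟩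

/-- The supports of the functionals of all the parents of a B-spline share a point. -/
lemma exists_common_mem_functionalSupp (hd₁ : 2 ≤ d₁) (hd₂ : 2 ≤ d₂) (ℓ : ℕ) (K : ℤ × ℤ) :
    ∃ w, ∀ J, 0 < refineCoeff d₁ d₂ J K → w ∈ G.functionalSupp d₁ d₂ ℓ J := by
  have key : ∀ (d : ℕ) (i i' : ℤ), 2 ≤ d → 0 ≤ i - 2 * i' → i - 2 * i' ≤ d + 1 →
      ((i' : ℝ) + 1 ≤ ((i / 2 + 1 : ℤ) : ℝ) ∧ ((i / 2 + 1 : ℤ) : ℝ) ≤ i' + d) := by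
    intro d i i' hd h1 h2
    constructor
    · exact_mod_cast (by omega : i' + 1 ≤ i / 2 + 1)
    · exact_mod_cast (by omega : i / 2 + 1 ≤ i' + d)
  obtain ⟨w, hx, hy⟩ := G.exists_coord ℓ ((K.1 / 2 + 1 : ℤ) : ℝ) ((K.2 / 2 + 1 : ℤ) : ℝ)
  refine ⟨w, fun J hJ => G.mem_functionalSupp_iff.2 ?_⟩
  rw [refineCoeff_pos_iff] at hJ
  rw [hx, hy]
  exact ⟨key _ _ _ hd₁ hJ.1.1 hJ.1.2, key _ _ _ hd₂ hJ.2.1 hJ.2.2⟩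

lemma functionalSupp_subset_ext {ℓ : ℕ} {J : ℤ × ℤ} (hJ : J ∈ G.indices d₁ d₂ ℓ) :
    G.functionalSupp d₁ d₂ ℓ J ⊆ G.extX d₁ ×ˢ G.extY d₂ := by
  obtain ⟨h1, h2⟩ := Finset.mem_product.1 hJ
  rw [Finset.mem_Ico] at h1 h2
  have key : ∀ (d : ℕ) (N : ℕ) (a h s : ℝ) (i : ℤ), 0 < s → h = 2 ^ ℓ * s → -(d : ℤ) ≤ i →
      i < 2 ^ ℓ * N → a - d * h ≤ a + ((i + 1 : ℤ) : ℝ) * s ∧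
        a + ((i + d : ℤ) : ℝ) * s ≤ a + N * h + d * h := by
    intro d N a h s i hs hh h0 h1
    have h0' : -(d : ℝ) ≤ i := by exact_mod_cast h0
    have h1' : (i : ℝ) ≤ 2 ^ ℓ * N := by exact_mod_cast h1.le
    have h2 : (1 : ℝ) ≤ 2 ^ ℓ := one_le_pow₀ (by norm_num)
    have hsh : s ≤ h := by rw [hh]; nlinarith
    have hd0 : (0 : ℝ) ≤ d := Nat.cast_nonneg d
    have e1 : (d : ℝ) * s ≤ d * h := by gcongr
    have e2 : (i : ℝ) * s ≤ N * h := by rw [hh]; nlinarith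
    have e3 : -(d : ℝ) * s ≤ i * s := by gcongr
    push_cast
    constructor <;> nlinarith
  have e1 : G.hx = 2 ^ ℓ * G.stepX ℓ := by unfold stepX; field_simp
  have e2 : G.hy = 2 ^ ℓ * G.stepY ℓ := by unfold stepY; field_simp
  have k1 := key d₁ G.N₁ G.a₁ G.hx _ J.1 (G.stepX_pos ℓ) e1 h1.1 h1.2
  have k2 := key d₂ G.N₂ G.a₂ G.hy _ J.2 (G.stepY_pos ℓ) e2 h2.1 h2.2
  exact prod_mono (Icc_subset_Icc k1.1 k1.2) (Icc_subset_Icc k2.1 k2.2)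

lemma domain_subset_ext : G.domain ⊆ G.extX d₁ ×ˢ G.extY d₂ := by
  have h1 : 0 ≤ (d₁ : ℝ) * G.hx := mul_nonneg (Nat.cast_nonneg _) G.hx_pos.le
  have h2 : 0 ≤ (d₂ : ℝ) * G.hy := mul_nonneg (Nat.cast_nonneg _) G.hy_pos.le
  exact prod_mono (Icc_subset_Icc (by linarith) (by linarith))
    (Icc_subset_Icc (by linarith) (by linarith))

end TensorGrid

/-! ### THB-splines on an active cell -/

namespace Hierarchy

open TensorGrid

variable (H : Hierarchy) {d₁ d₂ : ℕ}

/-- The interior of an active cell is disjoint from the next subdomain: that subdomain is a union of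
cells of the same level, so otherwise it would contain the whole cell. -/
lemma exists_cell_of_active {k : ℕ} {c : Set (ℝ × ℝ)} (hc : c ∈ H.activeCells k) :
    ∃ n, H.IsCellIndex k n ∧ c = H.cell k n ∧ Disjoint (H.openCell k n) (H.sub (k + 1)) := by
  obtain ⟨hcell, -, hfine⟩ := hc
  obtain ⟨n, hn, rfl⟩ := H.mem_cells_iff.1 hcell
  refine ⟨n, hn, rfl, Set.disjoint_left.2 fun q hq hq' => hfine ?_⟩
  obtain ⟨S, hS, hSe⟩ := H.sub_eq_union k
  have hq2 := hq'
  rw [hSe] at hq2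
  obtain ⟨c', hc'S, hqc'⟩ := hq2
  obtain ⟨n', -, rfl⟩ := H.mem_cells_iff.1 (hS hc'S)
  obtain rfl := H.cell_injective hq hqc'
  have hsub : H.cell k n' ⊆ H.sub (k + 1) := by
    rw [hSe]; exact subset_sUnion_of_mem hc'S
  -- the lower left quarter of the cell contradicts the activity of the cell
  have hle : H.cell (k + 1) (2 * n'.1, 2 * n'.2) ⊆ H.cell k n' := by
    intro p hp
    rw [mem_cell_iff, coordX_succ, coordY_succ] at hp
    rw [mem_cell_iff]
    push_cast at hp
    exact ⟨⟨by linarith [hp.1.1], by linarith [hp.1.2]⟩,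
      by linarith [hp.2.1], by linarith [hp.2.2]⟩
  refine ⟨k + 1, Nat.lt_succ_self k, _, H.mem_cells_iff.2 ⟨(2 * n'.1, 2 * n'.2), ?_, rfl⟩,
    hle.trans hsub, hle, fun h => ?_⟩
  · obtain ⟨⟨a, b⟩, c, d⟩ := hn
    refine ⟨⟨?_, ?_⟩, ?_, ?_⟩ <;> simp only [pow_succ, mul_right_comm] <;> omega
  · obtain ⟨q, hx, hy⟩ := H.exists_coord k ((n'.1 : ℝ) + 1) n'.2
    have := h (H.mem_cell_iff.2 (by rw [hx, hy]; exact ⟨⟨by linarith, le_rfl⟩, le_rfl, by linarith⟩))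
    rw [mem_cell_iff, coordX_succ, hx] at this
    push_cast at this
    linarith [this.1.2]

lemma basisFun_eq_zero_of_subset (hd₁ : 1 ≤ d₁) (hd₂ : 1 ≤ d₂) {k : ℕ} {n : ℤ × ℤ}
    (hn : H.IsCellIndex k n) (hdisj : Disjoint (H.openCell k n) (H.sub (k + 1))) {r : ℕ}
    (hr : k + 1 ≤ r) {K : ℤ × ℤ} (hK : H.suppBasis d₁ d₂ r K ⊆ H.sub r) {p : ℝ × ℝ}
    (hp : p ∈ H.cell k n) : H.basisFun d₁ d₂ r K p = 0 := by
  by_contra h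
  obtain ⟨q, hq, hq'⟩ := H.exists_mem_openCell_basisFun_ne_zero hd₁ hd₂ (by omega) hp h
  exact Set.disjoint_left.1 hdisj hq (H.sub_antitone hr (hK (H.mem_suppBasis
    (H.cell_subset_domain hn (H.openCell_subset_cell _ _ hq)) hq')))

/-- On an active cell of level `k` the truncations of the levels beyond `k` have no effect. -/
lemma thb_eq_on_cell (hd₁ : 1 ≤ d₁) (hd₂ : 1 ≤ d₂) {k : ℕ} (hk : k < H.M) {n : ℤ × ℤ}
    (hn : H.IsCellIndex k n) (hdisj : Disjoint (H.openCell k n) (H.sub (k + 1))) {ℓ : ℕ}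
    (hℓ : ℓ ≤ k) {J : ℤ × ℤ} (hJ : J ∈ H.indices d₁ d₂ ℓ) {p : ℝ × ℝ} (hp : p ∈ H.cell k n) :
    H.thb d₁ d₂ ℓ J p = ∑ K ∈ H.indices d₁ d₂ k,
      H.truncCoeff d₁ d₂ ℓ J (k - ℓ) K * H.basisFun d₁ d₂ k K p := by
  have hpΩ := H.cell_subset_domain hn hp
  have key : ∀ i, k - ℓ ≤ i → H.truncIter d₁ d₂ ℓ i (H.basisFun d₁ d₂ ℓ J) p =
      H.truncIter d₁ d₂ ℓ (k - ℓ) (H.basisFun d₁ d₂ ℓ J) p := by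
    intro i hi
    induction i, hi using Nat.le_induction with
    | base => rfl
    | succ i hi ih =>
      have href : ∀ q ∈ H.domain, H.truncIter d₁ d₂ ℓ i (H.basisFun d₁ d₂ ℓ J) q =
          ∑ K ∈ H.indices d₁ d₂ (ℓ + i + 1), (∑ K' ∈ H.indices d₁ d₂ (ℓ + i),
            H.truncCoeff d₁ d₂ ℓ J i K' * refineCoeff d₁ d₂ K' K) *
              H.basisFun d₁ d₂ (ℓ + i + 1) K q := fun q hq => by
        rw [H.truncIter_eq hd₁ hd₂ hJ i q hq, H.sum_refine hd₁ hd₂ _ _ hq]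
      rw [← ih, truncIter, H.trunc_eq hd₁ hd₂ href, href p hpΩ]
      refine Finset.sum_congr rfl fun K _ => ?_
      split_ifs with hs
      · rw [H.basisFun_eq_zero_of_subset hd₁ hd₂ hn hdisj (by omega) hs hp, mul_zero, mul_zero]
      · rfl
  rw [thb, key _ (by omega), H.truncIter_eq hd₁ hd₂ hJ _ p hpΩ, show ℓ + (k - ℓ) = k by omega]

lemma thb_pos_on_openCell (hd₁ : 1 ≤ d₁) (hd₂ : 1 ≤ d₂) {k : ℕ} (hk : k < H.M) {n : ℤ × ℤ}
    (hn : H.IsCellIndex k n) (hdisj : Disjoint (H.openCell k n) (H.sub (k + 1))) {ℓ : ℕ}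
    (hℓ : ℓ ≤ k) {J : ℤ × ℤ} (hJ : J ∈ H.indices d₁ d₂ ℓ) {K : ℤ × ℤ} (hK : Covers d₁ d₂ n K)
    (hpos : 0 < H.truncCoeff d₁ d₂ ℓ J (k - ℓ) K) {p : ℝ × ℝ} (hp : p ∈ H.openCell k n) :
    0 < H.thb d₁ d₂ ℓ J p := by
  rw [H.thb_eq_on_cell hd₁ hd₂ hk hn hdisj hℓ hJ (H.openCell_subset_cell _ _ hp)]
  exact Finset.sum_pos' (fun K' _ => mul_nonneg (H.truncCoeff_nonneg _ _ _ _)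
    (H.basisFun_nonneg _ _ _)) ⟨K, hK.mem_indices hn, mul_pos hpos (hK.basisFun_pos hd₁ hd₂ hp)⟩

lemma exists_covers_of_thb_ne_zero (hd₁ : 1 ≤ d₁) (hd₂ : 1 ≤ d₂) {k : ℕ} (hk : k < H.M)
    {n : ℤ × ℤ} (hn : H.IsCellIndex k n) (hdisj : Disjoint (H.openCell k n) (H.sub (k + 1)))
    {ℓ : ℕ} (hℓ : ℓ ≤ k) {J : ℤ × ℤ} (hJ : J ∈ H.indices d₁ d₂ ℓ) {p : ℝ × ℝ}
    (hp : p ∈ H.cell k n) (h : H.thb d₁ d₂ ℓ J p ≠ 0) :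
    ∃ K, Covers d₁ d₂ n K ∧ 0 < H.truncCoeff d₁ d₂ ℓ J (k - ℓ) K := by
  rw [H.thb_eq_on_cell hd₁ hd₂ hk hn hdisj hℓ hJ hp] at h
  obtain ⟨K, -, hK⟩ := Finset.exists_ne_zero_of_sum_ne_zero h
  exact ⟨K, covers_of_basisFun_ne_zero hd₁ hd₂ hp (right_ne_zero_of_mul hK),
    lt_of_le_of_ne (H.truncCoeff_nonneg _ _ _ _) (left_ne_zero_of_mul hK).symm⟩

end Hierarchy

end

section

open Set

/-! ### Ancestors of the B-splines acting on an active cell -/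

namespace Hierarchy

open TensorGrid

variable (H : Hierarchy) {d₁ d₂ : ℕ}

lemma truncCoeff_succ_eq_zero (hd₁ : 1 ≤ d₁) (hd₂ : 1 ≤ d₂) {r : ℕ} {K : ℤ × ℤ}
    (hs : H.suppBasis d₁ d₂ r K ⊆ H.sub (r + 1)) (i : ℕ) (K₀ : ℤ × ℤ) :
    ¬ 0 < H.truncCoeff d₁ d₂ r K (i + 1) K₀ := by
  induction i generalizing K₀ with
  | zero =>
    intro h
    obtain ⟨h1, K', -, h2, h3⟩ := H.truncCoeff_succ_pos_iff.1 h
    have : K' = K := by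
      by_contra hne; simp [truncCoeff, hne] at h2
    subst this
    exact h1 ((H.suppBasis_mono hd₁ hd₂ h3).trans hs)
  | succ i ih =>
    intro h
    obtain ⟨-, K', -, h2, -⟩ := H.truncCoeff_succ_pos_iff.1 h
    exact ih K' h2

/-- A B-spline of level `r` contained in `Ω^r`, some descendant of which survives up to level `k`
and covers an active cell of level `k`, is active and acts on the cell. -/
lemma acting_of_truncCoeff_pos (hd₁ : 1 ≤ d₁) (hd₂ : 1 ≤ d₂) {m : ℕ}
    (hadm : H.IsAdmissible d₁ d₂ m) {k : ℕ} (hk : k < H.M) {n : ℤ × ℤ}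
    (hn : H.IsCellIndex k n) (hact : H.cell k n ∈ H.activeCells k)
    (hdisj : Disjoint (H.openCell k n) (H.sub (k + 1))) {r : ℕ}
    (hr : r ≤ k) {K K₀ : ℤ × ℤ} (hK : K ∈ H.indices d₁ d₂ r) (hK₀ : Covers d₁ d₂ n K₀)
    (hpos : 0 < H.truncCoeff d₁ d₂ r K (k - r) K₀) (hs : H.suppBasis d₁ d₂ r K ⊆ H.sub r) :
    k + 1 - m ≤ r ∧ K ∈ H.actingIndices d₁ d₂ r (H.cell k n) := by
  classical
  have hactive : K ∈ H.activeIndices d₁ d₂ r := by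
    refine Finset.mem_filter.2 ⟨hK, hs, fun hs' => ?_⟩
    rcases hr.eq_or_lt with rfl | hlt
    · have : K₀ = K := by
        by_contra hne; simp [truncCoeff, hne] at hpos
      subst this
      obtain ⟨q, hq⟩ := H.openCell_nonempty r n
      exact Set.disjoint_left.1 hdisj hq (hs' (H.mem_suppBasis
        (H.cell_subset_domain hn (H.openCell_subset_cell _ _ hq))
        (hK₀.basisFun_pos hd₁ hd₂ hq).ne'))
    · rw [show k - r = (k - r - 1) + 1 by omega] at hpos
      exact H.truncCoeff_succ_eq_zero hd₁ hd₂ hs' _ _ hpos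
  have hthb : ∀ p ∈ H.openCell k n, 0 < H.thb d₁ d₂ r K p := fun p hp =>
    H.thb_pos_on_openCell hd₁ hd₂ hk hn hdisj hr hK hK₀ hpos hp
  refine ⟨?_, hactive, ?_⟩
  · obtain ⟨q, hq⟩ := H.openCell_nonempty k n
    exact (hadm.2.2 k hk _ hact r (by omega) K hactive
      ⟨q, H.openCell_subset_cell _ _ hq, (hthb q hq).ne'⟩).1
  · rw [cell_eq_closure]
    exact closure_mono fun p hp => (hthb p hp).ne'

/-- Even the inactive B-splines with a descendant acting on an active cell of level `k` belong to
the levels allowed by admissibility, since each of them has an active ancestor. -/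
lemma level_le_of_truncCoeff_pos (hd₁ : 2 ≤ d₁) (hd₂ : 2 ≤ d₂) {m : ℕ}
    (hadm : H.IsAdmissible d₁ d₂ m) {k : ℕ} (hk : k < H.M) {n : ℤ × ℤ}
    (hn : H.IsCellIndex k n) (hact : H.cell k n ∈ H.activeCells k)
    (hdisj : Disjoint (H.openCell k n) (H.sub (k + 1))) {K₀ : ℤ × ℤ} (hK₀ : Covers d₁ d₂ n K₀)
    {r : ℕ} (hr : r ≤ k) {K : ℤ × ℤ} (hK : K ∈ H.indices d₁ d₂ r)
    (hpos : 0 < H.truncCoeff d₁ d₂ r K (k - r) K₀) : k + 1 - m ≤ r := by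
  induction r generalizing K with
  | zero =>
    refine (H.acting_of_truncCoeff_pos (by omega) (by omega) hadm hk hn hact hdisj hr hK hK₀
      hpos ?_).1
    rw [H.sub_zero]; exact inter_subset_right
  | succ r ih =>
    by_cases hs : H.suppBasis d₁ d₂ (r + 1) K ⊆ H.sub (r + 1)
    · exact (H.acting_of_truncCoeff_pos (by omega) (by omega) hadm hk hn hact hdisj hr hK hK₀
        hpos hs).1
    · obtain ⟨z, hx, hy⟩ := H.exists_coord (r + 1) ((K.1 : ℝ) + 1) ((K.2 : ℝ) + 1)
      have h1 : (2 : ℝ) ≤ d₁ := by exact_mod_cast hd₁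
      have h2 : (2 : ℝ) ≤ d₂ := by exact_mod_cast hd₂
      obtain ⟨J, hJ, -⟩ := H.exists_parent_mem_functionalSupp hd₁ hd₂ (z := z) (K := K) (ℓ := r)
        (H.mem_functionalSupp_iff.2 (by
          rw [hx, hy]; exact ⟨⟨le_rfl, by linarith⟩, le_rfl, by linarith⟩))
      have hJi := H.parent_mem_indices hK hJ
      have := ih (by omega) hJi (by
        rw [show k - r = k - (r + 1) + 1 by omega]
        exact H.truncCoeff_pos_of_parent hJi hJ hs hpos)
      omega

/-- Propagation of bounds from one point of the support of the functional of a B-spline covering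
the cell to the supports of the functionals of all its active ancestors. A B-spline not contained
in the refined region is not active itself, and its functional is of no use; but the functionals of
its parents, whose supports cover the support of its own functional and share a point, are then
reached by induction on the level. -/
lemma propagate_to_ancestors (hd₁ : 2 ≤ d₁) (hd₂ : 2 ≤ d₂) {m : ℕ}
    (hadm : H.IsAdmissible d₁ d₂ m) {k : ℕ} (hk : k < H.M) {n : ℤ × ℤ}
    (hn : H.IsCellIndex k n) (hact : H.cell k n ∈ H.activeCells k)
    (hdisj : Disjoint (H.openCell k n) (H.sub (k + 1)))
    {Bd : ℝ × ℝ → ℝ → Prop} {A : ℝ} (hA : 1 ≤ A)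
    (hmono : ∀ z κ κ', κ ≤ κ' → Bd z κ → Bd z κ')
    (hprop : ∀ r K, k + 1 - m ≤ r → r ≤ k → K ∈ H.actingIndices d₁ d₂ r (H.cell k n) →
      ∀ κ, 1 ≤ κ → (∃ z ∈ H.functionalSupp d₁ d₂ r K, Bd z κ) →
        ∀ z ∈ H.functionalSupp d₁ d₂ r K, Bd z (A * κ))
    {K₀ : ℤ × ℤ} (hK₀ : Covers d₁ d₂ n K₀)
    {r : ℕ} (hr : r ≤ k) {K : ℤ × ℤ} (hK : K ∈ H.indices d₁ d₂ r)
    (hpos : 0 < H.truncCoeff d₁ d₂ r K (k - r) K₀) {κ : ℝ} (hκ : 1 ≤ κ)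
    (hz : ∃ z ∈ H.functionalSupp d₁ d₂ r K, Bd z κ) :
    (∀ z ∈ H.functionalSupp d₁ d₂ r K, Bd z (A ^ 2 ^ (r - (k + 1 - m)) * κ)) ∧
    ∀ ℓ ≤ r, ∀ J ∈ H.indices d₁ d₂ ℓ, H.suppBasis d₁ d₂ ℓ J ⊆ H.sub ℓ →
      0 < H.truncCoeff d₁ d₂ ℓ J (r - ℓ) K →
      ∀ z ∈ H.functionalSupp d₁ d₂ ℓ J, Bd z (A ^ 2 ^ (r - (k + 1 - m)) * κ) := by
  have self : ∀ r ℓ : ℕ, ∀ J K : ℤ × ℤ, ℓ ≤ r → 0 < H.truncCoeff d₁ d₂ ℓ J (r - ℓ) K →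
      H.suppBasis d₁ d₂ r K ⊆ H.sub r → ℓ = r ∧ J = K := by
    intro r ℓ J K hℓ h hs
    rcases hℓ.eq_or_lt with rfl | hlt
    · refine ⟨rfl, ?_⟩
      by_contra hne; simp [truncCoeff, Ne.symm hne] at h
    · rw [show r - ℓ = (r - ℓ - 1) + 1 by omega, truncCoeff_succ_pos_iff,
        show ℓ + (r - ℓ - 1) + 1 = r by omega] at h
      exact absurd hs h.1
  have terminal : ∀ r : ℕ, r ≤ k → ∀ K ∈ H.indices d₁ d₂ r,
      0 < H.truncCoeff d₁ d₂ r K (k - r) K₀ → H.suppBasis d₁ d₂ r K ⊆ H.sub r → ∀ κ : ℝ, 1 ≤ κ →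
      (∃ z ∈ H.functionalSupp d₁ d₂ r K, Bd z κ) →
      (∀ z ∈ H.functionalSupp d₁ d₂ r K, Bd z (A ^ 2 ^ (r - (k + 1 - m)) * κ)) ∧
      ∀ ℓ ≤ r, ∀ J ∈ H.indices d₁ d₂ ℓ, H.suppBasis d₁ d₂ ℓ J ⊆ H.sub ℓ →
        0 < H.truncCoeff d₁ d₂ ℓ J (r - ℓ) K →
        ∀ z ∈ H.functionalSupp d₁ d₂ ℓ J, Bd z (A ^ 2 ^ (r - (k + 1 - m)) * κ) := by
    intro r hr K hK hpos hs κ hκ hz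
    obtain ⟨hlev, hacting⟩ := H.acting_of_truncCoeff_pos (by omega) (by omega) hadm hk hn hact
      hdisj hr hK hK₀ hpos hs
    have h1 : ∀ z ∈ H.functionalSupp d₁ d₂ r K, Bd z (A ^ 2 ^ (r - (k + 1 - m)) * κ) := by
      intro z hzK
      refine hmono z _ _ ?_ (hprop r K hlev hr hacting κ hκ hz z hzK)
      exact mul_le_mul_of_nonneg_right (le_self_pow₀ hA (by positivity)) (by linarith)
    refine ⟨h1, fun ℓ hℓ J _ _ hJ => ?_⟩
    obtain ⟨rfl, rfl⟩ := self r ℓ J K hℓ hJ hs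
    exact h1
  induction r generalizing K κ with
  | zero =>
    refine terminal 0 hr K hK hpos ?_ κ hκ hz
    rw [H.sub_zero]; exact inter_subset_right
  | succ r ih =>
    by_cases hs : H.suppBasis d₁ d₂ (r + 1) K ⊆ H.sub (r + 1)
    · exact terminal (r + 1) hr K hK hpos hs κ hκ hz
    have hparent : ∀ J, 0 < refineCoeff d₁ d₂ J K → J ∈ H.indices d₁ d₂ r ∧
        0 < H.truncCoeff d₁ d₂ r J (k - r) K₀ := by
      intro J hJ
      have hJi := H.parent_mem_indices hK hJ
      refine ⟨hJi, ?_⟩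
      rw [show k - r = k - (r + 1) + 1 by omega]
      exact H.truncCoeff_pos_of_parent hJi hJ hs hpos
    obtain ⟨z, hzK, hzB⟩ := hz
    obtain ⟨J₀, hJ₀, hzJ₀⟩ := H.exists_parent_mem_functionalSupp hd₁ hd₂ hzK
    obtain ⟨w, hw⟩ := H.exists_common_mem_functionalSupp hd₁ hd₂ r K
    have hlev := H.level_le_of_truncCoeff_pos hd₁ hd₂ hadm hk hn hact hdisj hK₀ (by omega)
      (hparent J₀ hJ₀).1 (hparent J₀ hJ₀).2
    set e := 2 ^ (r - (k + 1 - m)) with he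
    have he2 : 2 ^ (r + 1 - (k + 1 - m)) = e + e := by
      rw [Nat.succ_sub hlev, pow_succ, he]; ring
    have hwB : Bd w (A ^ e * κ) :=
      (ih (by omega) (hparent J₀ hJ₀).1 (hparent J₀ hJ₀).2 hκ ⟨z, hzJ₀, hzB⟩).1 w (hw J₀ hJ₀)
    have hκ' : 1 ≤ A ^ e * κ := one_le_mul_of_one_le_of_one_le (one_le_pow₀ hA) hκ
    have hall : ∀ J, (hJ : 0 < refineCoeff d₁ d₂ J K) → _ := fun J hJ =>
      ih (by omega) (hparent J hJ).1 (hparent J hJ).2 hκ' ⟨w, hw J hJ, hwB⟩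
    rw [he2, pow_add, mul_assoc]
    refine ⟨fun z' hz' => ?_, fun ℓ hℓ J hJ hsJ hJpos => ?_⟩
    · obtain ⟨J, hJ, hzJ⟩ := H.exists_parent_mem_functionalSupp hd₁ hd₂ hz'
      exact (hall J hJ).1 z' hzJ
    · rcases hℓ.eq_or_lt with rfl | hlt
      · have : J = K := by
          by_contra hne; simp [truncCoeff, Ne.symm hne] at hJpos
        subst this
        exact absurd hsJ hs
      · rw [show r + 1 - ℓ = r - ℓ + 1 by omega, truncCoeff_succ_pos_iff,
          show ℓ + (r - ℓ) = r by omega] at hJpos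
        obtain ⟨-, K', -, h2, h3⟩ := hJpos
        exact (hall K' h3).2 ℓ (by omega) J hJ hsJ h2

end Hierarchy

end

section

open Set Polynomial

/-! ### Taylor polynomials and the functionals of the tensor-product scheme -/

/-- The polynomial `(X - x₀) ^ a / a!`. -/
def taylorMonomial (x₀ : ℝ) (a : ℕ) : ℝ[X] := C ((a.factorial : ℝ)⁻¹) * (X - C x₀) ^ a

lemma derivative_taylorMonomial (x₀ : ℝ) (a : ℕ) :
    derivative (taylorMonomial x₀ (a + 1)) = taylorMonomial x₀ a := by
  have h : ((a : ℝ) + 1) ≠ 0 := by positivity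
  have h' : (a.factorial : ℝ) ≠ 0 := by positivity
  rw [taylorMonomial, taylorMonomial, derivative_C_mul, derivative_X_sub_C_pow, Nat.add_sub_cancel,
    ← mul_assoc, ← C_mul]
  congr 2
  rw [Nat.factorial_succ]; push_cast
  field_simp

lemma iterate_derivative_taylorMonomial (x₀ : ℝ) (a r : ℕ) :
    derivative^[r] (taylorMonomial x₀ a) = if r ≤ a then taylorMonomial x₀ (a - r) else 0 := by
  induction r generalizing a with
  | zero => simp
  | succ r ih =>
    rw [Function.iterate_succ_apply]
    rcases a with _ | a
    · have : derivative (taylorMonomial x₀ 0) = 0 := by simp [taylorMonomial]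
      rw [this]; simp
    · rw [derivative_taylorMonomial, ih]; simp

lemma taylorMonomial_eval_self (x₀ : ℝ) (a : ℕ) :
    (taylorMonomial x₀ a).eval x₀ = if a = 0 then 1 else 0 := by
  rcases a with _ | a <;> simp [taylorMonomial]

lemma natDegree_taylorMonomial (x₀ : ℝ) (a : ℕ) : (taylorMonomial x₀ a).natDegree ≤ a := by
  refine (natDegree_C_mul_le _ _).trans (natDegree_pow_le.trans ?_)
  rw [natDegree_X_sub_C, mul_one]

/-- The partial derivatives of the polynomial of bidegree `(p, q)` whose derivatives of orders
`(a, b)`, `a ≤ p`, `b ≤ q`, at the point `z₀` are `c a b`. -/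
def taylorFamily (p q : ℕ) (z₀ : ℝ × ℝ) (c : ℕ → ℕ → ℝ) (r s : ℕ) (z : ℝ × ℝ) : ℝ :=
  ∑ a ∈ Finset.range (p + 1), ∑ b ∈ Finset.range (q + 1),
    c a b * ((derivative^[r] (taylorMonomial z₀.1 a)).eval z.1 *
      (derivative^[s] (taylorMonomial z₀.2 b)).eval z.2)

lemma taylorFamily_self {p q r s : ℕ} (hr : r ≤ p) (hs : s ≤ q) (z₀ : ℝ × ℝ) (c : ℕ → ℕ → ℝ) :
    taylorFamily p q z₀ c r s z₀ = c r s := by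
  have e : ∀ (x₀ : ℝ) (a r : ℕ), (derivative^[r] (taylorMonomial x₀ a)).eval x₀ =
      if a = r then 1 else 0 := by
    intro x₀ a r
    rw [iterate_derivative_taylorMonomial]
    split_ifs with h1 h2 h2
    · rw [taylorMonomial_eval_self, if_pos (by omega)]
    · rw [taylorMonomial_eval_self, if_neg (by omega)]
    · omega
    · simp
  simp only [taylorFamily, e]
  rw [Finset.sum_eq_single_of_mem r (Finset.mem_range.2 (by omega)) (fun a _ ha => by simp [ha]),
    Finset.sum_eq_single_of_mem s (Finset.mem_range.2 (by omega)) (fun b _ hb => by simp [hb])]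
  simp

lemma taylorFamily_eq_zero {p q r s : ℕ} (h : p < r ∨ q < s) (z₀ : ℝ × ℝ) (c : ℕ → ℕ → ℝ)
    (z : ℝ × ℝ) : taylorFamily p q z₀ c r s z = 0 := by
  refine Finset.sum_eq_zero fun a ha => Finset.sum_eq_zero fun b hb => ?_
  rw [Finset.mem_range] at ha hb
  rw [iterate_derivative_taylorMonomial, iterate_derivative_taylorMonomial]
  rcases h with h | h
  · rw [if_neg (show ¬ r ≤ a by omega)]; simp
  · rw [if_neg (show ¬ s ≤ b by omega)]; simp

lemma partialFamily_taylorFamily (X Y : Set ℝ) (p q p' q' : ℕ) (z₀ : ℝ × ℝ) (c : ℕ → ℕ → ℝ) :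
    PartialFamily X Y 1 1 p' q' (taylorFamily p q z₀ c) := by
  refine ⟨fun r _ s _ x _ y _ => ?_, fun r _ s _ x _ y _ => ?_⟩
  · rw [div_one]
    refine HasDerivWithinAt.fun_sum fun a _ => HasDerivWithinAt.fun_sum fun b _ => ?_
    rw [Function.iterate_succ_apply']
    exact ((((derivative^[r] (taylorMonomial z₀.1 a)).hasDerivAt x).mul_const
      ((derivative^[s] (taylorMonomial z₀.2 b)).eval y)).const_mul (c a b)).hasDerivWithinAt
  · rw [div_one]
    refine HasDerivWithinAt.fun_sum fun a _ => HasDerivWithinAt.fun_sum fun b _ => ?_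
    rw [Function.iterate_succ_apply']
    exact ((((derivative^[s] (taylorMonomial z₀.2 b)).hasDerivAt y).const_mul
      ((derivative^[r] (taylorMonomial z₀.1 a)).eval x)).const_mul (c a b)).hasDerivWithinAt

lemma PartialFamily.sub_scale {X Y : Set ℝ} {p q : ℕ} {D D' : ℕ → ℕ → ℝ × ℝ → ℝ}
    (h : PartialFamily X Y 1 1 p q D) (h' : PartialFamily X Y 1 1 p q D') {hx hy : ℝ}
    (hx0 : 0 < hx) (hy0 : 0 < hy) :
    PartialFamily X Y hx hy p q (fun r s z => hx ^ r * hy ^ s * (D r s z - D' r s z)) := by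
  refine ⟨fun r hr s hs x hx y hy => ?_, fun r hr s hs x hx y hy => ?_⟩
  · refine (((h.dx r hr s hs x hx y hy).fun_sub (h'.dx r hr s hs x hx y hy)).const_mul _).congr_deriv ?_
    rw [pow_succ]; field_simp
  · refine (((h.dy r hr s hs x hx y hy).fun_sub (h'.dy r hr s hs x hx y hy)).const_mul _).congr_deriv ?_
    rw [pow_succ]; field_simp

namespace TensorGrid

variable (G : TensorGrid) {d₁ d₂ : ℕ}

/-- The functional `λ_J^ℓ` as a function of the family of the partial derivatives. -/
def familyFunctional (d₁ d₂ ℓ : ℕ) (J : ℤ × ℤ) (D : ℕ → ℕ → ℝ × ℝ → ℝ) : ℝ :=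
  ∑ r : Fin d₁, ∑ s : Fin d₂,
    let z : ℝ × ℝ := (G.nodeX ℓ (J.1 + ((r : ℕ) : ℤ) + 1), G.nodeY ℓ (J.2 + ((s : ℕ) : ℤ) + 1))
    bsAlpha d₂ s * D 0 0 z * bsAlpha d₁ r
      - G.stepX ℓ * (bsAlpha d₂ s * D 1 0 z * bsBeta d₁ r)
      - G.stepY ℓ * (bsBeta d₂ s * D 0 1 z * bsAlpha d₁ r)
      + G.stepX ℓ * G.stepY ℓ * (bsBeta d₂ s * D 1 1 z * bsBeta d₁ r)

lemma functional_eq_familyFunctional (ℓ : ℕ) (J : ℤ × ℤ) (f : ℝ × ℝ → ℝ) :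
    G.functional d₁ d₂ ℓ J f = G.familyFunctional d₁ d₂ ℓ J
      (fun r s => mixedDeriv (G.extX d₁) (G.extY d₂) r s f) := by
  simp [functional, familyFunctional, mixedDeriv]

lemma familyFunctional_sub (ℓ : ℕ) (J : ℤ × ℤ) (D D' : ℕ → ℕ → ℝ × ℝ → ℝ) :
    G.familyFunctional d₁ d₂ ℓ J (fun r s z => D r s z - D' r s z) =
      G.familyFunctional d₁ d₂ ℓ J D - G.familyFunctional d₁ d₂ ℓ J D' := by
  simp only [familyFunctional, ← Finset.sum_sub_distrib]
  exact Finset.sum_congr rfl fun r _ => Finset.sum_congr rfl fun s _ => by ring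

lemma familyFunctional_taylorFamily (p q ℓ : ℕ) (J : ℤ × ℤ) (z₀ : ℝ × ℝ) (c : ℕ → ℕ → ℝ) :
    G.familyFunctional d₁ d₂ ℓ J (taylorFamily p q z₀ c) =
      ∑ a ∈ Finset.range (p + 1), ∑ b ∈ Finset.range (q + 1), c a b *
        (polyFunctional d₁ G.a₁ (G.stepX ℓ) J.1 (taylorMonomial z₀.1 a) *
          polyFunctional d₂ G.a₂ (G.stepY ℓ) J.2 (taylorMonomial z₀.2 b)) := by
  simp only [familyFunctional, taylorFamily, polyFunctional, Function.iterate_zero, id,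
    Function.iterate_one, nodeX, nodeY]
  simp only [Finset.sum_mul_sum]
  simp only [Finset.mul_sum, Finset.sum_mul, ← Finset.sum_sub_distrib, ← Finset.sum_add_distrib]
  rw [Finset.sum_congr rfl fun r _ => Finset.sum_comm, Finset.sum_comm]
  refine Finset.sum_congr rfl fun a _ => ?_
  rw [Finset.sum_congr rfl fun r _ => Finset.sum_comm, Finset.sum_comm]
  refine Finset.sum_congr rfl fun b _ => ?_
  exact Finset.sum_congr rfl fun r _ => Finset.sum_congr rfl fun s _ => by ring

/-- The tensor-product scheme reproduces the polynomials of bidegree at most `(d₁, d₂)`. -/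
lemma taylorFamily_eq_sum (hd₁ : 2 ≤ d₁) (hd₂ : 2 ≤ d₂) (ℓ : ℕ) (z₀ : ℝ × ℝ) (c : ℕ → ℕ → ℝ)
    {p : ℝ × ℝ} (hp : p ∈ G.domain) : taylorFamily d₁ d₂ z₀ c 0 0 p =
      ∑ J ∈ G.indices d₁ d₂ ℓ, G.familyFunctional d₁ d₂ ℓ J (taylorFamily d₁ d₂ z₀ c) *
        G.basisFun d₁ d₂ ℓ J p := by
  have e1 : (2 ^ ℓ * G.N₁ : ℤ) * G.stepX ℓ = G.N₁ * G.hx := by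
    unfold stepX; push_cast; field_simp
  have e2 : (2 ^ ℓ * G.N₂ : ℤ) * G.stepY ℓ = G.N₂ * G.hy := by
    unfold stepY; push_cast; field_simp
  have hX : ∀ a ∈ Finset.range (d₁ + 1), (taylorMonomial z₀.1 a).eval p.1 =
      ∑ i ∈ Finset.Ico (-(d₁ : ℤ)) (2 ^ ℓ * G.N₁),
        polyFunctional d₁ G.a₁ (G.stepX ℓ) i (taylorMonomial z₀.1 a) *
          bspline d₁ ((p.1 - G.a₁) / G.stepX ℓ - i) := fun a ha =>
    (sum_polyFunctional hd₁ (G.stepX_pos ℓ) (2 ^ ℓ * G.N₁) ((natDegree_taylorMonomial _ _).trans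
      (by rw [Finset.mem_range] at ha; omega)) hp.1.1 (by rw [e1]; exact hp.1.2)).symm
  have hY : ∀ b ∈ Finset.range (d₂ + 1), (taylorMonomial z₀.2 b).eval p.2 =
      ∑ j ∈ Finset.Ico (-(d₂ : ℤ)) (2 ^ ℓ * G.N₂),
        polyFunctional d₂ G.a₂ (G.stepY ℓ) j (taylorMonomial z₀.2 b) *
          bspline d₂ ((p.2 - G.a₂) / G.stepY ℓ - j) := fun b hb =>
    (sum_polyFunctional hd₂ (G.stepY_pos ℓ) (2 ^ ℓ * G.N₂) ((natDegree_taylorMonomial _ _).trans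
      (by rw [Finset.mem_range] at hb; omega)) hp.2.1 (by rw [e2]; exact hp.2.2)).symm
  simp only [familyFunctional_taylorFamily, Finset.sum_mul]
  rw [Finset.sum_comm]
  refine Finset.sum_congr rfl fun a ha => ?_
  rw [Finset.sum_comm]
  refine Finset.sum_congr rfl fun b hb => ?_
  rw [Function.iterate_zero, id, id, hX a ha, hY b hb, Finset.sum_mul_sum,
    Finset.mul_sum, indices, Finset.sum_product]
  refine Finset.sum_congr rfl fun i _ => ?_
  rw [Finset.mul_sum]
  refine Finset.sum_congr rfl fun j _ => ?_
  rw [basisFun]; ring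

lemma sum_basisFun_eq_one (hd₁ : 1 ≤ d₁) (hd₂ : 1 ≤ d₂) (ℓ : ℕ) {p : ℝ × ℝ} (hp : p ∈ G.domain) :
    ∑ J ∈ G.indices d₁ d₂ ℓ, G.basisFun d₁ d₂ ℓ J p = 1 := by
  obtain ⟨⟨hx0, hx1⟩, hy0, hy1⟩ := (G.mem_domain_iff ℓ p).1 hp
  have h := G.sum_basisFun (d₁ := d₁) (d₂ := d₂) ℓ (fun _ => 1) p
  simp only [one_mul] at h
  rw [h]
  simp only [sum_bspline_eq_one _ _ fun q hq => bspline_index_mem hd₂ hy0 hy1 hq, one_mul]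
  exact sum_bspline_eq_one _ _ fun q hq => bspline_index_mem hd₁ hx0 hx1 hq

/-- A bound for the norm of the functionals with respect to derivatives scaled by units of length
`hx` and `hy`, when the steps of the level are at most `R` times these units. -/
def functionalNorm (d₁ d₂ : ℕ) (R : ℝ) : ℝ := ∑ r : Fin d₁, ∑ s : Fin d₂,
  (|bsAlpha d₂ s| + R * |bsBeta d₂ s|) * (|bsAlpha d₁ r| + R * |bsBeta d₁ r|)

lemma functionalNorm_nonneg (d₁ d₂ : ℕ) {R : ℝ} (hR : 0 ≤ R) : 0 ≤ functionalNorm d₁ d₂ R :=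
  Finset.sum_nonneg fun r _ => Finset.sum_nonneg fun s _ => by positivity

lemma abs_familyFunctional_le {ℓ : ℕ} {J : ℤ × ℤ} {D : ℕ → ℕ → ℝ × ℝ → ℝ} {hx hy R B : ℝ}
    (hx0 : 0 < hx) (hy0 : 0 < hy) (hR : 0 ≤ R) (hxR : G.stepX ℓ ≤ R * hx)
    (hyR : G.stepY ℓ ≤ R * hy)
    (hB : ∀ z ∈ G.functionalSupp d₁ d₂ ℓ J, ∀ r ≤ 1, ∀ s ≤ 1, |hx ^ r * hy ^ s * D r s z| ≤ B) :
    |G.familyFunctional d₁ d₂ ℓ J D| ≤ functionalNorm d₁ d₂ R * B := by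
  rw [familyFunctional, functionalNorm, Finset.sum_mul]
  refine (Finset.abs_sum_le_sum_abs _ _).trans (Finset.sum_le_sum fun r _ => ?_)
  rw [Finset.sum_mul]
  refine (Finset.abs_sum_le_sum_abs _ _).trans (Finset.sum_le_sum fun s _ => ?_)
  have hnode : ∀ (d : ℕ) (i : ℤ) (r : Fin d), i + 1 ≤ i + ((r : ℕ) : ℤ) + 1 ∧
      i + ((r : ℕ) : ℤ) + 1 ≤ i + d := fun d i r => ⟨by omega, by have := r.2; omega⟩
  have hmono1 : ∀ i j : ℤ, i ≤ j → G.nodeX ℓ i ≤ G.nodeX ℓ j := fun i j h => by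
    have h' : (i : ℝ) ≤ j := by exact_mod_cast h
    have := G.stepX_pos ℓ
    unfold nodeX; gcongr
  have hmono2 : ∀ i j : ℤ, i ≤ j → G.nodeY ℓ i ≤ G.nodeY ℓ j := fun i j h => by
    have h' : (i : ℝ) ≤ j := by exact_mod_cast h
    have := G.stepY_pos ℓ
    unfold nodeY; gcongr
  have hz : (G.nodeX ℓ (J.1 + ((r : ℕ) : ℤ) + 1), G.nodeY ℓ (J.2 + ((s : ℕ) : ℤ) + 1)) ∈
      G.functionalSupp d₁ d₂ ℓ J :=
    ⟨⟨hmono1 _ _ (hnode d₁ J.1 r).1, hmono1 _ _ (hnode d₁ J.1 r).2⟩,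
      hmono2 _ _ (hnode d₂ J.2 s).1, hmono2 _ _ (hnode d₂ J.2 s).2⟩
  have hb := hB _ hz
  set z := (G.nodeX ℓ (J.1 + ((r : ℕ) : ℤ) + 1), G.nodeY ℓ (J.2 + ((s : ℕ) : ℤ) + 1))
  have h00 : |D 0 0 z| ≤ B := by simpa using hb 0 (by omega) 0 (by omega)
  have hB0 : 0 ≤ B := (abs_nonneg _).trans h00
  have hsx := G.stepX_pos ℓ
  have hsy := G.stepY_pos ℓ
  have h10 : |G.stepX ℓ * D 1 0 z| ≤ R * B := by
    have h := hb 1 le_rfl 0 (by omega)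
    rw [pow_one, pow_zero, mul_one, abs_mul, abs_of_pos hx0] at h
    rw [abs_mul, abs_of_pos hsx]
    calc _ ≤ R * hx * |D 1 0 z| := by gcongr
      _ = R * (hx * |D 1 0 z|) := by ring
      _ ≤ _ := by gcongr
  have h01 : |G.stepY ℓ * D 0 1 z| ≤ R * B := by
    have h := hb 0 (by omega) 1 le_rfl
    rw [pow_one, pow_zero, one_mul, abs_mul, abs_of_pos hy0] at h
    rw [abs_mul, abs_of_pos hsy]
    calc _ ≤ R * hy * |D 0 1 z| := by gcongr
      _ = R * (hy * |D 0 1 z|) := by ring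
      _ ≤ _ := by gcongr
  have h11 : |G.stepX ℓ * G.stepY ℓ * D 1 1 z| ≤ R * R * B := by
    have h := hb 1 le_rfl 1 le_rfl
    rw [pow_one, pow_one, abs_mul, abs_of_pos (mul_pos hx0 hy0)] at h
    rw [abs_mul, abs_of_pos (mul_pos hsx hsy)]
    calc _ ≤ (R * hx) * (R * hy) * |D 1 1 z| := by gcongr
      _ = R * R * (hx * hy * |D 1 1 z|) := by ring
      _ ≤ _ := by gcongr
  calc _ = |bsAlpha d₂ s * bsAlpha d₁ r * D 0 0 z
        - bsAlpha d₂ s * bsBeta d₁ r * (G.stepX ℓ * D 1 0 z)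
        - bsBeta d₂ s * bsAlpha d₁ r * (G.stepY ℓ * D 0 1 z)
        + bsBeta d₂ s * bsBeta d₁ r * (G.stepX ℓ * G.stepY ℓ * D 1 1 z)| := by congr 1; ring
    _ ≤ |bsAlpha d₂ s * bsAlpha d₁ r * D 0 0 z|
        + |bsAlpha d₂ s * bsBeta d₁ r * (G.stepX ℓ * D 1 0 z)|
        + |bsBeta d₂ s * bsAlpha d₁ r * (G.stepY ℓ * D 0 1 z)|
        + |bsBeta d₂ s * bsBeta d₁ r * (G.stepX ℓ * G.stepY ℓ * D 1 1 z)| :=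
        (abs_add_le _ _).trans (add_le_add_left ((abs_sub _ _).trans
          (add_le_add_left (abs_sub _ _) _)) _)
    _ ≤ |bsAlpha d₂ s| * |bsAlpha d₁ r| * B + |bsAlpha d₂ s| * |bsBeta d₁ r| * (R * B)
        + |bsBeta d₂ s| * |bsAlpha d₁ r| * (R * B)
        + |bsBeta d₂ s| * |bsBeta d₁ r| * (R * R * B) := by
        rw [abs_mul _ (D 0 0 z), abs_mul _ (G.stepX ℓ * D 1 0 z), abs_mul _ (G.stepY ℓ * D 0 1 z),
          abs_mul _ (G.stepX ℓ * G.stepY ℓ * D 1 1 z), abs_mul (bsAlpha d₂ s),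
          abs_mul (bsAlpha d₂ s), abs_mul (bsBeta d₂ s), abs_mul (bsBeta d₂ s)]
        gcongr
    _ = _ := by ring

end TensorGrid

end

section

open Set

/-! ### The local error estimate -/

lemma abs_le_supNorm {S T : Set (ℝ × ℝ)} {g : ℝ × ℝ → ℝ} (hT : IsCompact T)
    (hg : ContinuousOn g T) (hST : S ⊆ T) {w : ℝ × ℝ} (hw : w ∈ S) : |g w| ≤ supNorm S g := by
  refine le_csSup ?_ ⟨w, hw, rfl⟩
  exact (hT.bddAbove_image hg.abs).mono (image_mono hST)

lemma supNorm_nonneg (S : Set (ℝ × ℝ)) (g : ℝ × ℝ → ℝ) : 0 ≤ supNorm S g := by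
  refine Real.sSup_nonneg ?_
  rintro _ ⟨w, -, rfl⟩
  exact abs_nonneg _

namespace Hierarchy

open TensorGrid

variable (H : Hierarchy) {d₁ d₂ : ℕ}

lemma mem_activeIndices_iff {ℓ : ℕ} {J : ℤ × ℤ} : J ∈ H.activeIndices d₁ d₂ ℓ ↔
    J ∈ H.indices d₁ d₂ ℓ ∧ H.suppBasis d₁ d₂ ℓ J ⊆ H.sub ℓ ∧
      ¬ H.suppBasis d₁ d₂ ℓ J ⊆ H.sub (ℓ + 1) := by
  classical exact Finset.mem_filter

/-- Partition of unity. -/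
lemma sum_thb_eq_one (hd₁ : 1 ≤ d₁) (hd₂ : 1 ≤ d₂) {p : ℝ × ℝ} (hp : p ∈ H.domain) :
    ∑ ℓ ∈ Finset.range H.M, ∑ J ∈ H.activeIndices d₁ d₂ ℓ, H.thb d₁ d₂ ℓ J p = 1 := by
  simpa using H.sum_thb_eq hd₁ hd₂ (P := fun _ => 1) (σ := fun _ _ => 1)
    (fun ℓ q hq => by simpa using (H.sum_basisFun_eq_one hd₁ hd₂ ℓ hq).symm) hp

/-- The quasi-interpolant at a point of a cell is controlled by the functionals of the THB-splines
that do not vanish there, since the THB-splines form a convex partition of unity. -/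
lemma abs_sum_thb_le (hd₁ : 1 ≤ d₁) (hd₂ : 1 ≤ d₂) {p : ℝ × ℝ} (hp : p ∈ H.domain)
    {μ : ℕ → ℤ × ℤ → ℝ} {B : ℝ} (hB : ∀ ℓ < H.M, ∀ J ∈ H.activeIndices d₁ d₂ ℓ,
      H.thb d₁ d₂ ℓ J p ≠ 0 → |μ ℓ J| ≤ B) :
    |∑ ℓ ∈ Finset.range H.M, ∑ J ∈ H.activeIndices d₁ d₂ ℓ, μ ℓ J * H.thb d₁ d₂ ℓ J p| ≤ B := by
  calc _ ≤ ∑ ℓ ∈ Finset.range H.M, ∑ J ∈ H.activeIndices d₁ d₂ ℓ, B * H.thb d₁ d₂ ℓ J p := by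
        refine (Finset.abs_sum_le_sum_abs _ _).trans (Finset.sum_le_sum fun ℓ hℓ =>
          (Finset.abs_sum_le_sum_abs _ _).trans (Finset.sum_le_sum fun J hJ => ?_))
        have h0 := H.thb_nonneg hd₁ hd₂ (H.mem_activeIndices_iff.1 hJ).1 hp
        rw [abs_mul, abs_of_nonneg h0]
        by_cases hz : H.thb d₁ d₂ ℓ J p = 0
        · simp [hz]
        · exact mul_le_mul_of_nonneg_right (hB ℓ (Finset.mem_range.1 hℓ) J hJ hz) h0
    _ = B := by
        simp only [← Finset.mul_sum]
        rw [H.sum_thb_eq_one hd₁ hd₂ hp, mul_one]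

lemma localSet_subset_ext {m k : ℕ} {n : ℤ × ℤ} (hn : H.IsCellIndex k n) :
    H.localSet d₁ d₂ m k (H.cell k n) ⊆ H.extX d₁ ×ˢ H.extY d₂ := by
  intro w hw
  simp only [localSet, mem_iUnion] at hw
  obtain ⟨ℓ, -, J, hJ, hw | hw⟩ := hw
  · exact H.functionalSupp_subset_ext (H.mem_activeIndices_iff.1 hJ.1).1 hw
  · exact H.domain_subset_ext (H.cell_subset_domain hn hw)

/-- The local error estimate, with a constant that depends only on the constant of the propagation
of bounds on rectangles and on the norm of the functionals. -/
theorem abs_sub_quasiInterp_le (hd₁ : 2 ≤ d₁) (hd₂ : 2 ≤ d₂) {m : ℕ} {A : ℝ} (hA : 1 ≤ A)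
    (hAP : ∀ (a b a' b' hx hy K : ℝ) (D : ℕ → ℕ → ℝ × ℝ → ℝ) (z : ℝ × ℝ), 0 < hx → 0 < hy →
      hx ≤ b - a → b - a ≤ ((d₁ + d₂) * 2 ^ m : ℝ) * hx →
      hy ≤ b' - a' → b' - a' ≤ ((d₁ + d₂) * 2 ^ m : ℝ) * hy →
      PartialFamily (Icc a b) (Icc a' b') hx hy (d₁ + 1) (d₂ + 1) D →
      z ∈ Icc a b ×ˢ Icc a' b' → (∀ r ≤ d₁, ∀ s ≤ d₂, |D r s z| ≤ K) →
      (∀ w ∈ Icc a b ×ˢ Icc a' b', |D (d₁ + 1) 0 w| ≤ K) →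
      (∀ w ∈ Icc a b ×ˢ Icc a' b', |D 0 (d₂ + 1) w| ≤ K) →
      (∀ w ∈ Icc a b ×ˢ Icc a' b', |D (d₁ + 1) (d₂ + 1) w| ≤ K) →
      ∀ r ≤ d₁, ∀ s ≤ d₂, ∀ w ∈ Icc a b ×ˢ Icc a' b', |D r s w| ≤ A * K)
    (hadm : H.IsAdmissible d₁ d₂ m) {f : ℝ × ℝ → ℝ}
    (hf : MixedContDiffOn (d₁ + 1) (d₂ + 1) f (H.extX d₁) (H.extY d₂)) {k : ℕ} (hk : k < H.M)
    {c : Set (ℝ × ℝ)} (hc : c ∈ H.activeCells k) {p : ℝ × ℝ} (hp : p ∈ c) :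
    |f p - H.quasiInterp d₁ d₂ f p| ≤
      (A + functionalNorm d₁ d₂ (2 ^ m) * (A ^ 2 ^ m * A)) *
      (supNorm (H.localSet d₁ d₂ m k c) (mixedDeriv (H.extX d₁) (H.extY d₂) (d₁ + 1) 0 f) *
          H.stepX k ^ (d₁ + 1) +
        supNorm (H.localSet d₁ d₂ m k c) (mixedDeriv (H.extX d₁) (H.extY d₂) 0 (d₂ + 1) f) *
          H.stepY k ^ (d₂ + 1) +
        supNorm (H.localSet d₁ d₂ m k c)
          (mixedDeriv (H.extX d₁) (H.extY d₂) (d₁ + 1) (d₂ + 1) f) *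
          (H.stepX k ^ (d₁ + 1) * H.stepY k ^ (d₂ + 1))) := by
  have hd₁' : 1 ≤ d₁ := by omega
  have hd₂' : 1 ≤ d₂ := by omega
  have hd₁r : (2 : ℝ) ≤ d₁ := by exact_mod_cast hd₁
  have hd₂r : (2 : ℝ) ≤ d₂ := by exact_mod_cast hd₂
  obtain ⟨n, hn, rfl, hdisj⟩ := H.exists_cell_of_active hc
  set hx := H.stepX k with hhx
  set hy := H.stepY k with hhy
  have hx0 : 0 < hx := H.stepX_pos k
  have hy0 : 0 < hy := H.stepY_pos k
  set X := H.extX d₁ with hX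
  set Y := H.extY d₂ with hY
  set C := H.localSet d₁ d₂ m k (H.cell k n) with hC
  set E := supNorm C (mixedDeriv X Y (d₁ + 1) 0 f) * hx ^ (d₁ + 1) +
        supNorm C (mixedDeriv X Y 0 (d₂ + 1) f) * hy ^ (d₂ + 1) +
        supNorm C (mixedDeriv X Y (d₁ + 1) (d₂ + 1) f) * (hx ^ (d₁ + 1) * hy ^ (d₂ + 1)) with hE
  have hCext : C ⊆ X ×ˢ Y := H.localSet_subset_ext hn
  have hcompact : IsCompact (X ×ˢ Y) := isCompact_Icc.prod isCompact_Icc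
  have hXlt : H.a₁ - d₁ * H.hx < H.a₁ + H.N₁ * H.hx + d₁ * H.hx := by
    have h1 := H.hx_pos
    have h2 : (0 : ℝ) ≤ H.N₁ * H.hx := by positivity
    have h3 : (0 : ℝ) < d₁ * H.hx := by positivity
    linarith
  have hYlt : H.a₂ - d₂ * H.hy < H.a₂ + H.N₂ * H.hy + d₂ * H.hy := by
    have h1 := H.hy_pos
    have h2 : (0 : ℝ) ≤ H.N₂ * H.hy := by positivity
    have h3 : (0 : ℝ) < d₂ * H.hy := by positivity
    linarith
  have t1 : 0 ≤ supNorm C (mixedDeriv X Y (d₁ + 1) 0 f) * hx ^ (d₁ + 1) :=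
    mul_nonneg (supNorm_nonneg _ _) (by positivity)
  have t2 : 0 ≤ supNorm C (mixedDeriv X Y 0 (d₂ + 1) f) * hy ^ (d₂ + 1) :=
    mul_nonneg (supNorm_nonneg _ _) (by positivity)
  have t3 : 0 ≤ supNorm C (mixedDeriv X Y (d₁ + 1) (d₂ + 1) f) * (hx ^ (d₁ + 1) * hy ^ (d₂ + 1)) :=
    mul_nonneg (supNorm_nonneg _ _) (by positivity)
  have hE0 : 0 ≤ E := by linarith
  -- the error `f - P`, where `P` is the Taylor polynomial of `f` at the given point
  set P : ℕ → ℕ → ℝ × ℝ → ℝ := taylorFamily d₁ d₂ p (fun a b => mixedDeriv X Y a b f p) with hP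
  set D : ℕ → ℕ → ℝ × ℝ → ℝ :=
    fun r s z => hx ^ r * hy ^ s * (mixedDeriv X Y r s f z - P r s z) with hD
  have hDfam : PartialFamily X Y hx hy (d₁ + 1) (d₂ + 1) D :=
    (partialFamily_mixedDeriv (convex_Icc _ _) (convex_Icc _ _) (uniqueDiffOn_Icc hXlt)
      (uniqueDiffOn_Icc hYlt) hf).sub_scale (partialFamily_taylorFamily _ _ _ _ _ _ _ _) hx0 hy0
  have top : ∀ r ≤ d₁ + 1, ∀ s ≤ d₂ + 1, (d₁ < r ∨ d₂ < s) → ∀ w ∈ C,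
      |D r s w| ≤ supNorm C (mixedDeriv X Y r s f) * (hx ^ r * hy ^ s) := by
    intro r hr s hs hrs w hw
    have h0 : P r s w = 0 := taylorFamily_eq_zero hrs _ _ _
    have hpos : 0 < hx ^ r * hy ^ s := by positivity
    have e : D r s w = hx ^ r * hy ^ s * mixedDeriv X Y r s f w := by
      simp only [hD]
      rw [h0, _root_.sub_zero]
    rw [e, abs_mul, abs_of_pos hpos, mul_comm]
    exact mul_le_mul_of_nonneg_right (abs_le_supNorm hcompact (hf.continuousOn r hr s hs) hCext hw)
      hpos.le
  have top1 : ∀ w ∈ C, |D (d₁ + 1) 0 w| ≤ E := fun w hw => by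
    have := top (d₁ + 1) le_rfl 0 (by omega) (Or.inl (by omega)) w hw
    rw [pow_zero, mul_one] at this
    linarith
  have top2 : ∀ w ∈ C, |D 0 (d₂ + 1) w| ≤ E := fun w hw => by
    have := top 0 (by omega) (d₂ + 1) le_rfl (Or.inr (by omega)) w hw
    rw [pow_zero, one_mul] at this
    linarith
  have top3 : ∀ w ∈ C, |D (d₁ + 1) (d₂ + 1) w| ≤ E := fun w hw => by
    have := top (d₁ + 1) le_rfl (d₂ + 1) le_rfl (Or.inr (by omega)) w hw
    linarith
  set Bd : ℝ × ℝ → ℝ → Prop := fun z κ => ∀ r ≤ d₁, ∀ s ≤ d₂, |D r s z| ≤ κ * E with hBd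
  have hmono : ∀ z κ κ', κ ≤ κ' → Bd z κ → Bd z κ' := fun z κ κ' hκ h r hr s hs =>
    (h r hr s hs).trans (mul_le_mul_of_nonneg_right hκ hE0)
  have hrect : ∀ a b a' b' : ℝ, hx ≤ b - a → b - a ≤ ((d₁ + d₂) * 2 ^ m : ℝ) * hx →
      hy ≤ b' - a' → b' - a' ≤ ((d₁ + d₂) * 2 ^ m : ℝ) * hy → Icc a b ×ˢ Icc a' b' ⊆ C →
      ∀ κ, 1 ≤ κ → (∃ z ∈ Icc a b ×ˢ Icc a' b', Bd z κ) →
        ∀ z ∈ Icc a b ×ˢ Icc a' b', Bd z (A * κ) := by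
    rintro a b a' b' h1 h2 h3 h4 hsub κ hκ ⟨z, hz, hzB⟩ w hw r hr s hs
    have hEκ : E ≤ κ * E := le_mul_of_one_le_left hE0 hκ
    have hprod := hsub.trans hCext
    have hsX : Icc a b ⊆ X := fun x hx => (hprod (mk_mem_prod hx hz.2)).1
    have hsY : Icc a' b' ⊆ Y := fun y hy => (hprod (mk_mem_prod hz.1 hy)).2
    rw [mul_assoc]
    exact hAP a b a' b' hx hy (κ * E) D z hx0 hy0 h1 h2 h3 h4 (hDfam.mono hsX hsY) hz hzB
      (fun w hw => (top1 w (hsub hw)).trans hEκ) (fun w hw => (top2 w (hsub hw)).trans hEκ)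
      (fun w hw => (top3 w (hsub hw)).trans hEκ) r hr s hs w hw
  have h2m : (1 : ℝ) ≤ 2 ^ m := one_le_pow₀ (by norm_num)
  have hm : ∀ ℓ, k + 1 - m ≤ ℓ → ℓ ≤ k → (2 : ℝ) ^ (k - ℓ) ≤ 2 ^ m := fun ℓ h1 h2 =>
    pow_le_pow_right₀ (by norm_num) (by omega)
  have hprop : ∀ r K, k + 1 - m ≤ r → r ≤ k → K ∈ H.actingIndices d₁ d₂ r (H.cell k n) →
      ∀ κ, 1 ≤ κ → (∃ z ∈ H.functionalSupp d₁ d₂ r K, Bd z κ) →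
        ∀ z ∈ H.functionalSupp d₁ d₂ r K, Bd z (A * κ) := by
    intro r K h1 h2 hK
    have side : ∀ (d : ℕ) (R h : ℝ), 2 ≤ d → (d : ℝ) ≤ R → 0 < h →
        h ≤ (d - 1) * (2 ^ (k - r) * h) ∧ (d - 1) * (2 ^ (k - r) * h) ≤ (R * 2 ^ m) * h := by
      intro d R h hd hdR hh
      have hd' : (2 : ℝ) ≤ d := by exact_mod_cast hd
      have hp1 : (1 : ℝ) ≤ 2 ^ (k - r) := one_le_pow₀ (by norm_num)
      have hq := hm r h1 h2
      have hd1 : (1 : ℝ) ≤ d - 1 := by linarith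
      have hdR1 : (d : ℝ) - 1 ≤ R := by linarith
      have hR0 : 0 ≤ R := by linarith
      constructor
      · calc h = 1 * (1 * h) := by ring
          _ ≤ _ := by gcongr
      · calc _ ≤ R * (2 ^ m * h) := by gcongr
          _ = _ := by ring
    have s1 := side d₁ (d₁ + d₂) hx hd₁ (by linarith) hx0
    have s2 := side d₂ (d₁ + d₂) hy hd₂ (by linarith) hy0
    rw [hhx, ← H.stepX_eq_mul h2] at s1
    rw [hhy, ← H.stepY_eq_mul h2] at s2
    have w1 : H.nodeX r (K.1 + d₁) - H.nodeX r (K.1 + 1) = (d₁ - 1) * H.stepX r := by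
      simp only [nodeX]; push_cast; ring
    have w2 : H.nodeY r (K.2 + d₂) - H.nodeY r (K.2 + 1) = (d₂ - 1) * H.stepY r := by
      simp only [nodeY]; push_cast; ring
    refine hrect _ _ _ _ (by rw [w1]; exact s1.1) (by rw [w1]; exact s1.2)
      (by rw [w2]; exact s2.1) (by rw [w2]; exact s2.2) fun w hw => ?_
    simp only [hC, localSet, mem_iUnion]
    exact ⟨r, ⟨h1, h2⟩, K, hK, Or.inl hw⟩
  -- the THB-splines that do not vanish at the given point
  have hacts : ∀ ℓ < H.M, ∀ J ∈ H.activeIndices d₁ d₂ ℓ, H.thb d₁ d₂ ℓ J p ≠ 0 →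
      (k + 1 - m ≤ ℓ ∧ ℓ ≤ k) ∧ ∃ K, Covers d₁ d₂ n K ∧ 0 < H.truncCoeff d₁ d₂ ℓ J (k - ℓ) K := by
    intro ℓ hℓ J hJ h
    have hlev := hadm.2.2 k hk _ hc ℓ hℓ J hJ ⟨p, hp, h⟩
    exact ⟨hlev, H.exists_covers_of_thb_ne_zero hd₁' hd₂' hk hn hdisj hlev.2
      (H.mem_activeIndices_iff.1 hJ).1 hp h⟩
  have hpΩ : p ∈ H.domain := H.cell_subset_domain hn hp
  have hcC : H.cell k n ⊆ C := by
    obtain ⟨ℓ, hℓ, h1⟩ := Finset.exists_ne_zero_of_sum_ne_zero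
      (show ∑ ℓ ∈ Finset.range H.M, ∑ J ∈ H.activeIndices d₁ d₂ ℓ, H.thb d₁ d₂ ℓ J p ≠ 0 by
        rw [H.sum_thb_eq_one hd₁' hd₂' hpΩ]; exact one_ne_zero)
    obtain ⟨J, hJ, h2⟩ := Finset.exists_ne_zero_of_sum_ne_zero h1
    obtain ⟨hlev, K, hK, hpos⟩ := hacts ℓ (Finset.mem_range.1 hℓ) J hJ h2
    have hact := H.acting_of_truncCoeff_pos hd₁' hd₂' hadm hk hn hc hdisj hlev.2
      (H.mem_activeIndices_iff.1 hJ).1 hK hpos (H.mem_activeIndices_iff.1 hJ).2.1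
    intro w hw
    simp only [hC, localSet, mem_iUnion]
    exact ⟨ℓ, hlev, J, hact.2, Or.inr hw⟩
  have hBp : Bd p 1 := fun r hr s hs => by
    have : mixedDeriv X Y r s f p - P r s p = 0 := by
      rw [hP, taylorFamily_self hr hs, sub_self]
    rw [hD]
    simp only [this, mul_zero, abs_zero, one_mul]
    exact hE0
  have hcellB : ∀ z ∈ H.cell k n, Bd z A := by
    have w1 : H.nodeX k (n.1 + 1) - H.nodeX k n.1 = hx := by
      simp only [nodeX]; push_cast; ring
    have w2 : H.nodeY k (n.2 + 1) - H.nodeY k n.2 = hy := by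
      simp only [nodeY]; push_cast; ring
    have hL : (1 : ℝ) ≤ (d₁ + d₂) * 2 ^ m := one_le_mul_of_one_le_of_one_le (by linarith) h2m
    have := hrect _ _ _ _ w1.ge (by rw [w1]; exact le_mul_of_one_le_left hx0.le hL) w2.ge
      (by rw [w2]; exact le_mul_of_one_le_left hy0.le hL) hcC 1 le_rfl ⟨p, hp, hBp⟩
    intro z hz
    simpa using this z hz
  have hfun : ∀ ℓ < H.M, ∀ J ∈ H.activeIndices d₁ d₂ ℓ, H.thb d₁ d₂ ℓ J p ≠ 0 →
      |H.familyFunctional d₁ d₂ ℓ J (fun r s z => mixedDeriv X Y r s f z - P r s z)| ≤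
        functionalNorm d₁ d₂ (2 ^ m) * (A ^ 2 ^ m * A * E) := by
    intro ℓ hℓ J hJ h
    obtain ⟨⟨hl1, hl2⟩, K, hK, hpos⟩ := hacts ℓ hℓ J hJ h
    obtain ⟨z, hzc, hzK⟩ := hK.exists_mem_functionalSupp H.toTensorGrid hd₁' hd₂' k
    have hprp := (H.propagate_to_ancestors hd₁ hd₂ hadm hk hn hc hdisj hA hmono hprop hK le_rfl
      (hK.mem_indices hn) (by simp [truncCoeff]) hA ⟨z, hzK, hcellB z hzc⟩).2 ℓ hl2 J
      (H.mem_activeIndices_iff.1 hJ).1 (H.mem_activeIndices_iff.1 hJ).2.1 hpos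
    refine H.abs_familyFunctional_le hx0 hy0 (by positivity) ?_ ?_ fun w hw r hr s hs => ?_
    · rw [H.stepX_eq_mul hl2]; exact mul_le_mul_of_nonneg_right (hm ℓ hl1 hl2) hx0.le
    · rw [H.stepY_eq_mul hl2]; exact mul_le_mul_of_nonneg_right (hm ℓ hl1 hl2) hy0.le
    · refine (hprp w hw r (by omega) s (by omega)).trans ?_
      have : A ^ 2 ^ (k - (k + 1 - m)) ≤ A ^ 2 ^ m :=
        pow_le_pow_right₀ hA (Nat.pow_le_pow_right (by norm_num) (by omega))
      gcongr
  have hQ : H.quasiInterp d₁ d₂ f p = ∑ ℓ ∈ Finset.range H.M, ∑ J ∈ H.activeIndices d₁ d₂ ℓ,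
      H.familyFunctional d₁ d₂ ℓ J (fun r s z => mixedDeriv X Y r s f z - P r s z) *
        H.thb d₁ d₂ ℓ J p + P 0 0 p := by
    rw [← H.sum_thb_eq hd₁' hd₂' (P := P 0 0) (σ := fun ℓ J => H.familyFunctional d₁ d₂ ℓ J P)
      (fun ℓ q hq => H.taylorFamily_eq_sum hd₁ hd₂ ℓ _ _ hq) hpΩ, ← Finset.sum_add_distrib]
    refine Finset.sum_congr rfl fun ℓ _ => ?_
    rw [← Finset.sum_add_distrib]
    refine Finset.sum_congr rfl fun J _ => ?_
    rw [functional_eq_familyFunctional, familyFunctional_sub]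
    ring
  have hfp : f p - P 0 0 p = 0 := by
    rw [hP, taylorFamily_self (Nat.zero_le _) (Nat.zero_le _)]
    simp [mixedDeriv]
  have hsum := H.abs_sum_thb_le hd₁' hd₂' hpΩ hfun
  have hA0 : 0 ≤ A * E := by positivity
  rw [hQ, show ∀ S : ℝ, f p - (S + P 0 0 p) = -S + (f p - P 0 0 p) from fun S => by ring, hfp,
    add_zero, abs_neg]
  refine hsum.trans ?_
  linarith [show (A + functionalNorm d₁ d₂ (2 ^ m) * (A ^ 2 ^ m * A)) * E =
    A * E + functionalNorm d₁ d₂ (2 ^ m) * (A ^ 2 ^ m * A * E) by ring]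

end Hierarchy

end

end HermiteBS

end

theorem theorem1 (d₁ d₂ m : ℕ) (hd₁ : 2 ≤ d₁) (hd₂ : 2 ≤ d₂) :
    ∃ v₁ v₂ v₃ : ℝ, 0 < v₁ ∧ 0 < v₂ ∧ 0 < v₃ ∧
      ∀ H : HermiteBS.Hierarchy, H.IsAdmissible d₁ d₂ m →
      ∀ f : ℝ × ℝ → ℝ,
        HermiteBS.MixedContDiffOn (d₁ + 1) (d₂ + 1) f (H.extX d₁) (H.extY d₂) →
      ∀ k < H.M, ∀ c ∈ H.activeCells k, ∀ p ∈ c,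
        |f p - H.quasiInterp d₁ d₂ f p| ≤
          v₁ * HermiteBS.supNorm (H.localSet d₁ d₂ m k c)
              (HermiteBS.mixedDeriv (H.extX d₁) (H.extY d₂) (d₁ + 1) 0 f) *
              H.stepX k ^ (d₁ + 1) +
          v₂ * HermiteBS.supNorm (H.localSet d₁ d₂ m k c)
              (HermiteBS.mixedDeriv (H.extX d₁) (H.extY d₂) 0 (d₂ + 1) f) *
              H.stepY k ^ (d₂ + 1) +
          v₃ * HermiteBS.supNorm (H.localSet d₁ d₂ m k c)
              (HermiteBS.mixedDeriv (H.extX d₁) (H.extY d₂) (d₁ + 1) (d₂ + 1) f) *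
              (H.stepX k ^ (d₁ + 1) * H.stepY k ^ (d₂ + 1)) := by
  obtain ⟨A, hA, hAP⟩ := HermiteBS.exists_propagation_bound d₁ d₂ ((d₁ + d₂) * 2 ^ m : ℝ)
  have hv : 0 < A + HermiteBS.TensorGrid.functionalNorm d₁ d₂ (2 ^ m) * (A ^ 2 ^ m * A) := by
    have := HermiteBS.TensorGrid.functionalNorm_nonneg d₁ d₂ (R := 2 ^ m) (by positivity)
    positivity
  refine ⟨_, _, _, hv, hv, hv, fun H hadm f hf k hk c hc p hp => ?_⟩
  refine (H.abs_sub_quasiInterp_le hd₁ hd₂ hA hAP hadm hf hk hc hp).trans (le_of_eq ?_)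
  ring
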